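/- Let $q>1$ be a real number. For a tuple $\mathbf n=(n_1,\dots,n_m)$ of non-negative integers with $n_1+\dots+n_m=n$, cut $\{1,\dots,n\}$ into consecutive blocks of sizes $n_1,\dots,n_m$. Let $S_{\mathbf n}\subseteq S_n$ be the group of permutations that preserve every block, let $l(w)$ be the number of inversions of $w$, and let $\mathcal A_n=\mathbb C[x_1^{\pm1},\dots,x_n^{\pm1}]$. Let $\mathcal H_{\mathbf n}$ be the complex affine Hecke algebra generated by the algebra $\mathcal A_n$ and elements $T_w$ ($w\in S_{\mathbf n}$), with $T_1=1$, subject to: $T_wT_{w'}=T_{ww'}$ if $l(ww')=l(w)+l(w')$; and, for each simple transposition $s_j=(j,j+1)\in S_{\mathbf n}$ and $f\in\mathcal A_n$, $$(T_{s_j}+1)(T_{s_j}-q)=0,\qquad T_{s_j}f-f^{s_j}T_{s_j}=(q-1)\,\frac{f-f^{s_j}}{1-x_{j+1}x_j^{-1}}.$$ Write $\mathcal H_n$ for the case $m=1$. There is a canonical map $\mathcal H_{\mathbf n}\to\mathcal H_n$. For $t\in(\mathbb C^\times)^n$ let $\mathcal J_{S_{\mathbf n}t}$ be the ideal of the center $\mathcal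 A_n^{S_{\mathbf n}}$ of $\mathcal H_{\mathbf n}$ that consists of the invariant Laurent polynomials vanishing at $t$; define $\mathcal J_{S_nt}\subseteq\mathcal A_n^{S_n}$ likewise. For a tuple $\mathbf i=(i_1,\dots,i_m)$ of integers with $0\le i_k\le n_k$, the first $n_k-i_k$ and the last $i_k$ coordinates of each block define commuting maps $\mathcal H_{\mathbf n-\mathbf i}\to\mathcal H_{\mathbf n}$ and $\mathcal H_{\mathbf i}\to\mathcal H_{\mathbf n}$, where $\mathbf n-\mathbf i=(n_1-i_1,\dots,n_m-i_m)$. Let $\mathbf S_{\mathbf i}^{\mathbf n}\in\mathcal H_{\mathbf n}$ be the image of the sign projector $$\mathbf S_{\mathbf i}=\Big(\sum_{w\in S_{\mathbf i}}q^{-l(w)}\Big)^{-1}\sum_{w\in S_{\mathbf i}}(-1/q)^{l(w)}T_w\in\mathcal H_{\mathbf i},$$ and for an $\mathcal H_{\mathbf n}$-module $\sigma$ let $\mathbf{BZ}^{\mathbf n}_{\mathbf i}(\sigma)=\mathbf S_{\mathbf i}^{\mathbf n}\sigma$, which is an $\mathcal H_{\mathbf n-\mathbf i}$-module. For $m=1$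 and $0\le i\le n$ this gives the derivative $\mathbf{BZ}_i(\pi)$ of an $\mathcal H_n$-module $\pi$, which is an $\mathcal H_{n-i}$-module. **Theorem (Leibniz rule).** Let $t=(t_1,\dots,t_n)\in(\mathbb C^\times)^n$ be such that, for all $j,k$, one has $t_j/|t_j|=t_k/|t_k|$ if and only if $j$ and $k$ lie in the same block of $\mathbf n$. Let $\sigma$ be a finite-dimensional $\mathcal H_{\mathbf n}$-module annihilated by a power of $\mathcal J_{S_{\mathbf n}t}$, and let $\pi$ be a finite-dimensional $\mathcal H_n$-module annihilated by a power of $\mathcal J_{S_nt}$ such that $\pi\cong\mathcal H_n\otimes_{\mathcal H_{\mathbf n}}\sigma$. Then for every integer $i$ with $0\le i\le n$ there is an isomorphism of $\mathcal H_{n-i}$-modules $$\mathbf{BZ}_i(\pi)\;\cong\;\bigoplus_{\mathbf i}\ \mathcal H_{n-i}\otimes_{\mathcal H_{\mathbf n-\mathbf i}}\mathbf{BZ}^{\mathbf n}_{\mathbf i}(\sigma),$$ where $\mathbf i=(i_1,\dots,i_m)$ runs over all $m$-tuples of integers with $0\le i_k\le n_k$ for all $k$ and $i_1+\dots+i_m=i$.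 -/

import Mathlib

open scoped TensorProduct DirectSum

noncomputable section

namespace BZ

/-! ### Root data of type A with blocks

The lattice is `ℤ^I` for a finite linearly ordered set `I` of coordinates, and `b : I →o κ` is a
monotone map, whose fibres (the blocks) are intervals of `I`.  The roots are the `ε_a - ε_a'` with
`a ≠ a'` in the same block, positive if `a < a'`, and simple if moreover `a'` covers `a`. The Weyl
group is the group of permutations of `I` that preserve every block. -/

/-- The Weyl group of the root system `{ε_a - ε_a' : b a = b a', a ≠ a'}`. -/
def youngSubgroup {I κ : Type} (b : I → κ) : Subgroup (Equiv.Perm I) where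
  carrier := {w | ∀ a, b (w a) = b a}
  mul_mem' := by
    intro v w hv hw a
    rw [Equiv.Perm.mul_apply, hv, hw]
  one_mem' := fun _ => rfl
  inv_mem' := by
    intro w hw a
    have h := hw (w⁻¹ a)
    rw [← Equiv.Perm.mul_apply, mul_inv_cancel] at h
    exact h.symm

instance {I κ : Type} [Finite I] (b : I → κ) : Fintype (youngSubgroup b) := Fintype.ofFinite _

section Swap

variable {I : Type} [LinearOrder I]

lemma swap_mem_youngSubgroup {κ : Type} {b : I → κ} {a a' : I} (h : b a = b a') :
    Equiv.swap a a' ∈ youngSubgroup b := by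
  intro c
  rw [Equiv.swap_apply_def]
  split_ifs with h1 h2
  · rw [h1, h]
  · rw [h2, h]
  · rfl

lemma swap_lt_swap {a a' x y : I} (h : a ⋖ a') (hxy : x < y) (hne : ¬ (x = a ∧ y = a')) :
    Equiv.swap a a' x < Equiv.swap a a' y := by
  have h1 := h.1
  have h2 := h.2
  simp only [Equiv.swap_apply_def]
  split_ifs with p1 p2 p3 p4 p5 p6 p7 p8
  · subst p1; subst p2; exact absurd hxy (lt_irrefl _)
  · exact absurd ⟨p1, p3⟩ hne
  · subst p1
    exact lt_of_le_of_ne (not_lt.mp fun hc => h2 hxy hc) (Ne.symm p3)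
  · subst p4; subst p5; exact absurd (hxy.trans h1) (lt_irrefl _)
  · subst p4; subst p6; exact absurd hxy (lt_irrefl _)
  · subst p4; exact h1.trans hxy
  · subst p7; exact hxy.trans h1
  · subst p8
    exact lt_of_le_of_ne (not_lt.mp fun hc => h2 hc hxy) p1
  · exact hxy

end Swap

section Length

variable {I : Type} [Fintype I] [LinearOrder I]

/-- The inversions of a permutation: the positive roots that it makes negative. For `w` in a group
`youngSubgroup b` with `b` monotone, only roots with both ends in one block can occur. -/
def inversions (w : Equiv.Perm I) : Finset (I × I) :=
  Finset.univ.filter fun p => p.1 < p.2 ∧ w p.2 < w p.1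

/-- The length of a permutation: its number of inversions. -/
def length (w : Equiv.Perm I) : ℕ := (inversions w).card

lemma mem_inversions {w : Equiv.Perm I} {p : I × I} :
    p ∈ inversions w ↔ p.1 < p.2 ∧ w p.2 < w p.1 := by
  simp [inversions]

lemma length_one : length (1 : Equiv.Perm I) = 0 := by
  rw [length, Finset.card_eq_zero, inversions, Finset.filter_eq_empty_iff]
  rintro p - ⟨h1, h2⟩
  exact absurd h1 (not_lt.mpr h2.le)

/-- A descent lowers the length by one. -/
lemma length_eq_of_descent {a a' : I} (h : a ⋖ a') (w : Equiv.Perm I) (hw : w a' < w a) :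
    length w = length (w * Equiv.swap a a') + 1 := by
  have hmem : (a, a') ∈ inversions w := by simp [inversions, h.1, hw]
  rw [length, length, ← Finset.card_erase_add_one hmem]
  congr 1
  refine Finset.card_bij' (fun p _ => (Equiv.swap a a' p.1, Equiv.swap a a' p.2))
    (fun p _ => (Equiv.swap a a' p.1, Equiv.swap a a' p.2)) ?_ ?_ ?_ ?_
  · rintro ⟨x, y⟩ hp
    simp only [mem_inversions, Finset.mem_erase, ne_eq,
      Prod.mk.injEq, Equiv.Perm.mul_apply, Equiv.swap_apply_self] at hp ⊢
    exact ⟨swap_lt_swap h hp.2.1 hp.1, hp.2.2⟩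
  · rintro ⟨x, y⟩ hp
    simp only [mem_inversions, Finset.mem_erase, ne_eq,
      Prod.mk.injEq, Equiv.Perm.mul_apply] at hp ⊢
    have hne : ¬ (x = a ∧ y = a') := by
      rintro ⟨rfl, rfl⟩
      rw [Equiv.swap_apply_left, Equiv.swap_apply_right] at hp
      exact absurd hp.2 (not_lt.mpr hw.le)
    refine ⟨?_, swap_lt_swap h hp.1 hne, hp.2⟩
    rintro ⟨h1, h2⟩
    rw [Equiv.swap_apply_eq_iff, Equiv.swap_apply_left] at h1
    rw [Equiv.swap_apply_eq_iff, Equiv.swap_apply_right] at h2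
    have h3 := hp.1
    rw [h1, h2] at h3
    exact absurd h3 (not_lt.mpr h.1.le)
  · rintro ⟨x, y⟩ _
    simp
  · rintro ⟨x, y⟩ _
    simp

lemma exists_descent (w : Equiv.Perm I) (hw : w ≠ 1) : ∃ a a' : I, a ⋖ a' ∧ w a' < w a := by
  classical
  by_contra! hcon
  let : LocallyFiniteOrder I := Fintype.toLocallyFiniteOrder
  have hmono : StrictMono w := (strictMono_iff_forall_covBy w).mpr fun a a' haa =>
    lt_of_le_of_ne (hcon a a' haa) fun he => haa.1.ne (w.injective he)
  apply hw
  have : hmono.orderIsoOfSurjective w w.surjective = OrderIso.refl I := Subsingleton.elim _ _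
  ext a
  exact congrArg (fun e : I ≃o I => e a) this

/-- Induction on the length inside a Weyl group. -/
lemma youngSubgroup_induction {κ : Type} [PartialOrder κ] (b : I →o κ)
    {P : (w : Equiv.Perm I) → w ∈ youngSubgroup b → Prop} (one : P 1 (Subgroup.one_mem _))
    (step : ∀ (w : Equiv.Perm I) (hw : w ∈ youngSubgroup b) (a a' : I) (_ : a ⋖ a')
      (hb : b a = b a') (_ : w a' < w a),
      P (w * Equiv.swap a a') (Subgroup.mul_mem _ hw (swap_mem_youngSubgroup hb)) → P w hw)
    (w : Equiv.Perm I) (hw : w ∈ youngSubgroup b) : P w hw := by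
  induction hl : length w using Nat.strong_induction_on generalizing w with
  | _ l ih =>
    by_cases h1 : w = 1
    · subst h1; exact one
    · obtain ⟨a, a', haa, hd⟩ := exists_descent w h1
      have hb : b a = b a' := by
        refine le_antisymm (b.monotone haa.1.le) ?_
        have := b.monotone hd.le
        rwa [hw, hw] at this
      refine step w hw a a' haa hb hd (ih _ ?_ _ _ rfl)
      have := length_eq_of_descent haa w hd
      omega

end Length

/-! ### Affine Hecke algebras -/

/-- The group algebra `𝒜 = ℂ[ℤ^I]`, i.e. the Laurent polynomials in variables indexed by `I`. -/
abbrev Laurent (I : Type) : Type := AddMonoidAlgebra ℂ (I →₀ ℤ)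

/-- The algebra map of Laurent polynomials that renames the variables along `f`. For a permutation
`w` of `I` this is the action `θ_x ↦ θ_{w x}` of `w` on `𝒜`. -/
def Laurent.rename {I J : Type} (f : I → J) : Laurent I →ₐ[ℂ] Laurent J :=
  AddMonoidAlgebra.mapDomainAlgHom ℂ ℂ (Finsupp.mapDomain.addMonoidHom f)

/-- `θ_{-α}` for the root `α = ε_a - ε_a'`. -/
def thetaNeg {I : Type} (a a' : I) : Laurent I :=
  AddMonoidAlgebra.single (Finsupp.single a' 1 - Finsupp.single a 1) 1

lemma rename_thetaNeg {I J : Type} (f : I → J) (a a' : I) :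
    Laurent.rename f (thetaNeg a a') = thetaNeg (f a) (f a') := by
  simp only [Laurent.rename, thetaNeg, AddMonoidAlgebra.mapDomainAlgHom_apply]
  rw [AddMonoidAlgebra.mapDomain_single]
  congr 1
  rw [map_sub]
  simp [Finsupp.mapDomain.addMonoidHom, Finsupp.mapDomain_single]

lemma rename_rename {I J K : Type} (f : I → J) (g : J → K) (p : Laurent I) :
    Laurent.rename g (Laurent.rename f p) = Laurent.rename (g ∘ f) p := by
  have : (Laurent.rename g).comp (Laurent.rename f) = Laurent.rename (g ∘ f) := by
    unfold Laurent.rename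
    rw [← AddMonoidAlgebra.mapDomainAlgHom_comp]
    congr 1
    ext x : 1
    exact DFunLike.ext _ _ fun _ => by simp [Finsupp.mapDomain.addMonoidHom]
  exact DFunLike.congr_fun this p

section Algebra

variable {I κ : Type} [Fintype I] [LinearOrder I] [PartialOrder κ]

/-- Generators of the affine Hecke algebra: `T_w` for `w` in the Weyl group, and the elements
of `𝒜`. -/
inductive Gen (b : I →o κ) : Type
  | T (w : youngSubgroup b) : Gen b
  | theta (f : Laurent I) : Gen b

open Gen in
/-- The defining relations of the affine Hecke algebra. The first four say that `𝒜` maps to it by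
an algebra homomorphism and that `T_1` is the unit. In the last one, with `s` the simple
reflection of the simple root `α = ε_a - ε_a'`, the Laurent polynomial `g` is the (unique) quotient
`(f - s(f)) / (1 - θ_{-α})`. -/
inductive Rel (b : I →o κ) (q : ℂ) : FreeAlgebra ℂ (Gen b) → FreeAlgebra ℂ (Gen b) → Prop
  | theta_add (f g : Laurent I) : Rel b q (FreeAlgebra.ι ℂ (theta (f + g)))
      (FreeAlgebra.ι ℂ (theta f) + FreeAlgebra.ι ℂ (theta g))
  | theta_mul (f g : Laurent I) : Rel b q (FreeAlgebra.ι ℂ (theta (f * g)))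
      (FreeAlgebra.ι ℂ (theta f) * FreeAlgebra.ι ℂ (theta g))
  | theta_algebraMap (c : ℂ) : Rel b q (FreeAlgebra.ι ℂ (theta (algebraMap ℂ (Laurent I) c)))
      (algebraMap ℂ (FreeAlgebra ℂ (Gen b)) c)
  | T_one : Rel b q (FreeAlgebra.ι ℂ (T 1)) 1
  | T_mul (v w : youngSubgroup b)
      (h : length (v * w : Equiv.Perm I) = length (v : Equiv.Perm I) + length (w : Equiv.Perm I)) :
      Rel b q (FreeAlgebra.ι ℂ (T v) * FreeAlgebra.ι ℂ (T w)) (FreeAlgebra.ι ℂ (T (v * w)))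
  | quadratic (a a' : I) (_ : a ⋖ a') (hb : b a = b a') :
      Rel b q ((FreeAlgebra.ι ℂ (T ⟨Equiv.swap a a', swap_mem_youngSubgroup hb⟩) + 1) *
        (FreeAlgebra.ι ℂ (T ⟨Equiv.swap a a', swap_mem_youngSubgroup hb⟩) -
          algebraMap ℂ (FreeAlgebra ℂ (Gen b)) q)) 0
  | bernstein (a a' : I) (_ : a ⋖ a') (hb : b a = b a') (f g : Laurent I)
      (hg : g * (1 - thetaNeg a a') = f - Laurent.rename (Equiv.swap a a') f) :
      Rel b q (FreeAlgebra.ι ℂ (T ⟨Equiv.swap a a', swap_mem_youngSubgroup hb⟩) *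
          FreeAlgebra.ι ℂ (theta f) -
        FreeAlgebra.ι ℂ (theta (Laurent.rename (Equiv.swap a a') f)) *
          FreeAlgebra.ι ℂ (T ⟨Equiv.swap a a', swap_mem_youngSubgroup hb⟩))
        ((q - 1) • FreeAlgebra.ι ℂ (theta g))

/-- The affine Hecke algebra, over `ℂ` and with parameter `q`, of the lattice `ℤ^I` with the root
system and the simple roots given by `b : I →o κ`. -/
def AffineHecke (b : I →o κ) (q : ℂ) : Type := RingQuot (Rel b q)

namespace AffineHecke

instance (b : I →o κ) (q : ℂ) : Ring (AffineHecke b q) := inferInstanceAs (Ring (RingQuot _))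

instance (b : I →o κ) (q : ℂ) : Algebra ℂ (AffineHecke b q) :=
  inferInstanceAs (Algebra ℂ (RingQuot (Rel b q)))

/-- The quotient map from the free algebra. -/
def mk (b : I →o κ) (q : ℂ) : FreeAlgebra ℂ (Gen b) →ₐ[ℂ] AffineHecke b q :=
  RingQuot.mkAlgHom ℂ (Rel b q)

/-- The element `T_w`. -/
def T (b : I →o κ) (q : ℂ) (w : youngSubgroup b) : AffineHecke b q :=
  mk b q (FreeAlgebra.ι ℂ (Gen.T w))

lemma mk_rel {b : I →o κ} {q : ℂ} {x y : FreeAlgebra ℂ (Gen b)} (h : Rel b q x y) :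
    mk b q x = mk b q y := RingQuot.mkAlgHom_rel ℂ h

/-- The algebra homomorphism `𝒜 → ℋ`. -/
def theta (b : I →o κ) (q : ℂ) : Laurent I →ₐ[ℂ] AffineHecke b q where
  toFun f := mk b q (FreeAlgebra.ι ℂ (Gen.theta f))
  map_one' := by
    have := mk_rel (Rel.theta_algebraMap (b := b) (q := q) 1)
    rwa [map_one, map_one, map_one] at this
  map_mul' f g := by simpa using mk_rel (Rel.theta_mul (b := b) (q := q) f g)
  map_zero' := by
    have := mk_rel (Rel.theta_algebraMap (b := b) (q := q) 0)
    rwa [map_zero, map_zero, map_zero] at this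
  map_add' f g := by simpa using mk_rel (Rel.theta_add (b := b) (q := q) f g)
  commutes' c := by
    have := mk_rel (Rel.theta_algebraMap (b := b) (q := q) c)
    rwa [AlgHom.commutes] at this

lemma T_one (b : I →o κ) (q : ℂ) : T b q 1 = 1 :=
  (mk_rel (Rel.T_one (b := b) (q := q))).trans (map_one _)

lemma T_mul {b : I →o κ} {q : ℂ} (v w : youngSubgroup b)
    (h : length (v * w : Equiv.Perm I) = length (v : Equiv.Perm I) + length (w : Equiv.Perm I)) :
    T b q v * T b q w = T b q (v * w) :=
  (map_mul _ _ _).symm.trans (mk_rel (Rel.T_mul (b := b) (q := q) v w h))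

/-- The simple reflection that exchanges `a` and `a'`. -/
def simple {b : I →o κ} {a a' : I} (hb : b a = b a') : youngSubgroup b :=
  ⟨Equiv.swap a a', swap_mem_youngSubgroup hb⟩

lemma quadratic {b : I →o κ} {q : ℂ} {a a' : I} (h : a ⋖ a') (hb : b a = b a') :
    (T b q (simple hb) + 1) * (T b q (simple hb) - algebraMap ℂ _ q) = 0 := by
  have := mk_rel (Rel.quadratic (b := b) (q := q) a a' h hb)
  simp only [map_mul, map_add, map_sub, map_one, map_zero, AlgHom.commutes] at this
  exact this

lemma bernstein {b : I →o κ} {q : ℂ} {a a' : I} (h : a ⋖ a') (hb : b a = b a') (f g : Laurent I)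
    (hg : g * (1 - thetaNeg a a') = f - Laurent.rename (Equiv.swap a a') f) :
    T b q (simple hb) * theta b q f
      - theta b q (Laurent.rename (Equiv.swap a a') f) * T b q (simple hb)
      = (q - 1) • theta b q g := by
  have := mk_rel (Rel.bernstein (b := b) (q := q) a a' h hb f g hg)
  simp only [map_mul, map_sub, map_smul] at this
  exact this

/-- The sign projector `(∑_w (1/q)^{l(w)})⁻¹ ∑_w (-1/q)^{l(w)} T_w`. -/
def signProjector (b : I →o κ) (q : ℂ) : AffineHecke b q :=
  (∑ w : youngSubgroup b, (1 / q) ^ length (w : Equiv.Perm I))⁻¹ •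
    ∑ w : youngSubgroup b, (-1 / q) ^ length (w : Equiv.Perm I) • T b q w

end AffineHecke

end Algebra

/-! ### Embeddings of affine Hecke algebras -/

/-- An order embedding of the coordinates that maps blocks into blocks and whose image of
every block is an interval; so it maps simple roots to simple roots. -/
structure BlockEmb {I J κ μ : Type} [LinearOrder I] [LinearOrder J] [PartialOrder κ]
    [PartialOrder μ] (b : I →o κ) (d : J →o μ) where
  emb : I ↪o J
  map_block : ∀ a a', b a = b a' → d (emb a) = d (emb a')
  interval : ∀ a a' c, b a = b a' → emb a ≤ c → c ≤ emb a' → c ∈ Set.range emb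

section PermMap

variable {I J κ μ : Type} [LinearOrder I] [LinearOrder J] [PartialOrder κ] [PartialOrder μ]
  {b : I →o κ} {d : J →o μ}

namespace BlockEmb

lemma covBy (F : BlockEmb b d) {a a' : I} (h : a ⋖ a') (hb : b a = b a') :
    F.emb a ⋖ F.emb a' := by
  refine ⟨F.emb.lt_iff_lt.mpr h.1, fun c h1 h2 => ?_⟩
  obtain ⟨e, rfl⟩ := F.interval a a' c hb h1.le h2.le
  exact h.2 (F.emb.lt_iff_lt.mp h1) (F.emb.lt_iff_lt.mp h2)

/-- The induced injection of Weyl groups: a permutation of `I` is extended by the identity outside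
the image of `I` in `J`. -/
def permMap (F : BlockEmb b d) : youngSubgroup b →* youngSubgroup d where
  toFun w := ⟨Equiv.Perm.viaEmbedding (w : Equiv.Perm I) F.emb.toEmbedding, by
    intro c
    by_cases hc : c ∈ Set.range F.emb.toEmbedding
    · obtain ⟨a, rfl⟩ := hc
      rw [Equiv.Perm.viaEmbedding_apply]
      exact F.map_block _ _ (w.2 a)
    · rw [Equiv.Perm.viaEmbedding_apply_of_notMem _ _ _ hc]⟩
  map_one' := Subtype.ext (map_one (Equiv.Perm.viaEmbeddingHom F.emb.toEmbedding))
  map_mul' v w := Subtype.ext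
    (map_mul (Equiv.Perm.viaEmbeddingHom F.emb.toEmbedding) (v : Equiv.Perm I) w)

lemma permMap_apply (F : BlockEmb b d) (w : youngSubgroup b) (a : I) :
    (F.permMap w : Equiv.Perm J) (F.emb a) = F.emb ((w : Equiv.Perm I) a) :=
  Equiv.Perm.viaEmbedding_apply (w : Equiv.Perm I) F.emb.toEmbedding a

lemma permMap_apply_of_notMem (F : BlockEmb b d) (w : youngSubgroup b) {c : J}
    (hc : c ∉ Set.range F.emb) : (F.permMap w : Equiv.Perm J) c = c :=
  Equiv.Perm.viaEmbedding_apply_of_notMem (w : Equiv.Perm I) F.emb.toEmbedding c hc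

lemma permMap_comp (F : BlockEmb b d) (w : youngSubgroup b) :
    ((F.permMap w : Equiv.Perm J) : J → J) ∘ F.emb = F.emb ∘ (w : Equiv.Perm I) :=
  funext fun a => F.permMap_apply w a

lemma permMap_simple (F : BlockEmb b d) {a a' : I} (hb : b a = b a') :
    F.permMap (AffineHecke.simple hb) = AffineHecke.simple (F.map_block a a' hb) := by
  apply Subtype.ext
  ext c
  by_cases hc : c ∈ Set.range F.emb
  · obtain ⟨e, rfl⟩ := hc
    rw [permMap_apply]
    simp only [AffineHecke.simple, Equiv.swap_apply_def, F.emb.injective.eq_iff]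
    split_ifs <;> rfl
  · rw [permMap_apply_of_notMem _ _ hc]
    simp only [AffineHecke.simple]
    rw [Equiv.swap_apply_of_ne_of_ne]
    · rintro rfl; exact hc ⟨a, rfl⟩
    · rintro rfl; exact hc ⟨a', rfl⟩

lemma rename_swap (F : BlockEmb b d) {a a' : I} (hb : b a = b a') (f : Laurent I) :
    Laurent.rename F.emb (Laurent.rename (Equiv.swap a a') f) =
      Laurent.rename (Equiv.swap (F.emb a) (F.emb a')) (Laurent.rename F.emb f) := by
  rw [rename_rename, rename_rename]
  congr 1
  have := F.permMap_comp (AffineHecke.simple hb)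
  rw [permMap_simple] at this
  exact congrArg Laurent.rename this.symm

variable [Fintype J]

/-- The induced map on generators. -/
def genMap (F : BlockEmb b d) (q : ℂ) : FreeAlgebra ℂ (Gen b) →ₐ[ℂ] AffineHecke d q :=
  FreeAlgebra.lift ℂ fun x => match x with
    | Gen.T w => AffineHecke.T d q (F.permMap w)
    | Gen.theta f => AffineHecke.theta d q (Laurent.rename F.emb f)

lemma genMap_T (F : BlockEmb b d) (q : ℂ) (w : youngSubgroup b) :
    F.genMap q (FreeAlgebra.ι ℂ (Gen.T w)) = AffineHecke.T d q (F.permMap w) := by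
  simp [genMap]

lemma genMap_theta (F : BlockEmb b d) (q : ℂ) (f : Laurent I) :
    F.genMap q (FreeAlgebra.ι ℂ (Gen.theta f)) =
      AffineHecke.theta d q (Laurent.rename F.emb f) := by
  simp [genMap]

end BlockEmb

end PermMap

section Map

variable {I J κ μ : Type} [Fintype I] [LinearOrder I] [Fintype J] [LinearOrder J]
  [PartialOrder κ] [PartialOrder μ] {b : I →o κ} {d : J →o μ}

namespace BlockEmb

lemma length_permMap (F : BlockEmb b d) (w : youngSubgroup b) :
    length (F.permMap w : Equiv.Perm J) = length (w : Equiv.Perm I) := by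
  obtain ⟨w, hw⟩ := w
  induction w, hw using youngSubgroup_induction b with
  | one =>
    have : (⟨1, Subgroup.one_mem _⟩ : youngSubgroup b) = 1 := rfl
    rw [this, map_one]
    simp [length_one]
  | step w hw a a' haa hb hd ih =>
    have h1 : length w = _ := length_eq_of_descent haa w hd
    have h2 := length_eq_of_descent (F.covBy haa hb) (F.permMap ⟨w, hw⟩ : Equiv.Perm J) (by
      rw [permMap_apply, permMap_apply]; exact F.emb.lt_iff_lt.mpr hd)
    rw [h2]
    simp only
    rw [h1, ← ih]
    congr 2
    have h3 : (⟨w * Equiv.swap a a', Subgroup.mul_mem _ hw (swap_mem_youngSubgroup hb)⟩ :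
      youngSubgroup b) = ⟨w, hw⟩ * AffineHecke.simple hb := rfl
    rw [h3, map_mul, permMap_simple]
    rfl

lemma genMap_rel (F : BlockEmb b d) (q : ℂ) ⦃x y : FreeAlgebra ℂ (Gen b)⦄ (h : Rel b q x y) :
    F.genMap q x = F.genMap q y := by
  induction h with
  | theta_add f g => simp only [map_add, genMap_theta]
  | theta_mul f g => simp only [map_mul, genMap_theta]
  | theta_algebraMap c => rw [genMap_theta, AlgHom.commutes, AlgHom.commutes, AlgHom.commutes]
  | T_one => rw [genMap_T, map_one, map_one, AffineHecke.T_one]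
  | T_mul v w h =>
    rw [map_mul, genMap_T, genMap_T, genMap_T, map_mul]
    apply AffineHecke.T_mul
    rw [length_permMap, length_permMap, ← Subgroup.coe_mul, ← map_mul, length_permMap]
    exact h
  | quadratic a a' h hb =>
    have := AffineHecke.quadratic (q := q) (F.covBy h hb) (F.map_block a a' hb)
    rw [← F.permMap_simple hb] at this
    simp only [map_mul, map_add, map_sub, map_one, map_zero, AlgHom.commutes, genMap_T]
    exact this
  | bernstein a a' h hb f g hg =>
    have hg' := congrArg (Laurent.rename F.emb) hg
    rw [map_mul, map_sub, map_one, map_sub, rename_thetaNeg, F.rename_swap hb] at hg'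
    have := AffineHecke.bernstein (q := q) (F.covBy h hb) (F.map_block a a' hb) _ _ hg'
    rw [← F.permMap_simple hb, ← F.rename_swap hb] at this
    simp only [map_mul, map_sub, map_smul, genMap_T, genMap_theta]
    exact this

end BlockEmb

namespace AffineHecke

/-- The homomorphism of affine Hecke algebras given by a block embedding: `T_w ↦ T_{w'}`, where `w'`
extends `w` by the identity, and `x_a ↦ x_{F a}`. -/
def map (F : BlockEmb b d) (q : ℂ) : AffineHecke b q →ₐ[ℂ] AffineHecke d q :=
  RingQuot.liftAlgHom ℂ ⟨F.genMap q, F.genMap_rel q⟩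

lemma map_mk (F : BlockEmb b d) (q : ℂ) (x : FreeAlgebra ℂ (Gen b)) :
    map F q (mk b q x) = F.genMap q x :=
  RingQuot.liftAlgHom_mkAlgHom_apply ℂ _ _ _

lemma map_T (F : BlockEmb b d) (q : ℂ) (w : youngSubgroup b) :
    map F q (T b q w) = T d q (F.permMap w) := by
  rw [T, map_mk, BlockEmb.genMap_T]

lemma map_theta (F : BlockEmb b d) (q : ℂ) (f : Laurent I) :
    map F q (theta b q f) = theta d q (Laurent.rename F.emb f) :=
  (map_mk F q _).trans (F.genMap_theta q f)

/-- An element that commutes with the images of the `T_s` and of `𝒜` commutes with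
everything. -/
lemma commute_map (F : BlockEmb b d) (q : ℂ) (e : AffineHecke d q)
    (hT : ∀ (a a' : I) (_ : a ⋖ a') (hb : b a = b a'),
      Commute e (T d q (simple (F.map_block a a' hb))))
    (htheta : ∀ f, Commute e (theta d q (Laurent.rename F.emb f))) (x : AffineHecke b q) :
    Commute e (map F q x) := by
  have hTw : ∀ (w : Equiv.Perm I) (hw : w ∈ youngSubgroup b),
      Commute e (map F q (T b q ⟨w, hw⟩)) := by
    intro w hw
    induction w, hw using youngSubgroup_induction b with
    | one =>
      have : (⟨1, Subgroup.one_mem _⟩ : youngSubgroup b) = 1 := rfl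
      rw [this, T_one, map_one]
      exact Commute.one_right e
    | step w hw a a' haa hb hd ih =>
      set v : youngSubgroup b :=
        ⟨w * Equiv.swap a a', Subgroup.mul_mem _ hw (swap_mem_youngSubgroup hb)⟩ with hv
      have h1 : v * simple hb = ⟨w, hw⟩ := by
        apply Subtype.ext
        simp [hv, simple, mul_assoc]
      have hs : length ((simple hb : youngSubgroup b) : Equiv.Perm I) = 1 := by
        have := length_eq_of_descent haa (Equiv.swap a a') (by simpa using haa.1)
        simpa [length_one, simple] using this
      have h2 : T b q v * T b q (simple hb) = T b q ⟨w, hw⟩ := by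
        rw [← h1]
        apply T_mul
        rw [← Subgroup.coe_mul, h1, hs]
        exact length_eq_of_descent haa w hd
      rw [← h2, map_mul]
      refine ih.mul_right ?_
      rw [map_T, BlockEmb.permMap_simple]
      exact hT a a' haa hb
  obtain ⟨y, rfl⟩ := RingQuot.mkAlgHom_surjective ℂ (Rel b q) x
  change Commute e (map F q (mk b q y))
  induction y using FreeAlgebra.induction with
  | grade0 r =>
    rw [AlgHom.commutes, AlgHom.commutes]
    exact (Algebra.commutes r e).symm
  | grade1 y =>
    cases y with
    | T w => exact hTw w w.2
    | theta f =>
      rw [map_mk, BlockEmb.genMap_theta]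
      exact htheta f
  | mul x y hx hy => rw [map_mul, map_mul]; exact hx.mul_right hy
  | add x y hx hy => rw [map_add, map_add]; exact hx.add_right hy

lemma length_simple_mul {b : I →o κ} {a a' x x' : I} (h' : x ⋖ x')
    (hb : b a = b a') (hb' : b x = b x')
    (h1 : a ≠ x) (h2 : a ≠ x') (h3 : a' ≠ x) (h4 : a' ≠ x') :
    length ((simple hb : Equiv.Perm I) * (simple hb' : Equiv.Perm I)) =
      length (simple hb : Equiv.Perm I) + length (simple hb' : Equiv.Perm I) := by
  have e1 := length_eq_of_descent h' (Equiv.swap a a' * Equiv.swap x x') (by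
    rw [Equiv.Perm.mul_apply, Equiv.Perm.mul_apply, Equiv.swap_apply_left, Equiv.swap_apply_right,
      Equiv.swap_apply_of_ne_of_ne h1.symm h3.symm, Equiv.swap_apply_of_ne_of_ne h2.symm h4.symm]
    exact h'.1)
  have e2 := length_eq_of_descent h' (Equiv.swap x x') (by simpa using h'.1)
  rw [mul_assoc, Equiv.swap_mul_self, mul_one] at e1
  rw [Equiv.swap_mul_self, length_one] at e2
  simp only [simple]
  omega

/-- Block embeddings with disjoint images give commuting images. -/
lemma commute_map_map {I' κ' : Type} [Fintype I'] [LinearOrder I'] [PartialOrder κ']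
    {b' : I' →o κ'} (F : BlockEmb b d) (G : BlockEmb b' d) (hFG : ∀ a c, F.emb a ≠ G.emb c)
    (q : ℂ) (x : AffineHecke b q) (y : AffineHecke b' q) :
    Commute (map F q x) (map G q y) := by
  have key : ∀ {I₁ I₂ κ₁ κ₂ : Type} [Fintype I₁] [LinearOrder I₁] [PartialOrder κ₁]
      [Fintype I₂] [LinearOrder I₂] [PartialOrder κ₂] {b₁ : I₁ →o κ₁} {b₂ : I₂ →o κ₂}
      (F : BlockEmb b₁ d) (G : BlockEmb b₂ d) (_ : ∀ a c, F.emb a ≠ G.emb c)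
      (a a' : I₁) (_ : a ⋖ a') (hb : b₁ a = b₁ a') (f : Laurent I₂),
      Commute (T d q (simple (F.map_block a a' hb))) (theta d q (Laurent.rename G.emb f)) := by
    intro I₁ I₂ κ₁ κ₂ _ _ _ _ _ _ b₁ b₂ F G hFG a a' haa hb f
    have hfix : Laurent.rename (Equiv.swap (F.emb a) (F.emb a')) (Laurent.rename G.emb f) =
        Laurent.rename G.emb f := by
      rw [rename_rename]
      congr 2
      funext c
      exact Equiv.swap_apply_of_ne_of_ne (hFG a c).symm (hFG a' c).symm
    have := bernstein (q := q) (F.covBy haa hb) (F.map_block a a' hb)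
      (Laurent.rename G.emb f) 0 (by rw [hfix, zero_mul, sub_self])
    rw [hfix, map_zero, smul_zero, sub_eq_zero] at this
    exact this
  refine commute_map G q _ (fun c c' hcc hc => ?_) (fun f => ?_) y
  · refine (commute_map F q _ (fun a a' haa hb => ?_) (fun f => ?_) x).symm
    · rw [Commute, SemiconjBy, T_mul, T_mul]
      · congr 1
        apply Subtype.ext
        simp only [Subgroup.coe_mul, simple]
        apply Equiv.Perm.Disjoint.commute
        intro z
        by_cases hz : z = G.emb c ∨ z = G.emb c'
        · right
          rcases hz with rfl | rfl <;>
          exact Equiv.swap_apply_of_ne_of_ne (hFG a _).symm (hFG a' _).symm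
        · left
          push Not at hz
          exact Equiv.swap_apply_of_ne_of_ne hz.1 hz.2
      · exact length_simple_mul (G.covBy hcc hc) _ _ (hFG _ _) (hFG _ _)
          (hFG _ _) (hFG _ _)
      · exact length_simple_mul (F.covBy haa hb) _ _ (hFG _ _).symm
          (hFG _ _).symm (hFG _ _).symm (hFG _ _).symm
    · exact key G F (fun a c => (hFG c a).symm) c c' hcc hc f
  · refine (commute_map F q _ (fun a a' haa hb => ?_) (fun f' => ?_) x).symm
    · exact (key F G hFG a a' haa hb f).symm
    · rw [Commute, SemiconjBy, ← map_mul, ← map_mul, mul_comm]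

end AffineHecke

end Map

/-! ### Central characters -/

section Central

variable {I κ : Type} [Fintype I] [LinearOrder I] [PartialOrder κ]

/-- Evaluation of Laurent polynomials at a point `t` of the torus `Hom(ℤ^I, ℂˣ) = (ℂˣ)^I`. -/
def evalTorus (t : I → ℂˣ) : Laurent I →ₐ[ℂ] ℂ :=
  AddMonoidAlgebra.lift ℂ ℂ (I →₀ ℤ)
    { toFun := fun x => ((∏ a, t a ^ (Multiplicative.toAdd x) a : ℂˣ) : ℂ)
      map_one' := by simp
      map_mul' := fun x y => by simp [zpow_add, Finset.prod_mul_distrib] }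

/-- The algebra `𝒵 = 𝒜^W` of Weyl group invariant Laurent polynomials, which is the center of the
affine Hecke algebra. -/
def invariants (b : I →o κ) : Subalgebra ℂ (Laurent I) where
  carrier := {f | ∀ w ∈ youngSubgroup b, Laurent.rename w f = f}
  mul_mem' := by
    intro f g hf hg w hw
    rw [map_mul, hf w hw, hg w hw]
  add_mem' := by
    intro f g hf hg w hw
    rw [map_add, hf w hw, hg w hw]
  algebraMap_mem' := fun c w _ => AlgHom.commutes _ c

/-- The maximal ideal `𝒥_{Wt}` of `𝒵`: the invariant Laurent polynomials that vanish at `t`. -/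
def centralIdeal (b : I →o κ) (t : I → ℂˣ) : Ideal (invariants b) :=
  RingHom.ker ((evalTorus t).comp (invariants b).val)

/-- The module `M` is annihilated by a power of `𝒥_{Wt}`. -/
def AnnihilatedByPower (b : I →o κ) (q : ℂ) (t : I → ℂˣ) (M : Type*) [AddCommGroup M]
    [Module (AffineHecke b q) M] : Prop :=
  ∃ N : ℕ, ∀ f ∈ centralIdeal b t ^ N, ∀ v : M,
    AffineHecke.theta b q (f : Laurent I) • v = 0

end Central

/-! ### Induction, restriction and the image of a commuting element -/

section Modules

variable {B A : Type} [Ring B] [Algebra ℂ B] [Ring A] [Algebra ℂ A]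

/-- The submodule of `A ⊗_ℂ M` that is divided out to make the tensor product balanced over `B`. -/
def balancing (g : B →ₐ[ℂ] A) (M : Type*) [AddCommGroup M] [Module ℂ M] [Module B M] :
    Submodule A (A ⊗[ℂ] M) :=
  Submodule.span A {z | ∃ (x : A) (y : B) (v : M), z = (x * g y) ⊗ₜ[ℂ] v - x ⊗ₜ[ℂ] (y • v)}

/-- The induced module `A ⊗_B M`, where `A` is a right `B`-module through `g : B → A`. -/
abbrev Ind (g : B →ₐ[ℂ] A) (M : Type*) [AddCommGroup M] [Module ℂ M] [Module B M] : Type _ :=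
  (A ⊗[ℂ] M) ⧸ balancing g M

/-- The `A`-module `M`, seen as a `B`-module through `g : B → A`. -/
def Res (_ : B →ₐ[ℂ] A) (M : Type*) : Type _ := M

instance (g : B →ₐ[ℂ] A) (M : Type*) [AddCommGroup M] : AddCommGroup (Res g M) :=
  inferInstanceAs (AddCommGroup M)

instance (g : B →ₐ[ℂ] A) (M : Type*) [AddCommGroup M] [Module ℂ M] : Module ℂ (Res g M) :=
  inferInstanceAs (Module ℂ M)

instance (g : B →ₐ[ℂ] A) (M : Type*) [AddCommGroup M] [Module A M] : Module B (Res g M) :=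
  Module.compHom M (g : B →+* A)

instance (g : B →ₐ[ℂ] A) (M : Type*) [AddCommGroup M] [Module ℂ M] [Module A M]
    [IsScalarTower ℂ A M] : IsScalarTower ℂ B (Res g M) where
  smul_assoc c y v := by
    have h : ∀ u : M, g (c • y) • u = c • (g y • u) := fun u => by
      rw [map_smul, smul_assoc]
    exact h v

/-- The action on `M`, as a `B`-linear map, of an element `e` of `A` that commutes with the image
of `B`. -/
def actionOf (g : B →ₐ[ℂ] A) (e : A) (he : ∀ y, Commute e (g y)) (M : Type*) [AddCommGroup M]
    [Module A M] : Res g M →ₗ[B] Res g M where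
  toFun := fun v : M => e • v
  map_add' := fun v w : M => smul_add e v w
  map_smul' y v := by
    have h : ∀ u : M, e • (g y • u) = g y • (e • u) := fun u => by
      rw [smul_smul, smul_smul, (he y).eq]
    exact h v

end Modules

/-! ### The algebras `ℋ_n` and `ℋ_𝐧` -/

/-- All of `Fin n` as one block. -/
def oneBlock (n : ℕ) : Fin n →o Unit := OrderHom.const (Fin n) ()

/-- The affine Hecke algebra `ℋ_n` of `GL(n)`. -/
abbrev Hn (n : ℕ) (q : ℂ) : Type := AffineHecke (oneBlock n) q

/-- The coordinates, arranged in `m` consecutive blocks of sizes `c 0, …, c (m - 1)`: the pair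
`(k, j)` is the `j`-th coordinate of the `k`-th block, and pairs are ordered lexicographically. -/
abbrev Coord {m : ℕ} (c : Fin m → ℕ) : Type := Σₗ k : Fin m, Fin (c k)

/-- The `j`-th coordinate of the `k`-th block. -/
abbrev coord {m : ℕ} (c : Fin m → ℕ) (k : Fin m) (j : Fin (c k)) : Coord c := toLex ⟨k, j⟩

/-- The number of the block of a coordinate. -/
def block {m : ℕ} (c : Fin m → ℕ) : Coord c →o Fin m where
  toFun x := (ofLex x).1
  monotone' := by
    intro x y h
    rcases Sigma.Lex.le_def.mp h with h | ⟨h, _⟩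
    · exact h.le
    · exact h.le

/-- The affine Hecke algebra `ℋ_𝐧` for `𝐧 = (c 0, …, c (m - 1))`. -/
abbrev Hblock {m : ℕ} (c : Fin m → ℕ) (q : ℂ) : Type := AffineHecke (block c) q

lemma card_coord {m : ℕ} (c : Fin m → ℕ) : Fintype.card (Coord c) = ∑ k, c k := by
  have := Fintype.card_congr (ofLex (α := Σ k, Fin (c k)))
  simp [this]

/-- The order-preserving numbering of the coordinates. -/
def numbering {m : ℕ} (c : Fin m → ℕ) {n : ℕ} (h : ∑ k, c k = n) : Coord c ≃o Fin n :=
  (Fintype.orderIsoFinOfCardEq (Coord c) ((card_coord c).trans h)).symm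

/-- The block embedding underlying `ℋ_𝐧 ⊆ ℋ_n`. -/
def leviEmb {m : ℕ} (c : Fin m → ℕ) {n : ℕ} (h : ∑ k, c k = n) :
    BlockEmb (block c) (oneBlock n) where
  emb := (numbering c h).toOrderEmbedding
  map_block _ _ _ := rfl
  interval _ _ x _ _ _ := (numbering c h).surjective x

/-- The inclusion of `ℋ_𝐧` in `ℋ_n`, for `n` the sum of the block sizes. -/
def levi {m : ℕ} (c : Fin m → ℕ) {n : ℕ} (h : ∑ k, c k = n) (q : ℂ) : Hblock c q →ₐ[ℂ] Hn n q :=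
  AffineHecke.map (leviEmb c h) q

/-! ### Derivatives for `ℋ_n` -/

/-- The first `n - i` coordinates. -/
def firstEmb (n i : ℕ) : BlockEmb (oneBlock (n - i)) (oneBlock n) where
  emb := Fin.castLEOrderEmb (Nat.sub_le n i)
  map_block _ _ _ := rfl
  interval _ a' x _ _ h := ⟨⟨x, lt_of_le_of_lt (show (x : ℕ) ≤ a' from h) a'.2⟩, rfl⟩

/-- The last `i` coordinates: `j ↦ j + (n - i)`. -/
def lastEmb {n i : ℕ} (hi : i ≤ n) : BlockEmb (oneBlock i) (oneBlock n) where
  emb := OrderEmbedding.ofStrictMono (fun j => (⟨j + (n - i), by omega⟩ : Fin n)) (by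
    intro j k h
    have h' : (j : ℕ) < k := h
    exact Fin.mk_lt_mk.mpr (by omega))
  map_block _ _ _ := rfl
  interval a a' x _ h h' := by
    have h1 : (a : ℕ) + (n - i) ≤ x := h
    have h2 : (x : ℕ) ≤ a' + (n - i) := h'
    refine ⟨⟨x - (n - i), by omega⟩, Fin.ext ?_⟩
    change (x : ℕ) - (n - i) + (n - i) = x
    omega

/-- `ℋ_{n-i} → ℋ_n`, `h ↦ m(h ⊗ 1)`. -/
def firstMap (n i : ℕ) (q : ℂ) : Hn (n - i) q →ₐ[ℂ] Hn n q := AffineHecke.map (firstEmb n i) q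

/-- `𝐒_i^n = m(1 ⊗ 𝐒_i)`, the image in `ℋ_n` of the sign projector of `ℋ_i`. -/
def signElt {n i : ℕ} (hi : i ≤ n) (q : ℂ) : Hn n q :=
  AffineHecke.map (lastEmb hi) q (AffineHecke.signProjector (oneBlock i) q)

lemma signElt_commute {n i : ℕ} (hi : i ≤ n) (q : ℂ) (y : Hn (n - i) q) :
    Commute (signElt hi q) (firstMap n i q y) := by
  refine AffineHecke.commute_map_map _ _ (fun a c h => ?_) q _ _
  have h' : (a : ℕ) + (n - i) = c := congrArg Fin.val h
  have := c.2
  omega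

/-- The `i`-th Bernstein-Zelevinsky derivative `𝐒_i^n M` of an `ℋ_n`-module `M`, as a submodule
of `M` over `ℋ_{n-i}`. -/
def derivative {n i : ℕ} (hi : i ≤ n) (q : ℂ) (M : Type*) [AddCommGroup M] [Module (Hn n q) M] :
    Submodule (Hn (n - i) q) (Res (firstMap n i q) M) :=
  LinearMap.range (actionOf (firstMap n i q) (signElt hi q) (signElt_commute hi q) M)

/-! ### Derivatives for `ℋ_𝐧` -/

section Block

variable {m : ℕ} (c : Fin m → ℕ) (i : Fin m → ℕ)

/-- The first `c k - i k` coordinates of each block. -/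
def firstBlockEmb : BlockEmb (block (c - i)) (block c) where
  emb := OrderEmbedding.ofStrictMono
    (fun x => coord c (ofLex x).1 (Fin.castLE (Nat.sub_le _ _) (ofLex x).2)) (by
    rintro ⟨k, j⟩ ⟨k', j'⟩ h
    rcases Sigma.Lex.lt_def.mp h with h | ⟨h, h'⟩
    · exact Sigma.Lex.lt_def.mpr (Or.inl h)
    · obtain rfl : k = k' := h
      exact Sigma.Lex.lt_def.mpr (Or.inr ⟨rfl, h'⟩))
  map_block _ _ h := h
  interval := by
    rintro ⟨k, j⟩ ⟨k', j'⟩ ⟨l, x⟩ hb h h'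
    obtain rfl : k = k' := hb
    have h1 : k ≤ l := (block c).monotone h
    have h2 : l ≤ k := (block c).monotone h'
    obtain rfl : k = l := le_antisymm h1 h2
    rcases Sigma.Lex.le_def.mp h' with h' | ⟨_, h'⟩
    · exact absurd h' (lt_irrefl _)
    · have h3 : (x : ℕ) ≤ j' := h'
      exact ⟨coord (c - i) k ⟨x, lt_of_le_of_lt h3 j'.2⟩, rfl⟩

/-- `ℋ_{𝐧-𝐢} → ℋ_𝐧`, `h ↦ h ⊗ 1`. -/
def firstBlockMap (q : ℂ) : Hblock (c - i) q →ₐ[ℂ] Hblock c q :=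
  AffineHecke.map (firstBlockEmb c i) q

variable {c i}

/-- The last `i k` coordinates of each block. -/
def lastBlockEmb (hi : i ≤ c) : BlockEmb (block i) (block c) where
  emb := OrderEmbedding.ofStrictMono
    (fun x => coord c (ofLex x).1 ⟨(ofLex x).2 + (c (ofLex x).1 - i (ofLex x).1), by
      have h1 : ((ofLex x).2 : ℕ) < i (ofLex x).1 := (ofLex x).2.2
      have h2 : i (ofLex x).1 ≤ c (ofLex x).1 := hi (ofLex x).1
      omega⟩) (by
    rintro ⟨k, j⟩ ⟨k', j'⟩ h
    rcases Sigma.Lex.lt_def.mp h with h | ⟨h, h'⟩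
    · exact Sigma.Lex.lt_def.mpr (Or.inl h)
    · obtain rfl : k = k' := h
      have h'' : (j : ℕ) < j' := h'
      exact Sigma.Lex.lt_def.mpr (Or.inr ⟨rfl, Fin.mk_lt_mk.mpr (Nat.add_lt_add_right h'' _)⟩))
  map_block _ _ h := h
  interval := by
    rintro ⟨k, j⟩ ⟨k', j'⟩ ⟨l, x⟩ hb h h'
    obtain rfl : k = k' := hb
    have h1 : k ≤ l := (block c).monotone h
    have h2 : l ≤ k := (block c).monotone h'
    obtain rfl : k = l := le_antisymm h1 h2
    rcases Sigma.Lex.le_def.mp h with h | ⟨_, h⟩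
    · exact absurd h (lt_irrefl _)
    · have h3 : (j : ℕ) + (c k - i k) ≤ x := h
      have h4 := x.2
      have h5 : i k ≤ c k := hi k
      refine ⟨coord i k ⟨x - (c k - i k), by omega⟩, ?_⟩
      refine congrArg (coord c k) (Fin.ext ?_)
      change (x : ℕ) - (c k - i k) + (c k - i k) = x
      omega

/-- `𝐒_𝐢^𝐧`, the image of `1 ⊗ 𝐒_𝐢` in `ℋ_𝐧`. -/
def signBlockElt (hi : i ≤ c) (q : ℂ) : Hblock c q :=
  AffineHecke.map (lastBlockEmb hi) q (AffineHecke.signProjector (block i) q)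

lemma signBlockElt_commute (hi : i ≤ c) (q : ℂ) (y : Hblock (c - i) q) :
    Commute (signBlockElt hi q) (firstBlockMap c i q y) := by
  refine AffineHecke.commute_map_map _ _ ?_ q _ _
  rintro ⟨k, j⟩ ⟨l, x⟩ h
  obtain rfl : k = l := congrArg (block c) h
  have h1 : (⟨j + (c k - i k), _⟩ : Fin (c k)) = Fin.castLE _ x :=
    eq_of_heq (Sigma.mk.inj h).2
  have h2 : (j : ℕ) + (c k - i k) = x := congrArg Fin.val h1
  have h3 : (x : ℕ) < c k - i k := x.2
  omega

/-- The derivative `𝐒_𝐢^𝐧 M` of an `ℋ_𝐧`-module `M`, as a submodule of `M` over `ℋ_{𝐧-𝐢}`. -/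
def blockDerivative (hi : i ≤ c) (q : ℂ) (M : Type*) [AddCommGroup M] [Module (Hblock c q) M] :
    Submodule (Hblock (c - i) q) (Res (firstBlockMap c i q) M) :=
  LinearMap.range
    (actionOf (firstBlockMap c i q) (signBlockElt hi q) (signBlockElt_commute hi q) M)

lemma sum_sub {n r : ℕ} (hc : ∑ k, c k = n) (hi : i ≤ c) (hr : ∑ k, i k = r) :
    ∑ k, (c - i) k = n - r := by
  have : ∑ k, (c - i) k + ∑ k, i k = ∑ k, c k := by
    rw [← Finset.sum_add_distrib]
    exact Finset.sum_congr rfl fun k _ => Nat.sub_add_cancel (hi k)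
  omega

end Block

/-- The tuples `𝐢 = (i_1, …, i_m)` with `0 ≤ i_k ≤ c_k` and sum `r`. -/
abbrev Tuples {m : ℕ} (c : Fin m → ℕ) (r : ℕ) : Type := {i : Fin m → ℕ // i ≤ c ∧ ∑ k, i k = r}

/-- The unitary part `t / |t|` in the polar decomposition of a nonzero complex number. -/
def unitaryPart (t : ℂˣ) : ℂ := (t : ℂ) / (‖(t : ℂ)‖ : ℂ)

end BZ

end

open scoped TensorProduct DirectSum

noncomputable section

set_option linter.unusedSectionVars false

namespace BZ

/-! ### Lengths and shortest coset representatives. -/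

section LengthLemmas

variable {I : Type} [Fintype I] [LinearOrder I]

/-! Give each `t_j` as colour the block of `j`. The colour depends only on `t_j/|t_j|`, and `q > 0`,
so two numbers of different colours are neither equal nor in ratio `q`. The coordinate functions act
on `π` with eigenvalues among the `t_j`, and a polynomial partition of unity splits `π` into parts
`π_φ`, one for each colouring `φ` of the coordinates (`Colored.equiv`). If adjacent coordinates `a`,
`a'` have different colours, the element `τ = T_s (x_a - x_a') - (q - 1) x_a` maps `π_φ` to `π_{φ
s}`, and `τ² = (q x_a - x_a')(q x_a' - x_a)` is injective there. So all parts in one orbit of the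
symmetric group have the same dimension and generate the same submodule.

The part of a sorted colouring is a module over the corresponding Levi subalgebra. The module
induced from it is spanned by the `T_w ⊗ v` with `w` increasing on blocks, and there are at most as
many such `w` as colourings in the orbit. Comparison of dimensions shows that every module with
colours is the direct sum of the modules induced from its parts of sorted colours
(`Colored.nonempty_equiv_ind`). For `π ≅ ℋ_n ⊗ σ` it also shows that the sorted part is exactly `σ`
(`exists_sorted_inclusion`). That `σ` embeds in the induced module follows from a retraction of
`ℋ_n` onto the Levi subalgebra, which the Poincaré-Birkhoff-Witt theorem provides.

The Leibniz rule is this decomposition for `BZ_i(π)` over `ℋ_{n-i}`. Its sorted colourings have `n_k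
- i_k` coordinates of colour `k`, for some tuple `𝐢`, and the part of such a colouring has to be
identified with `𝐒_𝐢^𝐧 σ`. Fixing the colours of the first coordinates in `π` leaves a module over
`ℋ_i` in which only one sorted colouring can occur, so it is induced from that sorted part. On it,
`𝐒_i` restricts to a bijection from the image of `𝐒_𝐢` on the sorted part to the whole sign part. It
is onto because `𝐒_i T_s = -𝐒_i` reduces every colour to the sorted one
(`Colored.exists_sign_smul_eq`), and injective because the retraction sends `𝐒_i` to a nonzero
multiple of `𝐒_𝐢` (`Colored.eq_zero_of_sign_smul`).

Finally, the part that is sorted on the first and on the last coordinates separately is carried from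
`σ` by the permutation `w = separate`. Since `w` is shortest for its effect on the colours, taking
the component of `T_w v` of the permuted colour is a bijection that respects the Levi actions
(`Colored.intertwiner_bijective`, `Colored.intertwiner_smul_map`). Its composite with `𝐒_i` is
`derivativeMap`. -/

lemma length_mul_swap_of_lt {a a' : I} (h : a ⋖ a') (w : Equiv.Perm I) (hw : w a < w a') :
    length (w * Equiv.swap a a') = length w + 1 := by
  have := length_eq_of_descent h (w * Equiv.swap a a') (by simpa using hw)
  rwa [mul_assoc, Equiv.swap_mul_self, mul_one] at this

lemma length_swap {a a' : I} (h : a ⋖ a') : length (Equiv.swap a a') = 1 := by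
  have := length_mul_swap_of_lt h 1 (by simpa using h.1)
  simpa [length_one] using this

lemma length_mul_swap_le {a a' : I} (h : a ⋖ a') (w : Equiv.Perm I) :
    length (w * Equiv.swap a a') ≤ length w + 1 := by
  rcases lt_or_gt_of_ne (w.injective.ne h.1.ne) with h' | h'
  · exact (length_mul_swap_of_lt h w h').le
  · have := length_eq_of_descent h w h'
    omega

lemma length_le_mul_swap {a a' : I} (h : a ⋖ a') (w : Equiv.Perm I) :
    length w ≤ length (w * Equiv.swap a a') + 1 := by
  have := length_mul_swap_le h (w * Equiv.swap a a')
  rwa [mul_assoc, Equiv.swap_mul_self, mul_one] at this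

/-- Induction on the length in the full symmetric group. -/
lemma perm_induction {P : Equiv.Perm I → Prop} (one : P 1)
    (step : ∀ (w : Equiv.Perm I) (a a' : I), a ⋖ a' → w a' < w a →
      P (w * Equiv.swap a a') → P w) (w : Equiv.Perm I) : P w :=
  youngSubgroup_induction (OrderHom.const I ()) (P := fun w _ => P w) one
    (fun w _ a a' h _ hd ih => step w a a' h hd ih) w (fun _ => rfl)

lemma length_mul_le (v w : Equiv.Perm I) : length (v * w) ≤ length v + length w := by
  induction w using perm_induction with
  | one => simp
  | step w a a' h hd ih =>
    have h1 := length_eq_of_descent h w hd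
    have h2 := length_le_mul_swap h (v * w)
    rw [mul_assoc] at h2
    omega

/-- If `w` increases on the blocks of `φ`, its length is minimal in its coset. -/
lemma length_mul_of_increasing {κ : Type} [PartialOrder κ] (b : I →o κ) (w : Equiv.Perm I)
    (hw : ∀ x y, x < y → b x = b y → w x < w y) (g : Equiv.Perm I) (hg : g ∈ youngSubgroup b) :
    length (w * g) = length w + length g := by
  induction g, hg using youngSubgroup_induction b with
  | one => simp [length_one]
  | step g hg a a' h hb hd ih =>
    have h1 := length_eq_of_descent h g hd
    -- `g` preserves blocks, so its descent takes place inside one block, where `w` keeps the order.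
    have h2 := length_eq_of_descent h (w * g) (hw _ _ hd (by rw [hg, hg, hb]))
    rw [h2, h1, mul_assoc, ih]
    omega

/-- Two permutations that increase on blocks and lie in the same coset are equal. -/
lemma eq_of_increasing {κ : Type} [PartialOrder κ] (b : I →o κ) (v w : Equiv.Perm I)
    (hv : ∀ x y, x < y → b x = b y → v x < v y) (hw : ∀ x y, x < y → b x = b y → w x < w y)
    (h : b ∘ v.symm = b ∘ w.symm) : v = w := by
  have hg : w⁻¹ * v ∈ youngSubgroup b := fun x => by
    have := congrFun h (v x)
    simp only [Function.comp_apply, Equiv.symm_apply_apply] at this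
    exact this.symm
  -- Each of `v` and `w` is the shorter one: `l(v) = l(w) + l(w⁻¹v)` and `l(w) = l(v) + l(v⁻¹w)`,
  -- which forces `l(w⁻¹v) = 0`.
  have h1 := length_mul_of_increasing b w hw _ hg
  have h2 := length_mul_of_increasing b v hv _ (inv_mem hg)
  simp only [mul_inv_cancel_left, mul_inv_rev, inv_inv] at h1 h2
  have h3 : length (w⁻¹ * v) = 0 := by omega
  by_contra hne
  obtain ⟨a, a', ha, hd⟩ := exists_descent (w⁻¹ * v) (by
    intro h; exact hne (inv_mul_eq_one.mp h).symm)
  have := length_eq_of_descent ha _ hd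
  omega

end LengthLemmas

/-! ### Divided differences -/

section Quotient

variable {I : Type}

/-- The coordinate function `x_a`. -/
def xvar (a : I) : Laurent I := AddMonoidAlgebra.single (Finsupp.single a 1) 1

lemma rename_xvar {J : Type} (f : I → J) (a : I) : Laurent.rename f (xvar a) = xvar (f a) := by
  simp only [Laurent.rename, xvar, AddMonoidAlgebra.mapDomainAlgHom_apply]
  rw [AddMonoidAlgebra.mapDomain_single]
  simp [Finsupp.mapDomain.addMonoidHom, Finsupp.mapDomain_single]

lemma rename_single {J : Type} (f : I → J) (x : I →₀ ℤ) (z : ℂ) :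
    Laurent.rename f (AddMonoidAlgebra.single x z) =
      AddMonoidAlgebra.single (Finsupp.mapDomain f x) z := by
  simp only [Laurent.rename, AddMonoidAlgebra.mapDomainAlgHom_apply]
  rw [AddMonoidAlgebra.mapDomain_single]
  rfl

lemma rename_id (p : Laurent I) : Laurent.rename id p = p := by
  induction p using AddMonoidAlgebra.induction_linear with
  | zero => simp
  | add f g hf hg => rw [map_add, hf, hg]
  | single x z => rw [rename_single, Finsupp.mapDomain_id]

lemma rename_mul_perm (v w : Equiv.Perm I) (p : Laurent I) :
    Laurent.rename (v * w : Equiv.Perm I) p = Laurent.rename v (Laurent.rename w p) := by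
  rw [rename_rename]; rfl

lemma rename_swap_swap [DecidableEq I] (a a' : I) (p : Laurent I) :
    Laurent.rename (Equiv.swap a a') (Laurent.rename (Equiv.swap a a') p) = p := by
  rw [← rename_mul_perm, Equiv.swap_mul_self]; exact rename_id p

lemma xvar_mul_one_sub_thetaNeg (a a' : I) : xvar a * (1 - thetaNeg a a') = xvar a - xvar a' := by
  rw [mul_sub, mul_one, xvar, thetaNeg, AddMonoidAlgebra.single_mul_single]
  simp [xvar]

/-- Geometric series: `1 - θ_u` divides `1 - θ_u^k` for natural `k`. A negative exponent is reduced
to this by exchanging the roles of the two monomials. -/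
lemma dvd_single_sub_single (u x : I →₀ ℤ) (k : ℤ) (z : ℂ) :
    (1 - AddMonoidAlgebra.single u 1 : Laurent I) ∣
      AddMonoidAlgebra.single x z - AddMonoidAlgebra.single (x + k • u) z := by
  have nat : ∀ (y : I →₀ ℤ) (k : ℕ), (1 - AddMonoidAlgebra.single u 1 : Laurent I) ∣
      AddMonoidAlgebra.single y z - AddMonoidAlgebra.single (y + k • u) z := by
    intro y k
    have h : (AddMonoidAlgebra.single y z - AddMonoidAlgebra.single (y + k • u) z : Laurent I) =
        AddMonoidAlgebra.single y z * (1 ^ k - AddMonoidAlgebra.single u 1 ^ k) := by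
      rw [one_pow, AddMonoidAlgebra.single_pow, one_pow, mul_sub, mul_one,
        AddMonoidAlgebra.single_mul_single, mul_one]
    rw [h]
    exact (sub_dvd_pow_sub_pow _ _ _).mul_left _
  obtain ⟨l, rfl | rfl⟩ := Int.eq_nat_or_neg k
  · simpa using nat x l
  · have := nat (x + (-(l : ℤ)) • u) l
    rw [← dvd_neg, neg_sub]
    convert this using 3
    simp [add_assoc]

/-- The reflection formula `s(x) = x - ⟨x, α^∨⟩ α` for `α = ε_a - ε_a'`. It shows that a monomial
and its reflection differ by a power of `θ_{-α}`. -/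
lemma mapDomain_swap [DecidableEq I] (a a' : I) (x : I →₀ ℤ) :
    Finsupp.mapDomain (Equiv.swap a a') x =
      x + (x a - x a') • (Finsupp.single a' 1 - Finsupp.single a 1) := by
  have h1 : Finsupp.mapDomain (Equiv.swap a a') x = Finsupp.equivMapDomain (Equiv.swap a a') x :=
    (Finsupp.equivMapDomain_eq_mapDomain _ _).symm
  rw [h1]
  ext c
  simp only [Finsupp.equivMapDomain_apply, Equiv.symm_swap, Finsupp.add_apply, Finsupp.smul_apply,
    Finsupp.sub_apply, Finsupp.single_apply, Equiv.swap_apply_def, smul_eq_mul]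
  split_ifs <;> subst_vars <;> simp_all

/-- The quotient `(f - s f) / (1 - θ_{-α})` exists. -/
lemma exists_quotient [DecidableEq I] (a a' : I) (f : Laurent I) :
    ∃ g, g * (1 - thetaNeg a a') = f - Laurent.rename (Equiv.swap a a') f := by
  suffices h : (1 - thetaNeg a a') ∣ f - Laurent.rename (Equiv.swap a a') f by
    obtain ⟨g, hg⟩ := h
    exact ⟨g, by rw [hg, mul_comm]⟩
  induction f using AddMonoidAlgebra.induction_linear with
  | zero => simp
  | add f g hf hg => rw [map_add, add_sub_add_comm]; exact dvd_add hf hg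
  | single x z =>
    rw [rename_single, mapDomain_swap]
    exact dvd_single_sub_single _ _ _ _

end Quotient

/-! ### Generation of affine Hecke algebras -/

namespace AffineHecke

variable {I κ : Type} [Fintype I] [LinearOrder I] [PartialOrder κ] {b : I →o κ} {q : ℂ}

lemma T_mul_simple_of_lt {a a' : I} (h : a ⋖ a') (hb : b a = b a') (w : youngSubgroup b)
    (hw : (w : Equiv.Perm I) a < (w : Equiv.Perm I) a') :
    T b q w * T b q (simple hb) = T b q (w * simple hb) := by
  apply T_mul
  rw [simple, length_mul_swap_of_lt h _ hw, length_swap h]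

lemma simple_mul_self {a a' : I} (hb : b a = b a') : simple hb * simple hb = 1 :=
  Subtype.ext (Equiv.swap_mul_self a a')

lemma T_simple_mul_self {a a' : I} (h : a ⋖ a') (hb : b a = b a') :
    T b q (simple hb) * T b q (simple hb) = (q - 1) • T b q (simple hb) + q • 1 := by
  have := quadratic (q := q) h hb
  rw [Algebra.algebraMap_eq_smul_one] at this
  simp only [mul_sub, add_mul, one_mul, mul_smul_comm, mul_one, smul_add] at this
  rw [sub_eq_zero] at this
  rw [sub_smul, one_smul, sub_add_eq_add_sub, ← this]
  simp

lemma T_mul_simple_of_gt {a a' : I} (h : a ⋖ a') (hb : b a = b a') (w : youngSubgroup b)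
    (hw : (w : Equiv.Perm I) a' < (w : Equiv.Perm I) a) :
    T b q w * T b q (simple hb) = (q - 1) • T b q w + q • T b q (w * simple hb) := by
  have h1 : T b q (w * simple hb) * T b q (simple hb) = T b q w := by
    rw [T_mul_simple_of_lt h hb _ (by simpa [simple] using hw), mul_assoc, simple_mul_self,
      mul_one]
  conv_lhs => rw [← h1]
  rw [mul_assoc, T_simple_mul_self h hb, mul_add, mul_smul_comm, mul_smul_comm, h1, mul_one]

lemma T_eq_mul_simple {a a' : I} (h : a ⋖ a') (hb : b a = b a') (w : youngSubgroup b)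
    (hw : (w : Equiv.Perm I) a' < (w : Equiv.Perm I) a) :
    T b q w = T b q (w * simple hb) * T b q (simple hb) := by
  rw [T_mul_simple_of_lt h hb _ (by simpa [simple] using hw), mul_assoc, simple_mul_self, mul_one]

/-- A subalgebra that contains the `T_s` and `𝒜` is everything. -/
lemma mem_of_generators (S : Subalgebra ℂ (AffineHecke b q))
    (hT : ∀ (a a' : I) (_ : a ⋖ a') (hb : b a = b a'), T b q (simple hb) ∈ S)
    (htheta : ∀ f, theta b q f ∈ S) (x : AffineHecke b q) : x ∈ S := by
  have hTw : ∀ (w : Equiv.Perm I) (hw : w ∈ youngSubgroup b), T b q ⟨w, hw⟩ ∈ S := by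
    intro w hw
    induction w, hw using youngSubgroup_induction b with
    | one =>
      have : (⟨1, Subgroup.one_mem _⟩ : youngSubgroup b) = 1 := rfl
      rw [this, T_one]
      exact S.one_mem
    | step w hw a a' haa hb hd ih =>
      rw [T_eq_mul_simple haa hb ⟨w, hw⟩ hd]
      exact S.mul_mem ih (hT a a' haa hb)
  obtain ⟨y, rfl⟩ := RingQuot.mkAlgHom_surjective ℂ (Rel b q) x
  change mk b q y ∈ S
  induction y using FreeAlgebra.induction with
  | grade0 r => rw [AlgHom.commutes]; exact S.algebraMap_mem r
  | grade1 y =>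
    cases y with
    | T w => exact hTw w w.2
    | theta f => exact htheta f
  | mul x y hx hy => rw [map_mul]; exact S.mul_mem hx hy
  | add x y hx hy => rw [map_add]; exact S.add_mem hx hy

/-- The Bernstein relation, with `𝒜` on the left of `T_s` in the first term. -/
lemma theta_mul_T {a a' : I} (h : a ⋖ a') (hb : b a = b a') (f g : Laurent I)
    (hg : g * (1 - thetaNeg a a') = Laurent.rename (Equiv.swap a a') f - f) :
    theta b q f * T b q (simple hb) =
      T b q (simple hb) * theta b q (Laurent.rename (Equiv.swap a a') f)
        - (q - 1) • theta b q g := by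
  rw [← bernstein h hb (Laurent.rename (Equiv.swap a a') f) g (by rw [hg, rename_swap_swap]),
    rename_swap_swap, sub_sub_cancel]

end AffineHecke

/-! ### Matsumoto's theorem for the symmetric group -/

section Matsumoto

lemma swap_braid {I : Type} [DecidableEq I] {a b c : I} (hab : a ≠ b) (hbc : b ≠ c)
    (hac : a ≠ c) : Equiv.swap a b * Equiv.swap b c * Equiv.swap a b =
      Equiv.swap b c * Equiv.swap a b * Equiv.swap b c := by
  rw [Equiv.swap_mul_swap_mul_swap hab hac, Equiv.swap_comm a b, Equiv.swap_comm b c,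
    Equiv.swap_mul_swap_mul_swap hbc.symm hac.symm, Equiv.swap_comm]

variable {I : Type} [Fintype I] [LinearOrder I] {E : Type*} [Monoid E]

/-- The product of the `t s` along a chosen reduced word of `w`. -/
def wordProd (t : I → I → E) (w : Equiv.Perm I) : E :=
  if h : w = 1 then 1 else
    wordProd t (w * Equiv.swap (exists_descent w h).choose (exists_descent w h).choose_spec.choose) *
      t (exists_descent w h).choose (exists_descent w h).choose_spec.choose
termination_by length w
decreasing_by
  have h' := (exists_descent w h).choose_spec.choose_spec
  have := length_eq_of_descent h'.1 w h'.2
  omega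

lemma wordProd_one (t : I → I → E) : wordProd t 1 = 1 := by
  rw [wordProd, dif_pos rfl]

lemma exists_wordProd_eq (t : I → I → E) (w : Equiv.Perm I) (h : w ≠ 1) :
    ∃ a a' : I, a ⋖ a' ∧ w a' < w a ∧ wordProd t w = wordProd t (w * Equiv.swap a a') * t a a' := by
  have h' := (exists_descent w h).choose_spec.choose_spec
  refine ⟨_, _, h'.1, h'.2, ?_⟩
  rw [wordProd, dif_neg h]

/-- The braid relations imply that `wordProd` can be computed along any reduced word. -/
lemma wordProd_eq (t : I → I → E)
    (hcomm : ∀ a a' x x', a ⋖ a' → x ⋖ x' → a ≠ x → a ≠ x' → a' ≠ x → a' ≠ x' →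
      t a a' * t x x' = t x x' * t a a')
    (hbraid : ∀ a b c, a ⋖ b → b ⋖ c → t a b * t b c * t a b = t b c * t a b * t b c)
    (w : Equiv.Perm I) (x x' : I) (hx : x ⋖ x') (hw : w x' < w x) :
    wordProd t w = wordProd t (w * Equiv.swap x x') * t x x' := by
  induction hl : length w using Nat.strong_induction_on generalizing w x x' with
  | _ l ih =>
    have hw1 : w ≠ 1 := by
      rintro rfl
      exact absurd hx.1 (not_lt.mpr hw.le)
    obtain ⟨a, a', ha, hd, e⟩ := exists_wordProd_eq t w hw1
    have la := length_eq_of_descent ha w hd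
    have lx := length_eq_of_descent hx w hw
    -- If `w` has descents at two neighbouring simple roots, three letters can be removed in either
    -- braid order. By induction both words are products over the same shorter permutation, followed
    -- by the two sides of the braid relation.
    have braid : ∀ {a b c : I}, a ⋖ b → b ⋖ c → w b < w a → w c < w b →
        wordProd t (w * Equiv.swap a b) * t a b = wordProd t (w * Equiv.swap b c) * t b c := by
      intro a b c hab hbc h1 h2
      have l1 := length_eq_of_descent hab w h1
      have l2 := length_eq_of_descent hbc w h2
      have nac : a ≠ c := (hab.1.trans hbc.1).ne
      have d1 : (w * Equiv.swap a b) c < (w * Equiv.swap a b) b := by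
        simp only [Equiv.Perm.mul_apply, Equiv.swap_apply_right]
        rw [Equiv.swap_apply_of_ne_of_ne nac.symm hbc.1.ne']
        exact h2.trans h1
      have d1' : (w * Equiv.swap a b * Equiv.swap b c) b < (w * Equiv.swap a b * Equiv.swap b c) a := by
        simp only [Equiv.Perm.mul_apply, Equiv.swap_apply_left]
        rw [Equiv.swap_apply_of_ne_of_ne nac.symm hbc.1.ne',
          Equiv.swap_apply_of_ne_of_ne hab.1.ne nac, Equiv.swap_apply_left]
        exact h2
      have d2 : (w * Equiv.swap b c) b < (w * Equiv.swap b c) a := by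
        simp only [Equiv.Perm.mul_apply, Equiv.swap_apply_left]
        rw [Equiv.swap_apply_of_ne_of_ne hab.1.ne nac]
        exact h2.trans h1
      have d2' : (w * Equiv.swap b c * Equiv.swap a b) c < (w * Equiv.swap b c * Equiv.swap a b) b := by
        simp only [Equiv.Perm.mul_apply, Equiv.swap_apply_right]
        rw [Equiv.swap_apply_of_ne_of_ne hab.1.ne nac,
          Equiv.swap_apply_of_ne_of_ne nac.symm hbc.1.ne', Equiv.swap_apply_right]
        exact h1
      have m1 := length_eq_of_descent hbc _ d1
      have m2 := length_eq_of_descent hab _ d2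
      rw [ih _ (by omega) _ _ _ hbc d1 rfl, ih _ (by omega) _ _ _ hab d1' rfl,
        ih _ (by omega) _ _ _ hab d2 rfl, ih _ (by omega) _ _ _ hbc d2' rfl]
      have hs : w * Equiv.swap a b * Equiv.swap b c * Equiv.swap a b =
          w * Equiv.swap b c * Equiv.swap a b * Equiv.swap b c := by
        simp only [mul_assoc]
        congr 1
        rw [← mul_assoc, ← mul_assoc]
        exact swap_braid hab.1.ne hbc.1.ne nac
      have ht := hbraid a b c hab hbc
      simp only [mul_assoc] at ht hs ⊢
      rw [hs, ht]
    -- The last letter of the chosen reduced word and the prescribed one are equal, neighbouring (on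
    -- either side) or disjoint. In the disjoint case each descent survives the removal of the other
    -- letter, and the commutation relation applies.
    by_cases c1 : a = x
    · subst c1
      obtain rfl : a' = x' := ha.unique_right hx
      exact e
    by_cases c2 : a' = x
    · subst c2
      rw [e]
      exact braid ha hx hd hw
    by_cases c3 : a = x'
    · subst c3
      rw [e]
      exact (braid hx ha hw hd).symm
    have c4 : a' ≠ x' := by
      rintro rfl
      exact c1 (ha.unique_left hx)
    have d1 : (w * Equiv.swap a a') x' < (w * Equiv.swap a a') x := by
      simp only [Equiv.Perm.mul_apply]
      rw [Equiv.swap_apply_of_ne_of_ne (Ne.symm c3) c4.symm,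
        Equiv.swap_apply_of_ne_of_ne (Ne.symm c1) (Ne.symm c2)]
      exact hw
    have d2 : (w * Equiv.swap x x') a' < (w * Equiv.swap x x') a := by
      simp only [Equiv.Perm.mul_apply]
      rw [Equiv.swap_apply_of_ne_of_ne c2 c4, Equiv.swap_apply_of_ne_of_ne c1 c3]
      exact hd
    rw [e, ih _ (by omega) _ _ _ hx d1 rfl, ih _ (by omega) _ _ _ ha d2 rfl,
      mul_assoc (wordProd t _), mul_assoc (wordProd t _), hcomm a a' x x' ha hx c1 c3 c2 c4]
    congr 2
    rw [mul_assoc, mul_assoc]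
    congr 1
    apply Equiv.Perm.Disjoint.commute
    intro z
    by_cases hz : z = x ∨ z = x'
    · left
      rcases hz with rfl | rfl
      · exact Equiv.swap_apply_of_ne_of_ne (Ne.symm c1) (Ne.symm c2)
      · exact Equiv.swap_apply_of_ne_of_ne (Ne.symm c3) c4.symm
    · right
      push Not at hz
      exact Equiv.swap_apply_of_ne_of_ne hz.1 hz.2

lemma wordProd_mul (t : I → I → E)
    (ht : ∀ (w : Equiv.Perm I) (x x' : I), x ⋖ x' → w x' < w x →
      wordProd t w = wordProd t (w * Equiv.swap x x') * t x x')
    (v w : Equiv.Perm I) (h : length (v * w) = length v + length w) :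
    wordProd t (v * w) = wordProd t v * wordProd t w := by
  induction w using perm_induction with
  | one => rw [wordProd_one, mul_one, mul_one]
  | step w a a' ha hd ih =>
    have h1 := length_eq_of_descent ha w hd
    have h2 := length_mul_le v (w * Equiv.swap a a')
    rw [← mul_assoc] at h2 ih
    -- Additivity of the lengths forces the descent of `w` to be one of `v * w`: an ascent would
    -- give `l(v w s) = l(v) + l(w) + 1`, more than the bound `l(v) + l(w s)`.
    have hd' : (v * w) a' < (v * w) a := by
      by_contra hcon
      have hlt : (v * w) a < (v * w) a' :=
        lt_of_le_of_ne (not_lt.mp hcon) ((v * w).injective.ne ha.1.ne)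
      have := length_mul_swap_of_lt ha _ hlt
      omega
    have h3 := length_eq_of_descent ha _ hd'
    rw [ht _ _ _ ha hd', ht _ _ _ ha hd, ih (by omega), mul_assoc]

lemma wordProd_swap (t : I → I → E) {a a' : I} (h : a ⋖ a')
    (ht : ∀ (w : Equiv.Perm I) (x x' : I), x ⋖ x' → w x' < w x →
      wordProd t w = wordProd t (w * Equiv.swap x x') * t x x') :
    wordProd t (Equiv.swap a a') = t a a' := by
  rw [ht _ _ _ h (by simpa using h.1), Equiv.swap_mul_self, wordProd_one, one_mul]

end Matsumoto

/-! ### The representation by Demazure-Lusztig operators on rational functions -/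

section Rational

variable (I : Type)

instance : IsDomain (Laurent I) := by
  have : NoZeroDivisors (Laurent I) := inferInstance
  exact NoZeroDivisors.to_isDomain _

/-- The field of rational functions on the torus. -/
abbrev RatFun : Type := FractionRing (Laurent I)

variable {I}

lemma rename_perm_injective (w : Equiv.Perm I) :
    Function.Injective (Laurent.rename (w : I → I)) := by
  intro f g h
  have := congrArg (Laurent.rename (w⁻¹ : Equiv.Perm I)) h
  rwa [← rename_mul_perm, ← rename_mul_perm, inv_mul_cancel, Equiv.Perm.coe_one, rename_id,
    rename_id] at this

variable [Fintype I] [LinearOrder I]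

/-- The action of a permutation on Laurent polynomials, with values in rational functions. -/
def renameRat (w : Equiv.Perm I) : Laurent I →ₐ[ℂ] RatFun I :=
  (IsScalarTower.toAlgHom ℂ (Laurent I) (RatFun I)).comp (Laurent.rename (w : I → I))

lemma renameRat_injective (w : Equiv.Perm I) : Function.Injective (renameRat w) :=
  (IsFractionRing.injective (Laurent I) (RatFun I)).comp (rename_perm_injective w)

/-- The action of a permutation on rational functions. -/
def ratAct (w : Equiv.Perm I) : RatFun I →ₐ[ℂ] RatFun I :=
  IsFractionRing.liftAlgHom (renameRat_injective w)

lemma ratAct_algebraMap (w : Equiv.Perm I) (f : Laurent I) :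
    ratAct w (algebraMap _ _ f) = algebraMap _ _ (Laurent.rename w f) :=
  IsFractionRing.lift_algebraMap (g := (renameRat w).toRingHom) (renameRat_injective w) f

lemma ratAct_mul (v w : Equiv.Perm I) (f : RatFun I) :
    ratAct (v * w) f = ratAct v (ratAct w f) := by
  have : (ratAct (v * w) : RatFun I →+* RatFun I) =
      (ratAct v : RatFun I →+* RatFun I).comp (ratAct w : RatFun I →+* RatFun I) := by
    apply IsLocalization.ringHom_ext (nonZeroDivisors (Laurent I))
    refine RingHom.ext fun p => ?_
    simp only [RingHom.comp_apply, RingHom.coe_coe, ratAct_algebraMap, rename_mul_perm]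
  exact DFunLike.congr_fun this f

lemma ratAct_one (f : RatFun I) : ratAct 1 f = f := by
  have : ((ratAct 1 : RatFun I →ₐ[ℂ] RatFun I) : RatFun I →+* RatFun I) = RingHom.id _ := by
    apply IsLocalization.ringHom_ext (nonZeroDivisors (Laurent I))
    refine RingHom.ext fun p => ?_
    simp only [RingHom.comp_apply, RingHom.coe_coe, ratAct_algebraMap, Equiv.Perm.coe_one,
      rename_id, RingHom.id_apply]
  exact DFunLike.congr_fun this f

/-- The coordinate function `x_a` as a rational function. -/
def rvar (a : I) : RatFun I := algebraMap _ _ (xvar a)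

lemma ratAct_rvar (w : Equiv.Perm I) (a : I) : ratAct w (rvar a) = rvar (w a) := by
  rw [rvar, ratAct_algebraMap, rename_xvar]; rfl

lemma xvar_sub_smul_ne_zero {a a' : I} (h : a ≠ a') (z : ℂ) : xvar a - z • xvar a' ≠ 0 := by
  intro h0
  have := congrArg (fun f : Laurent I => f.coeff (Finsupp.single a 1)) h0
  simp [xvar, Finsupp.single_left_inj, h.symm] at this

lemma rvar_sub_smul_ne_zero {a a' : I} (h : a ≠ a') (z : ℂ) :
    rvar a - algebraMap ℂ _ z * rvar a' ≠ 0 := by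
  have h1 := xvar_sub_smul_ne_zero h z
  rw [← (IsFractionRing.injective (Laurent I) (RatFun I)).ne_iff, map_zero, map_sub,
    Algebra.smul_def, map_mul, ← IsScalarTower.algebraMap_apply] at h1
  exact h1

lemma rvar_sub_ne_zero {a a' : I} (h : a ≠ a') : rvar a - rvar a' ≠ 0 := by
  simpa using rvar_sub_smul_ne_zero h 1

lemma rvar_injective : Function.Injective (rvar : I → RatFun I) := by
  intro a a' h
  by_contra hne
  exact rvar_sub_ne_zero hne (sub_eq_zero.mpr h)

/-- Dedekind: the automorphisms `ratAct w` are linearly independent. -/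
lemma ratAct_independent (k : Equiv.Perm I → RatFun I)
    (h : ∀ f, ∑ w, k w * ratAct w f = 0) : k = 0 := by
  have h1 := (linearIndependent_monoidHom (RatFun I) (RatFun I)).comp
    (fun w : Equiv.Perm I => ((ratAct w : RatFun I →ₐ[ℂ] RatFun I) : RatFun I →* RatFun I)) (by
      intro v w hvw
      ext a
      have := DFunLike.congr_fun hvw (rvar a)
      change ratAct v (rvar a) = ratAct w (rvar a) at this
      rw [ratAct_rvar, ratAct_rvar] at this
      exact rvar_injective this)
  rw [Fintype.linearIndependent_iff] at h1
  funext w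
  refine h1 k ?_ w
  funext f
  simpa using h f

variable (q : ℂ)

/-- The coefficient of `1` in the Demazure-Lusztig operator. -/
def dlConst (a a' : I) : RatFun I := (algebraMap ℂ _ q - 1) * rvar a / (rvar a - rvar a')

/-- The coefficient of `s` in the Demazure-Lusztig operator. -/
def dlCoeff (a a' : I) : RatFun I := (rvar a - algebraMap ℂ _ q * rvar a') / (rvar a - rvar a')

/-- The Demazure-Lusztig operator of the simple reflection `s` that exchanges `a` and `a'`. -/
def demazureLusztig (a a' : I) : Module.End ℂ (RatFun I) :=
  Algebra.lmul ℂ _ (dlConst q a a') +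
    Algebra.lmul ℂ _ (dlCoeff q a a') * (ratAct (Equiv.swap a a')).toLinearMap

lemma demazureLusztig_apply (a a' : I) (f : RatFun I) :
    demazureLusztig q a a' f =
      dlConst q a a' * f + dlCoeff q a a' * ratAct (Equiv.swap a a') f := rfl

lemma ratAct_swap_swap (a a' : I) (f : RatFun I) :
    ratAct (Equiv.swap a a') (ratAct (Equiv.swap a a') f) = f := by
  rw [← ratAct_mul, Equiv.swap_mul_self, ratAct_one]

lemma ratAct_dlConst (w : Equiv.Perm I) (a a' : I) :
    ratAct w (dlConst q a a') = dlConst q (w a) (w a') := by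
  simp [dlConst, ratAct_rvar]

lemma ratAct_dlCoeff (w : Equiv.Perm I) (a a' : I) :
    ratAct w (dlCoeff q a a') = dlCoeff q (w a) (w a') := by
  simp [dlCoeff, ratAct_rvar]

lemma demazureLusztig_quadratic {a a' : I} (h : a ≠ a') :
    (demazureLusztig q a a' + 1) * (demazureLusztig q a a' - algebraMap ℂ _ q) = 0 := by
  ext f
  have h1 := rvar_sub_ne_zero h
  have h2 := rvar_sub_ne_zero h.symm
  simp only [Module.End.mul_apply, LinearMap.add_apply, LinearMap.sub_apply, Module.End.one_apply,
    demazureLusztig_apply, map_add, map_sub, map_mul, ratAct_swap_swap, ratAct_dlConst,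
    ratAct_dlCoeff, Equiv.swap_apply_left, Equiv.swap_apply_right, Module.algebraMap_end_apply,
    Algebra.smul_def, AlgHom.commutes, LinearMap.zero_apply]
  -- With all reflections moved to the right, `f` and its image can be treated as independent
  -- unknowns; what remains is an identity of rational functions.
  generalize ratAct (Equiv.swap a a') f = f'
  simp only [dlConst, dlCoeff]
  generalize algebraMap ℂ (RatFun I) q = Q at *
  have h3 : rvar a' - rvar a = -(rvar a - rvar a') := by ring
  rw [h3]
  field_simp
  ring

lemma demazureLusztig_comm {a a' x x' : I} (h1 : a ≠ x) (h2 : a ≠ x') (h3 : a' ≠ x)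
    (h4 : a' ≠ x') :
    demazureLusztig q a a' * demazureLusztig q x x' =
      demazureLusztig q x x' * demazureLusztig q a a' := by
  ext f
  have hs : ratAct (Equiv.swap a a') (ratAct (Equiv.swap x x') f) =
      ratAct (Equiv.swap x x') (ratAct (Equiv.swap a a') f) := by
    rw [← ratAct_mul, ← ratAct_mul]
    congr 2
    apply Equiv.Perm.Disjoint.commute
    intro z
    by_cases hz : z = x ∨ z = x'
    · left
      rcases hz with rfl | rfl
      · exact Equiv.swap_apply_of_ne_of_ne h1.symm h3.symm
      · exact Equiv.swap_apply_of_ne_of_ne h2.symm h4.symm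
    · right
      push Not at hz
      exact Equiv.swap_apply_of_ne_of_ne hz.1 hz.2
  simp only [Module.End.mul_apply, demazureLusztig_apply, map_add, map_mul, ratAct_dlConst,
    ratAct_dlCoeff, hs, Equiv.swap_apply_of_ne_of_ne h1 h2, Equiv.swap_apply_of_ne_of_ne h3 h4,
    Equiv.swap_apply_of_ne_of_ne h1.symm h3.symm, Equiv.swap_apply_of_ne_of_ne h2.symm h4.symm]
  ring

lemma demazureLusztig_braid {a b c : I} (hab : a ≠ b) (hbc : b ≠ c) (hac : a ≠ c) :
    demazureLusztig q a b * demazureLusztig q b c * demazureLusztig q a b =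
      demazureLusztig q b c * demazureLusztig q a b * demazureLusztig q b c := by
  ext f
  have hs : ratAct (Equiv.swap a b) (ratAct (Equiv.swap b c) (ratAct (Equiv.swap a b) f)) =
      ratAct (Equiv.swap b c) (ratAct (Equiv.swap a b) (ratAct (Equiv.swap b c) f)) := by
    simp only [← ratAct_mul]
    rw [← mul_assoc, ← mul_assoc, swap_braid hab hbc hac]
  simp only [Module.End.mul_apply, demazureLusztig_apply, map_add, map_mul, ratAct_dlConst,
    ratAct_dlCoeff, ratAct_swap_swap, hs, Equiv.swap_apply_left, Equiv.swap_apply_right,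
    Equiv.swap_apply_of_ne_of_ne hac.symm hbc.symm, Equiv.swap_apply_of_ne_of_ne hab hac]
  -- The images of `f` under the six elements of the group generated by the two reflections become
  -- independent unknowns.
  generalize ratAct (Equiv.swap b c) (ratAct (Equiv.swap a b) (ratAct (Equiv.swap b c) f)) = f121
  generalize ratAct (Equiv.swap b c) (ratAct (Equiv.swap a b) f) = f21
  generalize ratAct (Equiv.swap a b) (ratAct (Equiv.swap b c) f) = f12
  generalize ratAct (Equiv.swap a b) f = f1
  generalize ratAct (Equiv.swap b c) f = f2
  have h1 := rvar_sub_ne_zero hab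
  have h2 := rvar_sub_ne_zero hbc
  have h3 := rvar_sub_ne_zero hac
  have k1 : rvar b - rvar a = -(rvar a - rvar b) := by ring
  have k2 : rvar c - rvar b = -(rvar b - rvar c) := by ring
  simp only [dlConst, dlCoeff]
  generalize algebraMap ℂ (RatFun I) q = Q at *
  rw [k1, k2]
  field_simp
  ring

lemma dlCoeff_ne_zero {a a' : I} (h : a ≠ a') : dlCoeff q a a' ≠ 0 :=
  div_ne_zero (rvar_sub_smul_ne_zero h q) (rvar_sub_ne_zero h)

lemma wordProd_demazureLusztig (w : Equiv.Perm I) (x x' : I) (hx : x ⋖ x') (hw : w x' < w x) :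
    wordProd (demazureLusztig q) w =
      wordProd (demazureLusztig q) (w * Equiv.swap x x') * demazureLusztig q x x' :=
  wordProd_eq _ (fun _ _ _ _ _ _ h1 h2 h3 h4 => demazureLusztig_comm q h1 h2 h3 h4)
    (fun _ _ _ h1 h2 => demazureLusztig_braid q h1.1.ne h2.1.ne (h1.1.trans h2.1).ne) w x x' hx hw

/-- The leading term of the operator of `T_w` is a multiple of `w`. -/
lemma wordProd_demazureLusztig_triangular (w : Equiv.Perm I) :
    ∃ k : Equiv.Perm I → RatFun I, k w ≠ 0 ∧ (∀ u, k u ≠ 0 → u = w ∨ length u < length w) ∧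
      ∀ f, wordProd (demazureLusztig q) w f = ∑ u, k u * ratAct u f := by
  induction w using perm_induction with
  | one =>
    refine ⟨fun u => if u = 1 then 1 else 0, by simp, fun u hu => Or.inl (by simpa using hu),
      fun f => ?_⟩
    simp [wordProd_one, ratAct_one]
  | step w a a' ha hd ih =>
    obtain ⟨k, k1, k2, k3⟩ := ih
    have hl := length_eq_of_descent ha w hd
    -- The automorphism `u` arises from `u` itself through the constant part of the last operator,
    -- and from `u s` through its reflecting part.
    refine ⟨fun u => k u * ratAct u (dlConst q a a') + k (u * Equiv.swap a a') *
      ratAct (u * Equiv.swap a a') (dlCoeff q a a'), ?_, ?_, ?_⟩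
    · have h0 : k w = 0 := by
        by_contra hne
        rcases k2 w hne with h | h
        · rw [← h] at hl; omega
        · omega
      simp only [h0, zero_mul, zero_add]
      rw [ratAct_dlCoeff]
      exact mul_ne_zero k1 (dlCoeff_ne_zero q ((w * Equiv.swap a a').injective.ne ha.1.ne))
    · intro u hu
      by_cases h1 : k u = 0
      · have h2 : k (u * Equiv.swap a a') ≠ 0 := by
          rintro h2
          simp [h1, h2] at hu
        rcases k2 _ h2 with h | h
        · exact Or.inl (mul_right_cancel h)
        · have := length_le_mul_swap ha u
          exact Or.inr (by omega)
      · rcases k2 u h1 with h | h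
        · subst h; exact Or.inr (by omega)
        · exact Or.inr (by omega)
    · intro f
      rw [wordProd_demazureLusztig q w a a' ha hd, Module.End.mul_apply, k3]
      simp only [demazureLusztig_apply, map_add, map_mul, mul_add, add_mul, Finset.sum_add_distrib]
      congr 1
      · exact Finset.sum_congr rfl fun u _ => by ring
      · refine (Fintype.sum_equiv (Equiv.mulRight (Equiv.swap a a')) _ _ fun u => ?_).symm
        simp only [Equiv.coe_mulRight]
        rw [← ratAct_mul, mul_assoc u, Equiv.swap_mul_self, mul_one]
        ring

end Rational

/-! ### The Poincaré-Birkhoff-Witt theorem -/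

namespace AffineHecke

section Rep

variable {I κ : Type} [Fintype I] [LinearOrder I] [PartialOrder κ] (b : I →o κ) (q : ℂ)

/-- The representation on rational functions, on the free algebra. -/
def preRep : FreeAlgebra ℂ (Gen b) →ₐ[ℂ] Module.End ℂ (RatFun I) :=
  FreeAlgebra.lift ℂ fun x => match x with
    | Gen.T w => wordProd (demazureLusztig q) (w : Equiv.Perm I)
    | Gen.theta f => Algebra.lmul ℂ _ (algebraMap (Laurent I) (RatFun I) f)

lemma preRep_T (w : youngSubgroup b) : preRep b q (FreeAlgebra.ι ℂ (Gen.T w)) =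
    wordProd (demazureLusztig q) (w : Equiv.Perm I) := by
  simp [preRep]

lemma preRep_theta (f : Laurent I) : preRep b q (FreeAlgebra.ι ℂ (Gen.theta f)) =
    Algebra.lmul ℂ _ (algebraMap (Laurent I) (RatFun I) f) := by
  simp [preRep]

lemma preRep_rel ⦃x y : FreeAlgebra ℂ (Gen b)⦄ (h : Rel b q x y) :
    preRep b q x = preRep b q y := by
  induction h with
  | theta_add f g => simp only [map_add, preRep_theta]
  | theta_mul f g => simp only [map_mul, preRep_theta]
  | theta_algebraMap c =>
    rw [preRep_theta, ← IsScalarTower.algebraMap_apply, AlgHom.commutes, AlgHom.commutes]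
  | T_one => rw [preRep_T, map_one, Subgroup.coe_one, wordProd_one]
  | T_mul v w h =>
    rw [map_mul, preRep_T, preRep_T, preRep_T]
    exact (wordProd_mul _ (wordProd_demazureLusztig q) _ _ h).symm
  | quadratic a a' h hb =>
    simp only [map_mul, map_add, map_sub, map_one, map_zero, AlgHom.commutes, preRep_T]
    rw [wordProd_swap _ h (wordProd_demazureLusztig q)]
    exact demazureLusztig_quadratic q h.1.ne
  | bernstein a a' h hb f g hg =>
    simp only [map_mul, map_sub, map_smul, preRep_T, preRep_theta]
    rw [wordProd_swap _ h (wordProd_demazureLusztig q)]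
    ext p
    have hg' : g * (xvar a - xvar a') =
        xvar a * (f - Laurent.rename (Equiv.swap a a') f) := by
      rw [← xvar_mul_one_sub_thetaNeg, ← hg]; ring
    replace hg' := congrArg (algebraMap (Laurent I) (RatFun I)) hg'
    simp only [map_mul, map_sub] at hg'
    change _ * (rvar a - rvar a') = rvar a * _ at hg'
    simp only [LinearMap.sub_apply, Module.End.mul_apply, demazureLusztig_apply,
      LinearMap.smul_apply, LinearMap.mul_apply', map_mul, ratAct_algebraMap,
      Algebra.coe_lmul_eq_mul]
    rw [Algebra.smul_def, map_sub, map_one]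
    have h0 := rvar_sub_ne_zero h.1.ne
    rw [eq_div_of_mul_eq h0 hg']
    simp only [dlConst]
    field_simp
    ring

/-- The representation of the affine Hecke algebra on rational functions. -/
def rep : AffineHecke b q →ₐ[ℂ] Module.End ℂ (RatFun I) :=
  RingQuot.liftAlgHom ℂ ⟨preRep b q, preRep_rel b q⟩

lemma rep_mk (x : FreeAlgebra ℂ (Gen b)) : rep b q (mk b q x) = preRep b q x :=
  RingQuot.liftAlgHom_mkAlgHom_apply ℂ _ _ _

lemma rep_T (w : youngSubgroup b) :
    rep b q (T b q w) = wordProd (demazureLusztig q) (w : Equiv.Perm I) := by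
  rw [T, rep_mk, preRep_T]

lemma rep_theta (f : Laurent I) :
    rep b q (theta b q f) = Algebra.lmul ℂ _ (algebraMap (Laurent I) (RatFun I) f) :=
  (rep_mk b q _).trans (preRep_theta b q f)

/-- The map `(c_w)_w ↦ ∑_w T_w c_w`. -/
def pbw : (youngSubgroup b → Laurent I) →ₗ[ℂ] AffineHecke b q where
  toFun c := ∑ w, T b q w * theta b q (c w)
  map_add' c c' := by simp [mul_add, Finset.sum_add_distrib]
  map_smul' z c := by simp [Finset.smul_sum]

lemma pbw_apply (c : youngSubgroup b → Laurent I) :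
    pbw b q c = ∑ w, T b q w * theta b q (c w) := rfl

lemma pbw_single (w : youngSubgroup b) (f : Laurent I) :
    pbw b q (Pi.single w f) = T b q w * theta b q f := by
  rw [pbw_apply, Finset.sum_eq_single w]
  · rw [Pi.single_eq_same]
  · intro u _ hu
    rw [Pi.single_eq_of_ne hu, map_zero, mul_zero]
  · simp

/-- In the representation on rational functions a relation `∑ T_w c_w = 0` becomes a relation
between automorphisms, whose coefficients vanish by Dedekind's theorem. At a longest `w` with `c_w ≠
0` only `T_w` contributes to the coefficient of `w`, by triangularity, and this contribution is
nonzero. -/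
lemma pbw_injective : Function.Injective (pbw b q) := by
  rw [injective_iff_map_eq_zero]
  intro c hc
  by_contra hne
  obtain ⟨w₀, hw₀⟩ : ∃ w, c w ≠ 0 := by
    by_contra! h
    exact hne (funext h)
  obtain ⟨w, hw, hmax⟩ := Finset.exists_max_image (Finset.univ.filter fun w => c w ≠ 0)
    (fun w => length (w : Equiv.Perm I)) ⟨w₀, by simpa using hw₀⟩
  simp only [Finset.mem_filter, Finset.mem_univ, true_and] at hw hmax
  choose k k1 k2 k3 using fun u : Equiv.Perm I => wordProd_demazureLusztig_triangular q u
  have h0 := ratAct_independent (fun v => ∑ u : youngSubgroup b,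
      k u v * algebraMap _ _ (Laurent.rename v (c u))) (by
    intro f
    have := congrArg (fun h => rep b q h f) hc
    simp only [pbw_apply, map_sum, map_mul, rep_T, rep_theta, LinearMap.sum_apply,
      Module.End.mul_apply, k3, map_zero, LinearMap.zero_apply, Algebra.coe_lmul_eq_mul,
      LinearMap.mul_apply', ratAct_algebraMap] at this
    rw [Finset.sum_comm] at this
    rw [← this]
    refine Finset.sum_congr rfl fun v _ => ?_
    rw [Finset.sum_mul]
    exact Finset.sum_congr rfl fun u _ => by ring)
  have h1 := congrFun h0 w
  simp only [Pi.zero_apply] at h1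
  rw [Finset.sum_eq_single w] at h1
  · rcases mul_eq_zero.mp h1 with h | h
    · exact k1 _ h
    · rw [map_eq_zero_iff _ (IsFractionRing.injective (Laurent I) (RatFun I)),
        map_eq_zero_iff _ (rename_perm_injective _)] at h
      exact hw h
  · intro u _ hu
    by_cases hcu : c u = 0
    · rw [hcu, map_zero, map_zero, mul_zero]
    · have : k u w = 0 := by
        by_contra hk
        rcases k2 _ _ hk with h | h
        · exact hu (Subtype.ext h.symm)
        · exact absurd (hmax u hcu) (not_le.mpr h)
      rw [this, zero_mul]
  · simp

variable {b q}

/-- The span of the `T_w f` is everything. -/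
lemma pbw_surjective : Function.Surjective (pbw b q) := by
  suffices h : ∀ h : AffineHecke b q, ∀ x ∈ LinearMap.range (pbw b q),
      x * h ∈ LinearMap.range (pbw b q) by
    intro x
    have h1 : (1 : AffineHecke b q) ∈ LinearMap.range (pbw b q) :=
      ⟨Pi.single 1 1, by rw [pbw_single, T_one, map_one, mul_one]⟩
    simpa using h x 1 h1
  -- The elements whose right multiplication preserves the range form a subalgebra, so generators
  -- suffice.
  let S : Subalgebra ℂ (AffineHecke b q) :=
    { carrier := {h | ∀ x ∈ LinearMap.range (pbw b q), x * h ∈ LinearMap.range (pbw b q)}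
      mul_mem' := fun {h h'} hh hh' x hx => by rw [← mul_assoc]; exact hh' _ (hh _ hx)
      add_mem' := fun {h h'} hh hh' x hx => by
        rw [mul_add]; exact Submodule.add_mem _ (hh _ hx) (hh' _ hx)
      algebraMap_mem' := fun z x hx => by
        rw [Algebra.algebraMap_eq_smul_one, mul_smul_comm, mul_one]
        exact Submodule.smul_mem _ _ hx }
  refine fun h => mem_of_generators S (fun a a' ha hb x hx => ?_) (fun f x hx => ?_) h
  · obtain ⟨c, rfl⟩ := hx
    rw [pbw_apply, Finset.sum_mul]
    refine Submodule.sum_mem _ fun w _ => ?_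
    obtain ⟨g, hg⟩ := exists_quotient a a' (Laurent.rename (Equiv.swap a a') (c w))
    rw [rename_swap_swap] at hg
    rw [mul_assoc, theta_mul_T ha hb _ g hg, mul_sub, mul_smul_comm, ← mul_assoc]
    refine Submodule.sub_mem _ ?_ (Submodule.smul_mem _ _ ⟨_, pbw_single b q w g⟩)
    rcases lt_or_gt_of_ne ((w : Equiv.Perm I).injective.ne ha.1.ne) with h | h
    · rw [T_mul_simple_of_lt ha hb w h]
      exact ⟨_, pbw_single b q _ _⟩
    · rw [T_mul_simple_of_gt ha hb w h, add_mul, smul_mul_assoc, smul_mul_assoc]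
      exact Submodule.add_mem _ (Submodule.smul_mem _ _ ⟨_, pbw_single b q _ _⟩)
        (Submodule.smul_mem _ _ ⟨_, pbw_single b q _ _⟩)
  · obtain ⟨c, rfl⟩ := hx
    refine ⟨fun w => c w * f, ?_⟩
    simp only [pbw_apply, Finset.sum_mul, map_mul, mul_assoc]

end Rep

end AffineHecke

/-! ### The retraction of an affine Hecke algebra onto a Levi subalgebra -/

section Retraction

variable {I J κ μ : Type} [Fintype I] [LinearOrder I] [Fintype J] [LinearOrder J]
  [PartialOrder κ] [PartialOrder μ] {b : I →o κ} {d : J →o μ}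

lemma BlockEmb.permMap_injective (F : BlockEmb b d) : Function.Injective F.permMap := by
  intro u v h
  apply Subtype.ext
  ext a
  have := F.permMap_apply u a
  rw [h, F.permMap_apply] at this
  exact (F.emb.injective this).symm

namespace AffineHecke

/-- The coordinates in the basis of Poincaré, Birkhoff and Witt. -/
def pbwEquiv (b : I →o κ) (q : ℂ) : (youngSubgroup b → Laurent I) ≃ₗ[ℂ] AffineHecke b q :=
  LinearEquiv.ofBijective (pbw b q) ⟨pbw_injective b q, pbw_surjective⟩

lemma pbwEquiv_symm_T_mul_theta (q : ℂ) (w : youngSubgroup b) (f : Laurent I) :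
    (pbwEquiv b q).symm (T b q w * theta b q f) = Pi.single w f := by
  rw [LinearEquiv.symm_apply_eq]
  exact (pbw_single b q w f).symm

/-- Induction on linear combinations of the `T_w f`. -/
lemma T_theta_induction {q : ℂ} {P : AffineHecke b q → Prop}
    (base : ∀ w f, P (T b q w * theta b q f)) (zero : P 0) (add : ∀ x y, P x → P y → P (x + y))
    (x : AffineHecke b q) : P x := by
  obtain ⟨c, rfl⟩ := pbw_surjective x
  rw [pbw_apply]
  exact Finset.sum_induction _ P add zero fun w _ => base w (c w)

variable (F : BlockEmb b d) (hF : Function.Surjective F.emb) (q : ℂ)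

/-- The projection onto the subalgebra of a block embedding along the `T_w f` with `w` outside the
Weyl group of this subalgebra. -/
def retraction : AffineHecke d q →ₗ[ℂ] AffineHecke b q :=
  pbw b q ∘ₗ (LinearMap.pi fun u => (Laurent.rename (Function.surjInv hF)).toLinearMap ∘ₗ
    LinearMap.proj (F.permMap u)) ∘ₗ (pbwEquiv d q).symm.toLinearMap

lemma rename_surjInv (f : Laurent I) :
    Laurent.rename (Function.surjInv hF) (Laurent.rename F.emb f) = f := by
  rw [rename_rename]
  have : Function.surjInv hF ∘ F.emb = id :=
    funext fun a => F.emb.injective (Function.surjInv_eq hF (F.emb a))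
  rw [this, rename_id]

include hF in
lemma rename_emb_surjective (f : Laurent J) : ∃ g : Laurent I, Laurent.rename F.emb g = f := by
  refine ⟨Laurent.rename (Function.surjInv hF) f, ?_⟩
  rw [rename_rename]
  have : F.emb ∘ Function.surjInv hF = id := funext fun a => Function.surjInv_eq hF a
  rw [this, rename_id]

lemma retraction_T_mul_theta (w : youngSubgroup d) (f : Laurent J) :
    retraction F hF q (T d q w * theta d q f) = pbw b q fun u =>
      Laurent.rename (Function.surjInv hF) (Pi.single (M := fun _ => Laurent J) w f (F.permMap u)) := by
  simp only [retraction, LinearMap.comp_apply, LinearEquiv.coe_coe, pbwEquiv_symm_T_mul_theta]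
  rfl

lemma retraction_permMap (u : youngSubgroup b) (f : Laurent I) :
    retraction F hF q (T d q (F.permMap u) * theta d q (Laurent.rename F.emb f)) =
      T b q u * theta b q f := by
  rw [retraction_T_mul_theta, ← pbw_single]
  congr 1
  funext v
  by_cases h : v = u
  · subst h
    rw [Pi.single_eq_same, Pi.single_eq_same, rename_surjInv]
  · rw [Pi.single_eq_of_ne h, Pi.single_eq_of_ne (F.permMap_injective.ne h), map_zero]

lemma retraction_of_notMem (w : youngSubgroup d) (hw : w ∉ Set.range F.permMap) (f : Laurent J) :
    retraction F hF q (T d q w * theta d q f) = 0 := by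
  rw [retraction_T_mul_theta]
  convert map_zero (pbw b q)
  rename_i u
  rw [Pi.single_eq_of_ne (fun h => hw ⟨u, h⟩), map_zero]
  rfl

lemma retraction_map (x : AffineHecke b q) : retraction F hF q (map F q x) = x := by
  induction x using T_theta_induction with
  | base w f => rw [map_mul, map_T, map_theta, retraction_permMap]
  | zero => rw [map_zero, map_zero]
  | add x y hx hy => rw [map_add, map_add, hx, hy]

/-- The retraction is linear over the subalgebra. -/
lemma retraction_mul_map (x : AffineHecke d q) (y : AffineHecke b q) :
    retraction F hF q (x * map F q y) = retraction F hF q x * y := by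
  -- `Z` is a complement of the Levi subalgebra on which the retraction vanishes. Linearity reduces
  -- to the stability of `Z` under right multiplication by the Levi subalgebra.
  let Z : Submodule ℂ (AffineHecke d q) := Submodule.span ℂ
    {z | ∃ w ∉ Set.range F.permMap, ∃ f, z = T d q w * theta d q f}
  have hZ0 : ∀ z ∈ Z, retraction F hF q z = 0 := by
    intro z hz
    induction hz using Submodule.span_induction with
    | mem z hz =>
      obtain ⟨w, hw, f, rfl⟩ := hz
      exact retraction_of_notMem F hF q w hw f
    | zero => rw [map_zero]
    | add x y _ _ hx hy => rw [map_add, hx, hy, add_zero]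
    | smul a x _ hx => rw [map_smul, hx, smul_zero]
  have hmem : ∀ w ∉ Set.range F.permMap, ∀ f, T d q w * theta d q f ∈ Z :=
    fun w hw f => Submodule.subset_span ⟨w, hw, f, rfl⟩
  let S : Subalgebra ℂ (AffineHecke b q) :=
    { carrier := {y | ∀ z ∈ Z, z * map F q y ∈ Z}
      mul_mem' := fun {y y'} hy hy' z hz => by
        rw [map_mul, ← mul_assoc]; exact hy' _ (hy _ hz)
      add_mem' := fun {y y'} hy hy' z hz => by
        rw [map_add, mul_add]; exact Z.add_mem (hy _ hz) (hy' _ hz)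
      algebraMap_mem' := fun c z hz => by
        rw [AlgHom.commutes, Algebra.algebraMap_eq_smul_one, mul_smul_comm, mul_one]
        exact Z.smul_mem _ hz }
  have extend : ∀ h : AffineHecke d q, (∀ w ∉ Set.range F.permMap, ∀ f,
      T d q w * theta d q f * h ∈ Z) → ∀ z ∈ Z, z * h ∈ Z := by
    intro h hh z hz
    induction hz using Submodule.span_induction with
    | mem z hz => obtain ⟨w, hw, f, rfl⟩ := hz; exact hh w hw f
    | zero => rw [zero_mul]; exact Z.zero_mem
    | add x y _ _ hx hy => rw [add_mul]; exact Z.add_mem hx hy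
    | smul a x _ hx => rw [smul_mul_assoc]; exact Z.smul_mem _ hx
  have hS : ∀ y, y ∈ S := by
    refine mem_of_generators S (fun a a' ha hb => extend _ fun w hw f => ?_)
      (fun f' => extend _ fun w hw f => ?_)
    · obtain ⟨f, rfl⟩ := rename_emb_surjective F hF f
      obtain ⟨g, hg⟩ := exists_quotient a a' (Laurent.rename (Equiv.swap a a') f)
      rw [rename_swap_swap] at hg
      have h1 := congrArg (map F q) (theta_mul_T (q := q) ha hb _ g hg)
      rw [map_mul, map_theta] at h1
      rw [mul_assoc, h1, map_sub, map_smul, map_mul, map_theta, map_theta, mul_sub, mul_smul_comm,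
        ← mul_assoc, map_T]
      refine Z.sub_mem ?_ (Z.smul_mem _ (hmem w hw _))
      -- The complement of a subgroup is stable under right multiplication by the subgroup.
      have hw' : w * F.permMap (simple hb) ∉ Set.range F.permMap := by
        rintro ⟨u, hu⟩
        refine hw ⟨u * (simple hb)⁻¹, ?_⟩
        rw [map_mul, map_inv, hu, mul_inv_cancel_right]
      rw [F.permMap_simple hb] at hw' ⊢
      rcases lt_or_gt_of_ne ((w : Equiv.Perm J).injective.ne (F.covBy ha hb).1.ne) with h | h
      · rw [T_mul_simple_of_lt (F.covBy ha hb) _ w h]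
        exact hmem _ hw' _
      · rw [T_mul_simple_of_gt (F.covBy ha hb) _ w h, add_mul, smul_mul_assoc, smul_mul_assoc]
        exact Z.add_mem (Z.smul_mem _ (hmem _ hw _)) (Z.smul_mem _ (hmem _ hw' _))
    · rw [map_theta, mul_assoc, ← map_mul]
      exact hmem _ hw _
  induction x using T_theta_induction with
  | base w f =>
    by_cases hw : w ∈ Set.range F.permMap
    · obtain ⟨u, rfl⟩ := hw
      obtain ⟨f, rfl⟩ := rename_emb_surjective F hF f
      rw [← map_T, ← map_theta, ← map_mul, ← map_mul, retraction_map, retraction_map]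
    · rw [hZ0 _ (hS y _ (hmem w hw f)), hZ0 _ (hmem w hw f), zero_mul]
  | zero => simp
  | add x y hx hy => rw [add_mul, map_add, map_add, hx, hy, add_mul]

/-- The retraction of the sign projector is a multiple of the sign projector. -/
lemma retraction_signProjector (hq : ∀ c : I →o κ,
    (∑ w : youngSubgroup c, (1 / q) ^ length (w : Equiv.Perm I)) ≠ 0)
    (hq' : (∑ w : youngSubgroup d, (1 / q) ^ length (w : Equiv.Perm J)) ≠ 0) :
    ∃ z : ℂ, z ≠ 0 ∧ retraction F hF q (signProjector d q) = z • signProjector b q := by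
  refine ⟨(∑ w : youngSubgroup d, (1 / q) ^ length (w : Equiv.Perm J))⁻¹ *
    (∑ w : youngSubgroup b, (1 / q) ^ length (w : Equiv.Perm I)),
    mul_ne_zero (inv_ne_zero hq') (hq b), ?_⟩
  rw [signProjector, signProjector, smul_smul, mul_assoc, mul_inv_cancel₀ (hq b), mul_one, map_smul,
    map_sum]
  congr 1
  have h1 : ∀ w : youngSubgroup d, retraction F hF q (T d q w) =
      retraction F hF q (T d q w * theta d q 1) := fun w => by rw [map_one, mul_one]
  rw [← Finset.sum_subset (Finset.subset_univ (Finset.univ.image F.permMap)), Finset.sum_image]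
  · refine Finset.sum_congr rfl fun u _ => ?_
    rw [map_smul, h1, F.length_permMap]
    have := retraction_permMap F hF q u 1
    rw [map_one] at this
    rw [this, map_one, mul_one]
  · exact fun u _ v _ h => F.permMap_injective h
  · intro w _ hw
    rw [map_smul, h1, retraction_of_notMem, smul_zero]
    simpa using hw

end AffineHecke

end Retraction

/-! ### Induced modules -/

section Induced

variable {B A : Type} [Ring B] [Algebra ℂ B] [Ring A] [Algebra ℂ A] (g : B →ₐ[ℂ] A)
  (Y : Type*) [AddCommGroup Y] [Module ℂ Y] [Module B Y]

/-- The element `x ⊗ v` of an induced module. -/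
def Ind.tmul {Y : Type*} [AddCommGroup Y] [Module ℂ Y] [Module B Y] (x : A) (v : Y) : Ind g Y :=
  Submodule.Quotient.mk (x ⊗ₜ[ℂ] v)

namespace Ind

variable {Y}

lemma tmul_mul (x : A) (y : B) (v : Y) : tmul g (x * g y) v = tmul g x (y • v) :=
  (Submodule.Quotient.eq _).mpr (Submodule.subset_span ⟨x, y, v, rfl⟩)

lemma smul_tmul (x x' : A) (v : Y) : x • tmul g x' v = tmul g (x * x') v := by
  rw [tmul, ← Submodule.Quotient.mk_smul, TensorProduct.smul_tmul']
  rfl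

lemma tmul_add (x : A) (v v' : Y) : tmul g x (v + v') = tmul g x v + tmul g x v' := by
  rw [tmul, TensorProduct.tmul_add]; rfl

lemma add_tmul (x x' : A) (v : Y) : tmul g (x + x') v = tmul g x v + tmul g x' v := by
  rw [tmul, TensorProduct.add_tmul]; rfl

lemma zero_tmul (v : Y) : tmul g 0 v = 0 := by
  rw [tmul, TensorProduct.zero_tmul]; rfl

lemma tmul_smul (z : ℂ) (x : A) (v : Y) : tmul g x (z • v) = z • tmul g x v := by
  rw [tmul, TensorProduct.tmul_smul]; rfl

lemma induction {P : Ind g Y → Prop} (base : ∀ x v, P (tmul g x v))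
    (zero : P 0) (add : ∀ x y, P x → P y → P (x + y)) (x : Ind g Y) : P x := by
  obtain ⟨x, rfl⟩ := Submodule.Quotient.mk_surjective _ x
  induction x using TensorProduct.induction_on with
  | zero => exact zero
  | tmul x v => exact base x v
  | add x y hx hy => exact add _ _ hx hy

/-- Frobenius reciprocity: the `A`-linear extension of a `B`-linear map. -/
def lift {N : Type*} [AddCommGroup N] [Module ℂ N] [Module A N] [IsScalarTower ℂ A N]
    (f : Y →ₗ[ℂ] N) (hf : ∀ (y : B) v, f (y • v) = g y • f v) : Ind g Y →ₗ[A] N :=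
  (balancing g Y).liftQ
    (TensorProduct.AlgebraTensorModule.lift (LinearMap.toSpanSingleton A (Y →ₗ[ℂ] N) f))
    (by
      refine Submodule.span_le.mpr ?_
      rintro _ ⟨x, y, v, rfl⟩
      simp [hf, mul_smul])

lemma lift_tmul {N : Type*} [AddCommGroup N] [Module ℂ N] [Module A N] [IsScalarTower ℂ A N]
    (f : Y →ₗ[ℂ] N) (hf : ∀ (y : B) v, f (y • v) = g y • f v) (x : A) (v : Y) :
    lift g f hf (tmul g x v) = x • f v := rfl

/-- The map `x ⊗ v ↦ p(x) v` for a `B`-linear map `p : A → B`. -/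
lemma exists_retract [IsScalarTower ℂ B Y] (p : A →ₗ[ℂ] B) (hp : ∀ x y, p (x * g y) = p x * y) :
    ∃ r : Ind g Y → Y, ∀ x v, r (tmul g x v) = p x • v := by
  let r₀ : A ⊗[ℂ] Y →ₗ[ℂ] Y := TensorProduct.lift
    ((Algebra.lsmul ℂ ℂ Y).toLinearMap.comp p)
  have h0 : ∀ z ∈ balancing g Y, r₀ z = 0 := by
    intro z hz
    -- `r₀` is not `A`-linear, so vanishing on generators of the `A`-span is not enough. The
    -- generators are stable under left multiplication by `A`, hence they already generate this span
    -- additively.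
    have hz' : z ∈ AddSubgroup.closure
        {z | ∃ (x : A) (y : B) (v : Y), z = (x * g y) ⊗ₜ[ℂ] v - x ⊗ₜ[ℂ] (y • v)} := by
      induction hz using Submodule.span_induction with
      | mem z hz => exact AddSubgroup.subset_closure hz
      | zero => exact zero_mem _
      | add x y _ _ hx hy => exact add_mem hx hy
      | smul a z hmem hz =>
        clear hmem
        induction hz using AddSubgroup.closure_induction with
        | mem z hz =>
          obtain ⟨x, y, v, rfl⟩ := hz
          refine AddSubgroup.subset_closure ⟨a * x, y, v, ?_⟩
          rw [smul_sub, TensorProduct.smul_tmul', TensorProduct.smul_tmul', smul_eq_mul,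
            smul_eq_mul, mul_assoc]
        | zero => rw [smul_zero]; exact zero_mem _
        | add x y _ _ hx hy => rw [smul_add]; exact add_mem hx hy
        | neg x _ hx => rw [smul_neg]; exact neg_mem hx
    clear hz
    induction hz' using AddSubgroup.closure_induction with
    | mem z hz =>
      obtain ⟨x, y, v, rfl⟩ := hz
      simp [r₀, hp]
    | zero => exact map_zero _
    | add x y _ _ hx hy => rw [map_add, hx, hy, add_zero]
    | neg x _ hx => rw [map_neg, hx, neg_zero]
  refine ⟨fun z => Quotient.liftOn' z r₀ fun x y hxy => ?_, fun x v => ?_⟩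
  · rw [← sub_eq_zero, ← map_sub]
    exact h0 _ ((Submodule.quotientRel_def _).mp hxy)
  · change r₀ (x ⊗ₜ v) = _
    simp [r₀]

end Ind

end Induced

/-! ### Decomposition of modules by colours of weights -/

open Polynomial in
/-- Polynomials `e k` that give a decomposition of unity modulo the product of the pairwise coprime
polynomials `Q k`. The roots of `Q k` are thought of as the numbers of colour `k`, and the ratio of
two numbers of different colours is not `q`. -/
structure ColorSystem (κ : Type) [Fintype κ] (q : ℂ) where
  Q : κ → ℂ[X]
  e : κ → ℂ[X]
  dvd_one_sub_sum : (∏ l, Q l) ∣ 1 - ∑ k, e k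
  dvd_Q_mul : ∀ k, (∏ l, Q l) ∣ Q k * e k
  dvd_e_mul : ∀ k l, k ≠ l → (∏ l, Q l) ∣ e k * e l
  coprime : ∀ k l, k ≠ l → IsCoprime (Q k) ((Q l).comp (C q * X))

namespace ColorSystem

variable {κ : Type} [Fintype κ] {q : ℂ} (C : ColorSystem κ q)

section Idempotent

variable {J : Type} [Fintype J]

/-- The element of `𝒜` that projects to the part of a module with colouring `φ`. -/
def idem (φ : J → κ) : Laurent J := ∏ a, Polynomial.aeval (xvar a) (C.e (φ a))

lemma sum_idem [DecidableEq J] :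
    ∑ φ : J → κ, C.idem φ = ∏ a, Polynomial.aeval (xvar a) (∑ k, C.e k) := by
  simp only [map_sum]
  rw [Finset.prod_univ_sum, Fintype.piFinset_univ]
  rfl

lemma rename_aeval {I : Type} (f : I → J) (a : I) (p : Polynomial ℂ) :
    Laurent.rename f (Polynomial.aeval (xvar a) p) = Polynomial.aeval (xvar (f a)) p := by
  rw [← rename_xvar f a, Polynomial.aeval_algHom_apply]

lemma rename_idem (w : Equiv.Perm J) (φ : J → κ) :
    Laurent.rename w (C.idem φ) = C.idem (φ ∘ w.symm) := by
  rw [idem, idem, map_prod]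
  refine Fintype.prod_equiv w _ _ fun a => ?_
  rw [rename_aeval, Function.comp_apply, Equiv.symm_apply_apply]

end Idempotent

section Module

variable {J μ : Type} [Fintype J] [LinearOrder J] [PartialOrder μ] (d : J →o μ)
  (M : Type*) [AddCommGroup M] [Module ℂ M] [Module (AffineHecke d q) M]
  [IsScalarTower ℂ (AffineHecke d q) M]

open AffineHecke

/-- All weights of the module have a colour. -/
def Colored : Prop :=
  ∀ (a : J) (v : M), theta d q (Polynomial.aeval (xvar a) (∏ l, C.Q l)) • v = 0

/-- The part of a module with colouring `φ`. -/
def colorSpace (φ : J → κ) : Submodule ℂ M where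
  carrier := {v | theta d q (C.idem φ) • v = v}
  add_mem' := fun {v w} hv hw => by
    simp only [Set.mem_ofPred_eq] at *
    rw [smul_add, hv, hw]
  zero_mem' := smul_zero _
  smul_mem' := fun z v hv => by
    simp only [Set.mem_ofPred_eq] at *
    rw [smul_comm, hv]

variable {d M}

lemma mem_colorSpace {φ : J → κ} {v : M} :
    v ∈ C.colorSpace d M φ ↔ theta d q (C.idem φ) • v = v := Iff.rfl

lemma idem_smul_of_mem {φ : J → κ} {v : M} (hv : v ∈ C.colorSpace d M φ) :
    theta d q (C.idem φ) • v = v := hv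

lemma theta_smul_comm (f g : Laurent J) (v : M) :
    theta d q f • theta d q g • v = theta d q g • theta d q f • v := by
  rw [smul_smul, smul_smul, ← map_mul, ← map_mul, mul_comm]

lemma theta_smul_mem {φ : J → κ} (f : Laurent J) {v : M} (hv : v ∈ C.colorSpace d M φ) :
    theta d q f • v ∈ C.colorSpace d M φ := by
  rw [mem_colorSpace] at *
  rw [theta_smul_comm, hv]

variable {C}

lemma Colored.smul_eq_zero (hM : C.Colored d M) {p : Polynomial ℂ} (hp : (∏ l, C.Q l) ∣ p) (a : J)
    (v : M) : theta d q (Polynomial.aeval (xvar a) p) • v = 0 := by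
  obtain ⟨r, rfl⟩ := hp
  rw [map_mul, mul_comm, map_mul, mul_smul, hM, smul_zero]

lemma Colored.smul_eq_zero_of_dvd (hM : C.Colored d M) {p : Polynomial ℂ}
    (hp : (∏ l, C.Q l) ∣ p) (a : J) (f : Laurent J) (hf : Polynomial.aeval (xvar a) p ∣ f)
    (v : M) : theta d q f • v = 0 := by
  obtain ⟨r, rfl⟩ := hf
  rw [map_mul, mul_smul, hM.smul_eq_zero hp]

/-- The sum factors as `∏_a (∑_k e_k(x_a))`, and each factor acts as the identity. -/
lemma Colored.sum_idem_smul (hM : C.Colored d M) (v : M) :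
    ∑ φ : J → κ, theta d q (C.idem φ) • v = v := by
  rw [← Finset.sum_smul, ← map_sum, sum_idem]
  refine Finset.prod_induction (M := Laurent J) _ (fun f => theta d q f • v = v) ?_ ?_ fun a _ => ?_
  · intro f g hf hg
    rw [map_mul, mul_smul, hg, hf]
  · rw [map_one, one_smul]
  · have := hM.smul_eq_zero C.dvd_one_sub_sum a v
    rw [map_sub, map_one, map_sub, map_one, sub_smul, one_smul, sub_eq_zero] at this
    exact this.symm

/-- One coordinate with two different colours suffices: the product then contains the factor `(e_k
e_l)(x_a)` with `k ≠ l`. -/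
lemma Colored.idem_smul_idem_of_ne (hM : C.Colored d M) {φ χ : J → κ} (h : φ ≠ χ) (v : M) :
    theta d q (C.idem φ) • theta d q (C.idem χ) • v = 0 := by
  obtain ⟨a, ha⟩ := Function.ne_iff.mp h
  rw [smul_smul, ← map_mul]
  refine hM.smul_eq_zero_of_dvd (C.dvd_e_mul _ _ ha) a _ ?_ v
  rw [map_mul]
  exact mul_dvd_mul (Finset.dvd_prod_of_mem _ (Finset.mem_univ a))
    (Finset.dvd_prod_of_mem _ (Finset.mem_univ a))

lemma Colored.idem_smul_mem (hM : C.Colored d M) (φ : J → κ) (v : M) :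
    theta d q (C.idem φ) • v ∈ C.colorSpace d M φ := by
  rw [mem_colorSpace]
  conv_rhs => rw [← hM.sum_idem_smul v, Finset.smul_sum]
  rw [Finset.sum_eq_single φ]
  · exact fun χ _ h => hM.idem_smul_idem_of_ne h.symm v
  · simp

lemma Colored.idem_smul_of_ne (hM : C.Colored d M) {φ χ : J → κ} (h : φ ≠ χ) {v : M}
    (hv : v ∈ C.colorSpace d M χ) : theta d q (C.idem φ) • v = 0 := by
  rw [← C.idem_smul_of_mem hv]
  exact hM.idem_smul_idem_of_ne h v

/-- A module is the direct sum of its parts of the various colours. -/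
def Colored.equiv (hM : C.Colored d M) : M ≃ₗ[ℂ] ((φ : J → κ) → C.colorSpace d M φ) where
  toFun v φ := ⟨_, hM.idem_smul_mem φ v⟩
  map_add' v w := by ext; simp
  map_smul' z v := by
    ext φ
    exact smul_comm _ _ _
  invFun v := ∑ φ, (v φ : M)
  left_inv v := hM.sum_idem_smul v
  right_inv v := by
    ext φ
    simp only
    rw [Finset.smul_sum, Finset.sum_eq_single φ]
    · exact (v φ).2
    · exact fun χ _ h => hM.idem_smul_of_ne h.symm (v χ).2
    · simp

lemma Colored.finrank_eq (hM : C.Colored d M) [FiniteDimensional ℂ M] :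
    Module.finrank ℂ M = ∑ φ : J → κ, Module.finrank ℂ (C.colorSpace d M φ) := by
  rw [hM.equiv.finrank_eq, Module.finrank_pi_fintype]

lemma Colored.Q_smul (hM : C.Colored d M) {φ : J → κ} {v : M} (hv : v ∈ C.colorSpace d M φ)
    (a : J) : theta d q (Polynomial.aeval (xvar a) (C.Q (φ a))) • v = 0 := by
  rw [← C.idem_smul_of_mem hv, smul_smul, ← map_mul]
  refine hM.smul_eq_zero_of_dvd (C.dvd_Q_mul (φ a)) a _ ?_ v
  rw [map_mul]
  exact mul_dvd_mul_left _ (Finset.dvd_prod_of_mem _ (Finset.mem_univ a))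

/-- `q x_a - x_a'` acts injectively if `a` and `a'` have different colours. -/
lemma Colored.eq_zero_of_smul (hM : C.Colored d M) {φ : J → κ} {v : M}
    (hv : v ∈ C.colorSpace d M φ) {a a' : J} (h : φ a ≠ φ a')
    (h0 : theta d q (q • xvar a - xvar a') • v = 0) : v = 0 := by
  -- On `v` the operators `x_a'` and `q x_a` agree, so `Q_{φ a'}(q x_a)` kills `v`. So does `Q_{φ
  -- a}(x_a)`, and the two polynomials in `x_a` are coprime.
  have h1 : theta d q (Polynomial.aeval (xvar a)
      ((C.Q (φ a')).comp (Polynomial.C q * Polynomial.X))) • v = 0 := by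
    have h2 := Polynomial.sub_dvd_eval_sub (q • xvar a) (xvar a')
      ((C.Q (φ a')).map (algebraMap ℂ (Laurent J)))
    rw [Polynomial.eval_map_algebraMap, Polynomial.eval_map_algebraMap] at h2
    obtain ⟨r, hr⟩ := h2
    rw [Polynomial.aeval_comp, map_mul, Polynomial.aeval_C, Polynomial.aeval_X, ← Algebra.smul_def,
      sub_eq_iff_eq_add.mp hr, map_add, add_smul, hM.Q_smul hv, add_zero, mul_comm, map_mul,
      mul_smul, h0, smul_zero]
  obtain ⟨u, w, huw⟩ := C.coprime _ _ h
  have h3 := congrArg (fun p => theta d q (Polynomial.aeval (xvar a) p) • v) huw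
  simpa [add_smul, mul_smul, h1, hM.Q_smul hv] using h3.symm

end Module

/-! ### Intertwiners of simple reflections and the parts that they exchange. -/

section Swap

variable {J : Type} [Fintype J] [LinearOrder J] {μ : Type} [PartialOrder μ] {d : J →o μ}
  {M : Type*} [AddCommGroup M] [Module ℂ M] [Module (AffineHecke d q) M]
  [IsScalarTower ℂ (AffineHecke d q) M]

open AffineHecke

section Tau

variable (q) {a a' : J} (h : a ⋖ a') (hb : d a = d a')

/-- A multiple of the normalized intertwiner of a simple reflection. -/
def tau : AffineHecke d q :=
  T d q (simple hb) * theta d q (xvar a - xvar a') - (q - 1) • theta d q (xvar a)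

include h in
lemma T_mul_theta_xvar : T d q (simple hb) * theta d q (xvar a) =
    theta d q (xvar a') * T d q (simple hb) + (q - 1) • theta d q (xvar a) := by
  have := bernstein (q := q) h hb (xvar a) (xvar a) (by
    rw [rename_xvar, Equiv.swap_apply_left, xvar_mul_one_sub_thetaNeg])
  rw [rename_xvar, Equiv.swap_apply_left] at this
  rw [← this]; abel

include h in
lemma T_mul_theta_xvar' : T d q (simple hb) * theta d q (xvar a') =
    theta d q (xvar a) * T d q (simple hb) - (q - 1) • theta d q (xvar a) := by
  have := bernstein (q := q) h hb (xvar a') (-xvar a) (by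
    rw [rename_xvar, Equiv.swap_apply_right, neg_mul, xvar_mul_one_sub_thetaNeg, neg_sub])
  rw [rename_xvar, Equiv.swap_apply_right, map_neg, smul_neg] at this
  rw [sub_eq_add_neg, ← this]; abel

include h in
-- The term `-(q - 1) x_a` cancels the correction in the Bernstein relation, because the divided
-- difference `g` of `f` satisfies `g (x_a - x_a') = x_a (f - s f)`.
lemma tau_mul_theta (f : Laurent J) : tau q hb * theta d q f =
    theta d q (Laurent.rename (Equiv.swap a a') f) * tau q hb := by
  obtain ⟨g, hg⟩ := exists_quotient a a' f
  have h1 := bernstein (q := q) h hb f g hg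
  have h2 : g * (xvar a - xvar a') = xvar a * (f - Laurent.rename (Equiv.swap a a') f) := by
    rw [← xvar_mul_one_sub_thetaNeg, ← hg]; ring
  have h3 := congrArg (theta d q) h2
  rw [map_mul, map_mul, map_sub (theta d q) f] at h3
  rw [sub_eq_iff_eq_add] at h1
  rw [tau, sub_mul, mul_assoc, ← map_mul, mul_comm (xvar a - xvar a') f, map_mul, ← mul_assoc, h1,
    add_mul, smul_mul_assoc, h3, mul_sub, mul_sub, smul_mul_assoc, smul_sub, mul_smul_comm,
    ← map_mul, ← map_mul, ← map_mul, mul_comm (xvar a) (Laurent.rename (Equiv.swap a a') f),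
    mul_assoc, add_comm]
  abel

include h in
-- On rational functions `tau` is the operator `(q x_a' - x_a) s`, and the square of this operator
-- is the asserted product. The proof obtains the identity directly from the defining relations.
lemma tau_mul_tau : tau q hb * tau q hb =
    theta d q ((q • xvar a - xvar a') * (q • xvar a' - xvar a)) := by
  have h1 := T_mul_theta_xvar q h hb
  have h2 := T_mul_theta_xvar' q h hb
  have h3 := T_simple_mul_self (q := q) h hb
  have h4 := tau_mul_theta q h hb
  have e1 : tau q hb * T d q (simple hb) =
      (q - 1) • (T d q (simple hb) * theta d q (xvar a)) -
        theta d q (q • xvar a - q • xvar a' + (q - 1) ^ 2 • xvar a) := by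
    have e2 : theta d q (xvar a - xvar a') * T d q (simple hb) =
        (2 * (q - 1)) • theta d q (xvar a) - T d q (simple hb) * theta d q (xvar a - xvar a') := by
      rw [map_sub, sub_mul, mul_sub (T d q (simple hb)), h1, h2]; module
    have e3 : theta d q (xvar a) * T d q (simple hb) =
        T d q (simple hb) * theta d q (xvar a') + (q - 1) • theta d q (xvar a) := by
      rw [h2]; abel
    rw [tau, sub_mul, mul_assoc, e2, mul_sub, mul_smul_comm, ← mul_assoc, h3, smul_mul_assoc, e3]
    simp only [map_sub, map_add, map_smul, mul_sub, add_mul, smul_mul_assoc, one_mul]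
    module
  have e4 := h4 (xvar a)
  rw [rename_xvar, Equiv.swap_apply_left] at e4
  have e5 : tau q hb * tau q hb = tau q hb * T d q (simple hb) * theta d q (xvar a - xvar a') -
      (q - 1) • (tau q hb * theta d q (xvar a)) := by
    conv_lhs => rw [tau, ← tau]
    conv_lhs => rhs; rw [tau]
    rw [mul_sub, mul_smul_comm, mul_assoc]
  have e6 : xvar a * (xvar a - xvar a') = (xvar a - xvar a') * xvar a := mul_comm _ _
  have e7 : theta d q ((q • xvar a - q • xvar a' + (q - 1) ^ 2 • xvar a) * (xvar a - xvar a')) =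
      (q - 1) ^ 2 • theta d q (xvar a * xvar a)
        - theta d q ((q • xvar a - xvar a') * (q • xvar a' - xvar a)) := by
    rw [← map_smul, ← map_sub]
    congr 1
    simp only [Algebra.smul_def, map_sub, map_one, map_pow]
    ring
  rw [e5, e1, tau]
  generalize xvar a - xvar a' = δ at *
  generalize (q • xvar a - xvar a') * (q • xvar a' - xvar a) = ε at *
  simp only [sub_mul, smul_mul_assoc, mul_assoc, ← map_mul]
  rw [e6]
  rw [e7, smul_sub, smul_smul]
  module

end Tau

variable {C} {φ : J → κ} {a a' : J} (h : a ⋖ a') (hb : d a = d a')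

include h in
lemma T_mul_idem_of_eq (hφ : φ ∘ Equiv.swap a a' = φ) :
    T d q (simple hb) * theta d q (C.idem φ) = theta d q (C.idem φ) * T d q (simple hb) := by
  have e : Laurent.rename (Equiv.swap a a') (C.idem φ) = C.idem φ := by
    rw [rename_idem, Equiv.symm_swap, hφ]
  have := bernstein (q := q) h hb (C.idem φ) 0 (by rw [e, zero_mul, sub_self])
  rwa [e, map_zero, smul_zero, sub_eq_zero] at this

lemma comp_swap_eq (hφ : φ a = φ a') : φ ∘ Equiv.swap a a' = φ := by
  funext x
  simp only [Function.comp_apply, Equiv.swap_apply_def]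
  split_ifs with h1 h2
  · rw [h1, hφ]
  · rw [h2, hφ]
  · rfl

lemma comp_swap_ne (hφ : φ a ≠ φ a') : φ ∘ Equiv.swap a a' ≠ φ := by
  intro h
  have := congrFun h a
  rw [Function.comp_apply, Equiv.swap_apply_left] at this
  exact hφ this.symm

lemma comp_swap_swap (φ : J → κ) (a a' : J) :
    (φ ∘ Equiv.swap a a') ∘ Equiv.swap a a' = φ := by
  funext x; simp

include h in
lemma T_smul_mem_of_eq (hφ : φ a = φ a') {v : M} (hv : v ∈ C.colorSpace d M φ) :
    T d q (simple hb) • v ∈ C.colorSpace d M φ := by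
  rw [mem_colorSpace] at *
  rw [smul_smul, ← T_mul_idem_of_eq h hb (comp_swap_eq hφ), mul_smul, hv]

include h in
-- The sum of the idempotents of `φ` and `φ s` is invariant under `s`, hence commutes with `T_s`; so
-- `T_s v` has components of these two colours only.
lemma Colored.T_smul_eq (hM : C.Colored d M) (hφ : φ a ≠ φ a') {v : M}
    (hv : v ∈ C.colorSpace d M φ) : T d q (simple hb) • v =
      theta d q (C.idem φ) • T d q (simple hb) • v +
        theta d q (C.idem (φ ∘ Equiv.swap a a')) • T d q (simple hb) • v := by
  have e : Laurent.rename (Equiv.swap a a') (C.idem φ + C.idem (φ ∘ Equiv.swap a a')) =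
      C.idem φ + C.idem (φ ∘ Equiv.swap a a') := by
    rw [map_add, rename_idem, rename_idem, Equiv.symm_swap, comp_swap_swap, add_comm]
  have := bernstein (q := q) h hb (C.idem φ + C.idem (φ ∘ Equiv.swap a a')) 0
    (by rw [e, zero_mul, sub_self])
  rw [e, map_zero, smul_zero, sub_eq_zero] at this
  rw [← add_smul, ← map_add, smul_smul, ← this, mul_smul, map_add, add_smul, C.idem_smul_of_mem hv,
    hM.idem_smul_of_ne (comp_swap_ne hφ) hv, add_zero]

include h in
/-- Up to the action on the part of colour `φ`, the operator `T_s` permutes the weights. -/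
lemma Colored.idem_smul_T_smul_theta (hM : C.Colored d M) (hφ : φ a ≠ φ a') (f : Laurent J) {v : M}
    (hv : v ∈ C.colorSpace d M φ) :
    theta d q (C.idem (φ ∘ Equiv.swap a a')) • T d q (simple hb) • theta d q f • v =
      theta d q (Laurent.rename (Equiv.swap a a') f) •
        theta d q (C.idem (φ ∘ Equiv.swap a a')) • T d q (simple hb) • v := by
  obtain ⟨g, hg⟩ := exists_quotient a a' f
  have h1 : T d q (simple hb) • theta d q f • v =
      theta d q (Laurent.rename (Equiv.swap a a') f) • T d q (simple hb) • v +
        (q - 1) • theta d q g • v := by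
    rw [smul_smul, sub_eq_iff_eq_add'.mp (bernstein (q := q) h hb f g hg), add_smul, mul_smul,
      smul_assoc]
  -- The Bernstein correction `θ_g v` still has colour `φ`, so the idempotent of the other colour
  -- removes it.
  rw [h1, smul_add, smul_comm _ (q - 1), hM.idem_smul_of_ne (comp_swap_ne hφ)
    (C.theta_smul_mem g hv), smul_zero, add_zero, theta_smul_comm]

include h in
lemma tau_smul_mem {v : M} (hv : v ∈ C.colorSpace d M φ) :
    tau q hb • v ∈ C.colorSpace d M (φ ∘ Equiv.swap a a') := by
  rw [mem_colorSpace] at *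
  have := tau_mul_theta q h hb (C.idem φ)
  rw [rename_idem, Equiv.symm_swap] at this
  rw [smul_smul, ← this, mul_smul, hv]

include h in
-- Both factors of `tau²` are injective on the part of colour `φ`, since the colours of `a` and `a'`
-- differ.
lemma Colored.tau_smul_eq_zero (hM : C.Colored d M) (hφ : φ a ≠ φ a') {v : M}
    (hv : v ∈ C.colorSpace d M φ) (h0 : tau q hb • v = 0) : v = 0 := by
  have h1 := congrArg (tau q hb • ·) h0
  simp only [smul_zero] at h1
  rw [smul_smul, tau_mul_tau q h hb, map_mul, mul_smul] at h1
  exact hM.eq_zero_of_smul hv hφ.symm (hM.eq_zero_of_smul (C.theta_smul_mem _ hv) hφ h1)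

variable (C)

include h hb in
lemma Colored.finrank_le (hM : C.Colored d M) [FiniteDimensional ℂ M] (φ : J → κ)
    (hφ : φ a ≠ φ a') : Module.finrank ℂ (C.colorSpace d M φ) ≤
      Module.finrank ℂ (C.colorSpace d M (φ ∘ Equiv.swap a a')) := by
  let t : C.colorSpace d M φ →ₗ[ℂ] C.colorSpace d M (φ ∘ Equiv.swap a a') :=
    ((Algebra.lsmul ℂ ℂ M (tau q hb)).domRestrict _).codRestrict _
      fun v => tau_smul_mem h hb v.2
  refine LinearMap.finrank_le_finrank_of_injective (f := t) ?_
  rw [injective_iff_map_eq_zero]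
  intro v hv
  exact Subtype.ext (hM.tau_smul_eq_zero h hb hφ v.2 (congrArg Subtype.val hv))

include h hb in
lemma Colored.finrank_comp_swap (hM : C.Colored d M) [FiniteDimensional ℂ M] (φ : J → κ) :
    Module.finrank ℂ (C.colorSpace d M (φ ∘ Equiv.swap a a')) =
      Module.finrank ℂ (C.colorSpace d M φ) := by
  by_cases hφ : φ a = φ a'
  · rw [comp_swap_eq hφ]
  · refine le_antisymm ?_ (Colored.finrank_le C h hb hM φ hφ)
    have := Colored.finrank_le C h hb hM (φ ∘ Equiv.swap a a') (by simpa using Ne.symm hφ)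
    rwa [comp_swap_swap] at this

variable {C}

include h in
lemma Colored.exists_tau_smul (hM : C.Colored d M) [FiniteDimensional ℂ M]
    (hφ : φ a ≠ φ a') {u : M} (hu : u ∈ C.colorSpace d M (φ ∘ Equiv.swap a a')) :
    ∃ v ∈ C.colorSpace d M φ, tau q hb • v = u := by
  let t : C.colorSpace d M φ →ₗ[ℂ] C.colorSpace d M (φ ∘ Equiv.swap a a') :=
    ((Algebra.lsmul ℂ ℂ M (tau q hb)).domRestrict _).codRestrict _
      fun v => tau_smul_mem h hb v.2
  have hi : Function.Injective t := by
    rw [injective_iff_map_eq_zero]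
    intro v hv
    exact Subtype.ext (hM.tau_smul_eq_zero h hb hφ v.2 (congrArg Subtype.val hv))
  obtain ⟨v, hv⟩ := (LinearMap.injective_iff_surjective_of_finrank_eq_finrank
    (Colored.finrank_comp_swap C h hb hM φ).symm).mp hi ⟨u, hu⟩
  exact ⟨v, v.2, congrArg Subtype.val hv⟩

include h in
/-- The component of `T_s v` of the exchanged colour determines `v`, and is arbitrary. -/
lemma Colored.bijective_idem_T (hM : C.Colored d M) [FiniteDimensional ℂ M] (hφ : φ a ≠ φ a') :
    (∀ u ∈ C.colorSpace d M (φ ∘ Equiv.swap a a'), ∃ v ∈ C.colorSpace d M φ,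
      theta d q (C.idem (φ ∘ Equiv.swap a a')) • T d q (simple hb) • v = u) ∧
    ∀ v ∈ C.colorSpace d M φ,
      theta d q (C.idem (φ ∘ Equiv.swap a a')) • T d q (simple hb) • v = 0 → v = 0 := by
  let t : C.colorSpace d M φ →ₗ[ℂ] C.colorSpace d M (φ ∘ Equiv.swap a a') :=
    ((Algebra.lsmul ℂ ℂ M (theta d q (C.idem (φ ∘ Equiv.swap a a')) *
      T d q (simple hb))).domRestrict _).codRestrict _
      fun v => by
        simp only [LinearMap.domRestrict_apply, Algebra.lsmul_coe, mul_smul]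
        exact hM.idem_smul_mem _ _
  have hs : Function.Surjective t := by
    rintro ⟨u, hu⟩
    -- In the colour `φ s` the vectors `T_s (x_a - x_a') v` and `tau v` have the same component,
    -- because `(q - 1) x_a v` has colour `φ`. So surjectivity is inherited from `tau`.
    obtain ⟨v, hv, rfl⟩ := hM.exists_tau_smul h hb hφ hu
    refine ⟨⟨_, C.theta_smul_mem (xvar a - xvar a') hv⟩, Subtype.ext ?_⟩
    change (theta d q (C.idem (φ ∘ Equiv.swap a a')) * T d q (simple hb)) •
      theta d q (xvar a - xvar a') • v = _
    have h1 := C.idem_smul_of_mem hu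
    conv_lhs at h1 => rw [tau, sub_smul, smul_sub, smul_assoc, smul_comm _ (q - 1),
      hM.idem_smul_of_ne (comp_swap_ne hφ) (C.theta_smul_mem _ hv), smul_zero, sub_zero]
    refine Eq.trans ?_ h1
    rw [mul_smul, mul_smul]
  have hi := (LinearMap.injective_iff_surjective_of_finrank_eq_finrank
    (Colored.finrank_comp_swap C h hb hM φ).symm).mpr hs
  constructor
  · intro u hu
    obtain ⟨v, hv⟩ := hs ⟨u, hu⟩
    refine ⟨v, v.2, ?_⟩
    rw [smul_smul]
    exact congrArg Subtype.val hv
  · intro v hv h0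
    have : t ⟨v, hv⟩ = 0 := Subtype.ext (by
      rw [smul_smul] at h0
      exact h0)
    exact congrArg Subtype.val (hi (this.trans (map_zero t).symm))

end Swap

end ColorSystem

/-! ### Modules induced from their part of a sorted colouring -/

section Increasing

variable {J κ : Type} [Fintype J] [LinearOrder J] [LinearOrder κ]

/-- The permutations that increase on each fibre of a colouring. -/
def increasing (ψ : J →o κ) : Finset (Equiv.Perm J) :=
  open Classical in Finset.univ.filter fun w => ∀ x y, x < y → ψ x = ψ y → w x < w y

/-- The colourings that arise from a given one by a permutation. -/
def orbit (ψ : J → κ) : Finset (J → κ) := Finset.univ.image fun w : Equiv.Perm J => ψ ∘ w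

lemma mem_increasing {ψ : J →o κ} {w : Equiv.Perm J} :
    w ∈ increasing ψ ↔ ∀ x y, x < y → ψ x = ψ y → w x < w y := by
  simp [increasing]

lemma mem_orbit {ψ χ : J → κ} : χ ∈ orbit ψ ↔ ∃ w : Equiv.Perm J, ψ ∘ w = χ := by
  simp [orbit]

/-- The injectivity is the uniqueness of the increasing representative of a coset. This inequality
is enough, since the reverse bounds come from dimensions of colour parts. -/
lemma card_increasing_le (ψ : J →o κ) : (increasing ψ).card ≤ (orbit ψ).card := by
  refine Finset.card_le_card_of_injOn (fun w => ψ ∘ w.symm) ?_ ?_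
  · exact fun w _ => mem_orbit.mpr ⟨w.symm, rfl⟩
  · intro v hv w hw h
    exact eq_of_increasing ψ v w (mem_increasing.mp hv) (mem_increasing.mp hw) h

lemma exists_descent_of_notMem_increasing {ψ : J →o κ} {w : Equiv.Perm J}
    (hw : w ∉ increasing ψ) : ∃ a a', a ⋖ a' ∧ ψ a = ψ a' ∧ w a' < w a := by
  by_contra! hcon
  let : LocallyFiniteOrder J := Fintype.toLocallyFiniteOrder
  -- Without a descent inside a fibre, this map increases along every covering pair, hence
  -- everywhere; on a fibre of `ψ` this says that `w` increases.
  have h : StrictMono fun x => toLex (ψ x, w x) := by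
    rw [strictMono_iff_forall_covBy]
    intro a a' ha
    rw [Prod.Lex.toLex_lt_toLex]
    rcases (ψ.monotone ha.1.le).lt_or_eq with h | h
    · exact Or.inl h
    · exact Or.inr ⟨h, lt_of_le_of_ne (hcon a a' ha h) (w.injective.ne ha.1.ne)⟩
  refine hw (mem_increasing.mpr fun x y hxy hψ => ?_)
  rcases Prod.Lex.toLex_lt_toLex.mp (h hxy) with h' | h'
  · exact absurd hψ h'.ne
  · exact h'.2

end Increasing

/-! ### Spanning sets and dimension bounds for induced modules. -/

section Levi

variable {I J κ μ : Type} [Fintype I] [LinearOrder I] [Fintype J] [LinearOrder J]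
  [LinearOrder κ] [PartialOrder μ] {b : I →o κ} {d : J →o μ}

/-- The colouring of the coordinates of `J` by the blocks of `I`. -/
def BlockEmb.coloring (F : BlockEmb b d) (hF : Function.Surjective F.emb) : J →o κ where
  toFun x := b (Function.surjInv hF x)
  monotone' x y h := b.monotone (by
    rwa [← F.emb.le_iff_le, Function.surjInv_eq hF, Function.surjInv_eq hF])

lemma BlockEmb.coloring_apply (F : BlockEmb b d) (hF : Function.Surjective F.emb) (a : I) :
    F.coloring hF (F.emb a) = b a :=
  congrArg b (F.emb.injective (Function.surjInv_eq hF (F.emb a)))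

open AffineHecke

variable (F : BlockEmb b d) (hF : Function.Surjective F.emb) (hd : ∀ x y, d x = d y) (q : ℂ)
  (Y : Type*) [AddCommGroup Y] [Module ℂ Y] [Module (AffineHecke b q) Y]
  [IsScalarTower ℂ (AffineHecke b q) Y]

/-- The Weyl group element of a permutation, if there is only one block. -/
def full (hd : ∀ x y, d x = d y) (w : Equiv.Perm J) : youngSubgroup d := ⟨w, fun _ => hd _ _⟩

/-- The map `(v_w)_w ↦ ∑ T_w ⊗ v_w`. -/
def sumTmul : (increasing (F.coloring hF) → Y) →ₗ[ℂ] Ind (map F q) Y where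
  toFun v := ∑ w : increasing (F.coloring hF), Ind.tmul (map F q) (T d q (full hd w.1)) (v w)
  map_add' v v' := by simp [Ind.tmul_add, Finset.sum_add_distrib]
  map_smul' z v := by simp [Ind.tmul_smul, Finset.smul_sum]

/-- If `w` does not increase on the fibres, it can be written as a shorter permutation times a
simple reflection of the Levi subgroup, with additive lengths. The corresponding `T_s` moves across
the tensor sign, and induction on the length applies. -/
lemma sumTmul_surjective : Function.Surjective (sumTmul F hF hd q Y) := by
  classical
  have key : ∀ (w : Equiv.Perm J) (v : Y),
      Ind.tmul (map F q) (T d q (full hd w)) v ∈ LinearMap.range (sumTmul F hF hd q Y) := by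
    intro w
    induction hl : length w using Nat.strong_induction_on generalizing w with
    | _ l ih =>
      intro v
      by_cases hw : w ∈ increasing (F.coloring hF)
      · refine ⟨Pi.single ⟨w, hw⟩ v, ?_⟩
        change ∑ u : increasing (F.coloring hF), _ = _
        rw [Finset.sum_eq_single ⟨w, hw⟩]
        · rw [Pi.single_eq_same]
        · intro u _ hu
          rw [Pi.single_eq_of_ne hu, ← zero_smul (AffineHecke b q) (0 : Y), ← Ind.tmul_mul, map_zero,
            mul_zero, Ind.zero_tmul]
        · simp
      · obtain ⟨a, a', ha, hψ, hd'⟩ := exists_descent_of_notMem_increasing hw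
        obtain ⟨a, rfl⟩ := hF a
        obtain ⟨a', rfl⟩ := hF a'
        rw [F.coloring_apply, F.coloring_apply] at hψ
        have h1 := length_eq_of_descent ha w hd'
        rw [T_eq_mul_simple ha (F.map_block a a' hψ) (full hd w) hd', ← F.permMap_simple hψ,
          ← map_T, Ind.tmul_mul, F.permMap_simple hψ]
        exact ih _ (by omega) (w * Equiv.swap (F.emb a) (F.emb a')) rfl _
  intro x
  change x ∈ LinearMap.range (sumTmul F hF hd q Y)
  induction x using Ind.induction with
  | base x v =>
    induction x using T_theta_induction with
    | base w f =>
      obtain ⟨f, rfl⟩ := rename_emb_surjective F hF f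
      rw [← map_theta, Ind.tmul_mul]
      exact key w _
    | zero => rw [Ind.zero_tmul]; exact zero_mem _
    | add x y hx hy => rw [Ind.add_tmul]; exact add_mem hx hy
  | zero => exact zero_mem _
  | add x y hx hy => exact add_mem hx hy

include hF hd in
lemma finite_ind [FiniteDimensional ℂ Y] : FiniteDimensional ℂ (Ind (map F q) Y) :=
  Module.Finite.of_surjective _ (sumTmul_surjective F hF hd q Y)

include hd in
lemma finrank_ind_le [FiniteDimensional ℂ Y] : Module.finrank ℂ (Ind (map F q) Y) ≤
    (orbit (F.coloring hF)).card * Module.finrank ℂ Y := by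
  refine (LinearMap.finrank_le_finrank_of_surjective (sumTmul_surjective F hF hd q Y)).trans ?_
  rw [Module.finrank_pi_fintype, Finset.sum_const, Finset.card_univ, Fintype.card_coe, smul_eq_mul]
  exact Nat.mul_le_mul_right _ (card_increasing_le _)

end Levi

namespace ColorSystem

open AffineHecke

variable {κ : Type} [Fintype κ] [LinearOrder κ] {q : ℂ} {C : ColorSystem κ q}
  {J μ : Type} [Fintype J] [LinearOrder J] [PartialOrder μ] {d : J →o μ} (hd : ∀ x y, d x = d y)
  {M : Type*} [AddCommGroup M] [Module ℂ M] [Module (AffineHecke d q) M]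
  [IsScalarTower ℂ (AffineHecke d q) M] [FiniteDimensional ℂ M]

include hd in
lemma Colored.finrank_comp_perm (hM : C.Colored d M) (φ : J → κ) (w : Equiv.Perm J) :
    Module.finrank ℂ (C.colorSpace d M (φ ∘ w)) = Module.finrank ℂ (C.colorSpace d M φ) := by
  induction w using perm_induction with
  | one => rfl
  | step w a a' h _ ih =>
    rw [← ih]
    exact (Colored.finrank_comp_swap C h (hd a a') hM (φ ∘ w)).symm

include hd in
-- Parts of neighbouring colourings in an orbit are equal or are images of each other under `tau`,
-- which lies in the algebra and so preserves `S`.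
lemma Colored.colorSpace_comp_perm_le (hM : C.Colored d M) (S : Submodule (AffineHecke d q) M)
    (φ : J → κ) (hS : ∀ v ∈ C.colorSpace d M φ, v ∈ S) (w : Equiv.Perm J) :
    ∀ v ∈ C.colorSpace d M (φ ∘ w), v ∈ S := by
  induction w using perm_induction with
  | one => exact hS
  | step w a a' h _ ih =>
    intro v hv
    by_cases hφ : (φ ∘ w) a = (φ ∘ w) a'
    · have := comp_swap_eq hφ
      refine ih v ?_
      change v ∈ C.colorSpace d M ((φ ∘ w) ∘ Equiv.swap a a')
      rwa [this]
    · have h1 : (φ ∘ (w * Equiv.swap a a' : Equiv.Perm J)) a ≠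
          (φ ∘ (w * Equiv.swap a a' : Equiv.Perm J)) a' := by
        simpa using Ne.symm hφ
      have h2 : φ ∘ w = (φ ∘ (w * Equiv.swap a a' : Equiv.Perm J)) ∘ Equiv.swap a a' :=
        (comp_swap_swap (φ ∘ w) a a').symm
      rw [h2] at hv
      obtain ⟨u, hu, rfl⟩ := hM.exists_tau_smul h (hd a a') h1 hv
      exact S.smul_mem _ (ih u hu)

include hd in
lemma Colored.card_orbit_mul_finrank (hM : C.Colored d M) (φ : J → κ) :
    (orbit φ).card * Module.finrank ℂ (C.colorSpace d M φ) =
      ∑ χ ∈ orbit φ, Module.finrank ℂ (C.colorSpace d M χ) := by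
  rw [Finset.sum_congr rfl (g := fun _ => Module.finrank ℂ (C.colorSpace d M φ)), Finset.sum_const,
    smul_eq_mul]
  intro χ hχ
  obtain ⟨w, rfl⟩ := mem_orbit.mp hχ
  exact hM.finrank_comp_perm hd φ w

include hd in
lemma Colored.card_orbit_mul_finrank_le (hM : C.Colored d M) (φ : J → κ) :
    (orbit φ).card * Module.finrank ℂ (C.colorSpace d M φ) ≤ Module.finrank ℂ M := by
  rw [hM.card_orbit_mul_finrank hd, hM.finrank_eq]
  exact Finset.sum_le_sum_of_subset (Finset.subset_univ _)

end ColorSystem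

lemma exists_monotone_comp {n : ℕ} {κ : Type} [LinearOrder κ] (φ : Fin n → κ) :
    ∃ w : Equiv.Perm (Fin n), Monotone (φ ∘ w) := ⟨Tuple.sort φ, Tuple.monotone_sort φ⟩

/-- Together with `exists_monotone_comp`, this makes the sorted colourings a system of
representatives of the orbits. -/
lemma eq_of_mem_orbit {n : ℕ} {κ : Type} [LinearOrder κ] {φ χ : Fin n → κ} (hφ : Monotone φ)
    (hχ : Monotone χ) (h : χ ∈ orbit φ) : χ = φ := by
  obtain ⟨w, rfl⟩ := mem_orbit.mp h
  exact Tuple.unique_monotone (f := φ) (σ := w) (τ := 1) hχ hφ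

lemma injective_of_surjective_of_finrank_le {R : Type} [Fintype R] {X : R → Type*}
    [∀ r, AddCommGroup (X r)] [∀ r, Module ℂ (X r)] [∀ r, FiniteDimensional ℂ (X r)] {N : Type*}
    [AddCommGroup N] [Module ℂ N] [FiniteDimensional ℂ N] (g : (∀ r, X r) →ₗ[ℂ] N)
    (hg : Function.Surjective g) (hle : Module.finrank ℂ (∀ r, X r) ≤ Module.finrank ℂ N) :
    Function.Injective g :=
  (LinearMap.injective_iff_surjective_of_finrank_eq_finrank
      (le_antisymm hle (LinearMap.finrank_le_finrank_of_surjective hg))).mpr hg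

namespace ColorSystem

open AffineHecke

variable {κ : Type} [Fintype κ] [LinearOrder κ] {q : ℂ} {C : ColorSystem κ q} {n : ℕ}
  {N : Type*} [AddCommGroup N] [Module ℂ N] [Module (Hn n q) N] [IsScalarTower ℂ (Hn n q) N]
  [FiniteDimensional ℂ N]

/-- A module is induced from its parts of sorted colours. -/
theorem Colored.nonempty_equiv_ind (hN : C.Colored (oneBlock n) N) {R : Type} [Fintype R]
    [DecidableEq R] {I : R → Type}
    [∀ r, Fintype (I r)] [∀ r, LinearOrder (I r)] {b : ∀ r, I r →o κ}
    (F : ∀ r, BlockEmb (b r) (oneBlock n)) (hF : ∀ r, Function.Surjective (F r).emb)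
    {Y : R → Type*} [∀ r, AddCommGroup (Y r)] [∀ r, Module ℂ (Y r)]
    [∀ r, Module (AffineHecke (b r) q) (Y r)] [∀ r, IsScalarTower ℂ (AffineHecke (b r) q) (Y r)]
    (f : ∀ r, Y r →ₗ[ℂ] N) (hf : ∀ r (y : AffineHecke (b r) q) v, f r (y • v) = map (F r) q y • f r v)
    (hinj : ∀ r, Function.Injective (f r))
    (hrange : ∀ r, LinearMap.range (f r) = C.colorSpace (oneBlock n) N ((F r).coloring (hF r)))
    (hF' : Function.Injective fun r => (F r).coloring (hF r))
    (hall : ∀ χ : Fin n →o κ, C.colorSpace (oneBlock n) N χ ≠ ⊥ → ∃ r, (F r).coloring (hF r) = χ) :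
    ∃ Φ : (⨁ r, Ind (map (F r) q) (Y r)) ≃ₗ[Hn n q] N,
      ∀ r x, Φ (DirectSum.lof (Hn n q) R _ r x) = Ind.lift (map (F r) q) (f r) (hf r) x := by
  have hd : ∀ x y, oneBlock n x = oneBlock n y := fun _ _ => rfl
  have fin : ∀ r, FiniteDimensional ℂ (Y r) := fun r => Module.Finite.of_injective (f r) (hinj r)
  have fin' : ∀ r, FiniteDimensional ℂ (Ind (map (F r) q) (Y r)) := fun r =>
    finite_ind (F r) (hF r) hd q (Y r)
  have free : ∀ r, Module.Free ℂ (Ind (map (F r) q) (Y r)) := fun r =>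
    Module.Free.of_divisionRing ℂ (Ind (map (F r) q) (Y r))
  let e : (⨁ r, Ind (map (F r) q) (Y r)) ≃ₗ[ℂ] (∀ r, Ind (map (F r) q) (Y r)) :=
    DirectSum.linearEquivFunOnFintype ℂ R fun r => Ind (map (F r) q) (Y r)
  let Φ : (⨁ r, Ind (map (F r) q) (Y r)) →ₗ[Hn n q] N :=
    DirectSum.toModule (Hn n q) R N fun r => Ind.lift (map (F r) q) (f r) (hf r)
  have hΦ : ∀ r x, Φ (DirectSum.lof (Hn n q) R _ r x) = Ind.lift (map (F r) q) (f r) (hf r) x :=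
    fun r x => DirectSum.toModule_lof (Hn n q) (M := fun r => Ind (map (F r) q) (Y r)) r x
  -- The range contains all sorted colour parts, hence the parts of all colourings in their orbits,
  -- and these span `N`.
  have hsurj : Function.Surjective Φ := by
    rw [← LinearMap.range_eq_top, eq_top_iff]
    rintro v -
    rw [← hN.sum_idem_smul v]
    refine Submodule.sum_mem _ fun φ _ => ?_
    obtain ⟨w, hw⟩ := exists_monotone_comp φ
    have hv := hN.idem_smul_mem φ v
    have e : φ = (φ ∘ w) ∘ w.symm := by funext x; simp
    generalize hu : theta (oneBlock n) q (C.idem φ) • v = u at hv ⊢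
    by_cases h0 : C.colorSpace (oneBlock n) N (φ ∘ w) = ⊥
    · have h1 := hN.finrank_comp_perm hd φ w
      rw [h0, finrank_bot] at h1
      rw [Submodule.finrank_eq_zero.mp h1.symm, Submodule.mem_bot] at hv
      rw [hv]
      exact zero_mem _
    · obtain ⟨r, hr⟩ := hall ⟨φ ∘ w, hw⟩ h0
      rw [e] at hv
      refine hN.colorSpace_comp_perm_le hd _ (φ ∘ w) (fun v' hv' => ?_) w.symm u hv
      have h2 : C.colorSpace (oneBlock n) N (φ ∘ w) = LinearMap.range (f r) := by
        rw [hrange, hr]; rfl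
      rw [h2] at hv'
      obtain ⟨y, rfl⟩ := hv'
      exact ⟨DirectSum.lof (Hn n q) R _ r (Ind.tmul _ 1 y), by
        rw [hΦ, Ind.lift_tmul, one_smul]⟩
  -- Each summand is at most as large as the sum of the colour parts in one orbit. Different sorted
  -- colourings have disjoint orbits, so the total does not exceed the dimension of `N`.
  have hle : Module.finrank ℂ (∀ r, Ind (map (F r) q) (Y r)) ≤ Module.finrank ℂ N := by
    rw [Module.finrank_pi_fintype, hN.finrank_eq]
    calc ∑ r, Module.finrank ℂ (Ind (map (F r) q) (Y r))
        ≤ ∑ r, ∑ χ ∈ orbit ((F r).coloring (hF r)),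
          Module.finrank ℂ (C.colorSpace (oneBlock n) N χ) := by
          refine Finset.sum_le_sum fun r _ => ?_
          rw [← hN.card_orbit_mul_finrank hd, ← hrange, LinearMap.finrank_range_of_inj (hinj r)]
          exact finrank_ind_le (F r) (hF r) hd q (Y r)
      _ = ∑ χ ∈ Finset.univ.biUnion fun r => orbit ((F r).coloring (hF r)),
          Module.finrank ℂ (C.colorSpace (oneBlock n) N χ) := by
          rw [Finset.sum_biUnion]
          intro r _ s _ hrs
          rw [Function.onFun, Finset.disjoint_left]
          intro χ h1 h2
          obtain ⟨v, rfl⟩ := mem_orbit.mp h1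
          obtain ⟨w, hw⟩ := mem_orbit.mp h2
          refine hrs (hF' (OrderHom.ext _ _ (eq_of_mem_orbit ((F s).coloring (hF s)).monotone
            ((F r).coloring (hF r)).monotone (mem_orbit.mpr ⟨w * v⁻¹, ?_⟩))))
          rw [Equiv.Perm.coe_mul, ← Function.comp_assoc, hw]
          funext x
          simp
      _ ≤ _ := Finset.sum_le_sum_of_subset (Finset.subset_univ _)
  have hsurj' : Function.Surjective ((Φ.restrictScalars ℂ).comp e.symm.toLinearMap) :=
    hsurj.comp e.symm.surjective
  have hinj' : Function.Injective ((Φ.restrictScalars ℂ).comp e.symm.toLinearMap) :=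
    injective_of_surjective_of_finrank_le (X := fun r => Ind (map (F r) q) (Y r)) _ hsurj' hle
  have hinj'' : Function.Injective Φ := fun x y hxy => e.injective (hinj' (by simpa using hxy))
  exact ⟨LinearEquiv.ofBijective Φ ⟨hinj'', hsurj⟩, hΦ⟩

end ColorSystem

/-! ### Intertwining operators between parts of different colours -/

namespace ColorSystem

open AffineHecke

variable {κ : Type} [Fintype κ] {q : ℂ} {C : ColorSystem κ q}
  {J μ : Type} [Fintype J] [LinearOrder J] [PartialOrder μ] {d : J →o μ} (hd : ∀ x y, d x = d y)
  {M : Type*} [AddCommGroup M] [Module ℂ M] [Module (AffineHecke d q) M]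
  [IsScalarTower ℂ (AffineHecke d q) M]

lemma T_full_one : T d q (full hd 1) = 1 := T_one d q

lemma T_full_eq_mul {a a' : J} (h : a ⋖ a') (w : Equiv.Perm J) (hw : w a' < w a) :
    T d q (full hd w) =
      T d q (full hd (w * Equiv.swap a a')) * T d q (simple (hd a a')) :=
  T_eq_mul_simple h (hd a a') (full hd w) hw

/-- The colours that occur in `T_w v` come from permutations that are not longer than `w`. -/
lemma Colored.exists_of_idem_smul_T_ne_zero (hM : C.Colored d M) {φ χ : J → κ} (w : Equiv.Perm J)
    {v : M} (hv : v ∈ C.colorSpace d M φ)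
    (h0 : theta d q (C.idem χ) • T d q (full hd w) • v ≠ 0) :
    ∃ u : Equiv.Perm J, length u ≤ length w ∧ φ ∘ u.symm = χ := by
  induction w using perm_induction generalizing φ v with
  | one =>
    refine ⟨1, le_rfl, ?_⟩
    rw [T_full_one, one_smul] at h0
    by_contra hne
    exact h0 (hM.idem_smul_of_ne (Ne.symm hne) hv)
  | step w a a' h hdesc ih =>
    have hl := length_eq_of_descent h w hdesc
    rw [T_full_eq_mul hd h w hdesc, mul_smul] at h0
    by_cases hφ : φ a = φ a'
    · obtain ⟨u, hu, e⟩ := ih (T_smul_mem_of_eq h (hd a a') hφ hv) h0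
      exact ⟨u, by omega, e⟩
    · rw [hM.T_smul_eq h (hd a a') hφ hv, smul_add, smul_add] at h0
      by_cases h1 : theta d q (C.idem χ) • T d q (full hd (w * Equiv.swap a a')) •
          theta d q (C.idem φ) • T d q (simple (hd a a')) • v = 0
      · rw [h1, zero_add] at h0
        obtain ⟨u, hu, e⟩ := ih (hM.idem_smul_mem _ _) h0
        have := length_mul_swap_le h u
        exact ⟨u * Equiv.swap a a', by omega, e⟩
      · obtain ⟨u, hu, e⟩ := ih (hM.idem_smul_mem _ _) h1
        exact ⟨u, by omega, e⟩

/-- The permutation `w` has minimal length among those that have the same effect on `φ`. -/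
def IsShortest (φ : J → κ) (w : Equiv.Perm J) : Prop :=
  ∀ u : Equiv.Perm J, φ ∘ u.symm = φ ∘ w.symm → length w ≤ length u

/-- A permutation with the same effect on `ψ` is `w g` with `g` preserving the fibres, and then `l(w
g) = l(w) + l(g)`. -/
lemma isShortest_of_increasing [LinearOrder κ] (ψ : J →o κ) {w : Equiv.Perm J}
    (hw : w ∈ increasing ψ) : IsShortest ψ w := by
  intro u hu
  have hg : w⁻¹ * u ∈ youngSubgroup ψ := fun x => by
    have := congrFun hu (u x)
    simp only [Function.comp_apply, Equiv.symm_apply_apply] at this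
    exact this.symm
  have := length_mul_of_increasing ψ w (mem_increasing.mp hw) _ hg
  rw [mul_inv_cancel_left] at this
  omega

variable (C) in
/-- The component of `T_w v` of colour `w φ`. -/
def intertwiner (φ : J → κ) (w : Equiv.Perm J) : AffineHecke d q :=
  theta d q (C.idem (φ ∘ w.symm)) * T d q (full hd w)

/-- If `a` and `a'` had equal colours, `w s` would have the same effect as `w` and be shorter. A
competitor `u` of `w s` for `φ s` gives the competitor `u s` of `w` for `φ`, whose length is at most
`l(u) + 1`. -/
lemma IsShortest.of_descent {φ : J → κ} {w : Equiv.Perm J} (hw : IsShortest φ w) {a a' : J}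
    (h : a ⋖ a') (hdesc : w a' < w a) :
    φ a ≠ φ a' ∧ IsShortest (φ ∘ Equiv.swap a a') (w * Equiv.swap a a') := by
  have hl := length_eq_of_descent h w hdesc
  have hs : (w * Equiv.swap a a').symm = Equiv.swap a a' * w.symm := by
    change (w * Equiv.swap a a')⁻¹ = _ * w⁻¹
    rw [mul_inv_rev, Equiv.swap_inv]
  refine ⟨fun hφ => ?_, fun u hu => ?_⟩
  · have := hw (w * Equiv.swap a a') (by
      rw [hs, Equiv.Perm.coe_mul, ← Function.comp_assoc, comp_swap_eq hφ])
    omega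
  · have h1 := hw (u * Equiv.swap a a') (by
      have hs' : (u * Equiv.swap a a').symm = Equiv.swap a a' * u.symm := by
        change (u * Equiv.swap a a')⁻¹ = _ * u⁻¹
        rw [mul_inv_rev, Equiv.swap_inv]
      rw [hs', Equiv.Perm.coe_mul, ← Function.comp_assoc, hu, hs, Equiv.Perm.coe_mul,
        ← Function.comp_assoc, comp_swap_swap])
    have h2 := length_mul_swap_le h u
    omega

lemma comp_symm_mul_swap (φ : J → κ) (w : Equiv.Perm J) (a a' : J) :
    (φ ∘ Equiv.swap a a') ∘ (w * Equiv.swap a a').symm = φ ∘ w.symm := by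
  have hs : (w * Equiv.swap a a').symm = Equiv.swap a a' * w.symm := by
    change (w * Equiv.swap a a')⁻¹ = _ * w⁻¹
    rw [mul_inv_rev, Equiv.swap_inv]
  rw [hs, Equiv.Perm.coe_mul, ← Function.comp_assoc, comp_swap_swap]

/-- Write `T_w = T_{w s} T_s` and split `T_s v` into its colours `φ` and `φ s`. The component of
colour `φ` contributes nothing: otherwise some permutation of length at most `l(w s)` would have the
effect of `w` on `φ`, against minimality. -/
lemma Colored.intertwiner_smul (hM : C.Colored d M) {φ : J → κ} {w : Equiv.Perm J}
    (hw : IsShortest φ w) {a a' : J} (h : a ⋖ a') (hdesc : w a' < w a) {v : M}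
    (hv : v ∈ C.colorSpace d M φ) : C.intertwiner hd φ w • v =
      C.intertwiner hd (φ ∘ Equiv.swap a a') (w * Equiv.swap a a') •
        theta d q (C.idem (φ ∘ Equiv.swap a a')) • T d q (simple (hd a a')) • v := by
  have hl := length_eq_of_descent h w hdesc
  obtain ⟨hφ, hw'⟩ := hw.of_descent h hdesc
  rw [intertwiner, intertwiner, comp_symm_mul_swap, T_full_eq_mul hd h w hdesc, mul_smul, mul_smul,
    mul_smul]
  conv_lhs => rw [hM.T_smul_eq h (hd a a') hφ hv, smul_add, smul_add]
  rw [add_eq_right]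
  by_contra hne
  obtain ⟨u, hu, e⟩ := hM.exists_of_idem_smul_T_ne_zero hd _ (hM.idem_smul_mem _ _) hne
  have := hw u e
  omega

lemma Colored.intertwiner_smul_mem (hM : C.Colored d M) (φ : J → κ) (w : Equiv.Perm J) (v : M) :
    C.intertwiner hd φ w • v ∈ C.colorSpace d M (φ ∘ w.symm) := by
  rw [intertwiner, mul_smul]
  exact hM.idem_smul_mem _ _

lemma Colored.intertwiner_one_smul {φ : J → κ} {v : M} (hv : v ∈ C.colorSpace d M φ) :
    C.intertwiner hd φ 1 • v = v := by
  rw [intertwiner, T_full_one, mul_one]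
  exact hv

lemma Colored.intertwiner_smul_theta (hM : C.Colored d M) {φ : J → κ} {w : Equiv.Perm J}
    (hw : IsShortest φ w) (f : Laurent J) {v : M} (hv : v ∈ C.colorSpace d M φ) :
    C.intertwiner hd φ w • theta d q f • v =
      theta d q (Laurent.rename w f) • C.intertwiner hd φ w • v := by
  induction w using perm_induction generalizing φ v f with
  | one =>
    rw [Colored.intertwiner_one_smul hd hv, Colored.intertwiner_one_smul hd (C.theta_smul_mem f hv),
      Equiv.Perm.coe_one, rename_id]
  | step w a a' h hdesc ih =>
    obtain ⟨hφ, hw'⟩ := hw.of_descent h hdesc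
    rw [hM.intertwiner_smul hd hw h hdesc (C.theta_smul_mem f hv),
      hM.intertwiner_smul hd hw h hdesc hv, hM.idem_smul_T_smul_theta h (hd a a') hφ f hv,
      ih hw' _ (hM.idem_smul_mem _ _), ← rename_mul_perm, mul_assoc, Equiv.swap_mul_self, mul_one]

lemma Colored.intertwiner_bijective [FiniteDimensional ℂ M] (hM : C.Colored d M) {φ : J → κ}
    {w : Equiv.Perm J} (hw : IsShortest φ w) :
    (∀ u ∈ C.colorSpace d M (φ ∘ w.symm), ∃ v ∈ C.colorSpace d M φ,
      C.intertwiner hd φ w • v = u) ∧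
    ∀ v ∈ C.colorSpace d M φ, C.intertwiner hd φ w • v = 0 → v = 0 := by
  induction w using perm_induction generalizing φ with
  | one =>
    refine ⟨fun u hu => ⟨u, hu, Colored.intertwiner_one_smul hd hu⟩, fun v hv h0 => ?_⟩
    rwa [Colored.intertwiner_one_smul hd hv] at h0
  | step w a a' h hdesc ih =>
    obtain ⟨hφ, hw'⟩ := hw.of_descent h hdesc
    obtain ⟨h1, h2⟩ := hM.bijective_idem_T h (hd a a') hφ
    obtain ⟨h3, h4⟩ := ih hw'
    rw [comp_symm_mul_swap] at h3
    constructor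
    · intro u hu
      obtain ⟨v', hv', rfl⟩ := h3 u hu
      obtain ⟨v, hv, rfl⟩ := h1 v' hv'
      exact ⟨v, hv, hM.intertwiner_smul hd hw h hdesc hv⟩
    · intro v hv h0
      rw [hM.intertwiner_smul hd hw h hdesc hv] at h0
      exact h2 v hv (h4 _ (hM.idem_smul_mem _ _) h0)

/-- With `s'` the simple reflection of the images, `w s = s' w` with additive lengths on both sides,
so `T_w T_s = T_{s'} T_w`. The idempotent commutes with `T_{s'}` because the permuted colouring
takes equal values at `w a` and `w a'`. -/
lemma intertwiner_mul_T {φ : J → κ} {w : Equiv.Perm J} {a a' : J} (h : a ⋖ a') (hφ : φ a = φ a')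
    (h' : w a ⋖ w a') : C.intertwiner hd φ w * T d q (simple (hd a a')) =
      T d q (simple (hd (w a) (w a'))) * C.intertwiner hd φ w := by
  have h1 : T d q (full hd w) * T d q (simple (hd a a')) = T d q (full hd w * simple (hd a a')) :=
    T_mul_simple_of_lt h (hd a a') (full hd w) h'.1
  have hs : Equiv.swap (w a) (w a') * w = w * Equiv.swap a a' := by
    rw [Equiv.mul_swap_eq_swap_mul]
  have h2 : T d q (simple (hd (w a) (w a'))) * T d q (full hd w) =
      T d q (full hd w * simple (hd a a')) := by
    have e : simple (hd (w a) (w a')) * full hd w = full hd w * simple (hd a a') := Subtype.ext hs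
    rw [← e]
    apply T_mul
    change length (Equiv.swap (w a) (w a') * w) = length (Equiv.swap (w a) (w a')) + length w
    rw [hs, length_mul_swap_of_lt h w h'.1, length_swap h', add_comm]
  rw [intertwiner, mul_assoc, h1, ← h2, ← mul_assoc, ← mul_assoc, T_mul_idem_of_eq h']
  exact comp_swap_eq (by simpa using hφ)

/-- Intertwiners commute with the action of subalgebras whose blocks they translate. -/
lemma Colored.intertwiner_smul_map (hM : C.Colored d M) {φ : J → κ} {w : Equiv.Perm J}
    (hw : IsShortest φ w) {I ν : Type} [Fintype I] [LinearOrder I] [PartialOrder ν] {b : I →o ν}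
    (F G : BlockEmb b d) (hFG : ∀ x, w (F.emb x) = G.emb x)
    (hφ : ∀ x y, b x = b y → φ (F.emb x) = φ (F.emb y)) (y : AffineHecke b q) :
    ∀ v ∈ C.colorSpace d M φ, map F q y • v ∈ C.colorSpace d M φ ∧
      C.intertwiner hd φ w • map F q y • v = map G q y • C.intertwiner hd φ w • v := by
  let S : Subalgebra ℂ (AffineHecke b q) :=
    { carrier := {y | ∀ v ∈ C.colorSpace d M φ, map F q y • v ∈ C.colorSpace d M φ ∧
        C.intertwiner hd φ w • map F q y • v = map G q y • C.intertwiner hd φ w • v}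
      mul_mem' := fun {y y'} hy hy' v hv => by
        obtain ⟨h1, h2⟩ := hy' v hv
        obtain ⟨h3, h4⟩ := hy _ h1
        rw [map_mul, map_mul, mul_smul, mul_smul]
        exact ⟨h3, by rw [h4, h2]⟩
      add_mem' := fun {y y'} hy hy' v hv => by
        obtain ⟨h1, h2⟩ := hy' v hv
        obtain ⟨h3, h4⟩ := hy v hv
        rw [map_add, map_add, add_smul, add_smul]
        exact ⟨add_mem h3 h1, by rw [smul_add, h2, h4]⟩
      algebraMap_mem' := fun z v hv => by
        rw [AlgHom.commutes, AlgHom.commutes, algebraMap_smul, algebraMap_smul]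
        exact ⟨Submodule.smul_mem _ _ hv, smul_comm _ _ _⟩ }
  refine mem_of_generators S (fun a a' ha hb v hv => ?_) (fun f v hv => ?_) y
  · rw [map_T, map_T, F.permMap_simple, G.permMap_simple]
    refine ⟨T_smul_mem_of_eq (F.covBy ha hb) _ (hφ _ _ hb) hv, ?_⟩
    have h1 := intertwiner_mul_T (C := C) hd (w := w) (F.covBy ha hb) (hφ _ _ hb) (by
      rw [hFG, hFG]; exact G.covBy ha hb)
    rw [smul_smul, smul_smul]
    refine congrArg (· • v) (h1.trans ?_)
    congr 3 <;> exact hFG _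
  · rw [map_theta, map_theta, hM.intertwiner_smul_theta hd hw _ hv, rename_rename]
    refine ⟨C.theta_smul_mem _ hv, ?_⟩
    have : (w : J → J) ∘ F.emb = G.emb := funext hFG
    rw [this]

end ColorSystem

/-! ### Sign projectors -/

namespace AffineHecke

section Sign

variable {I J κ μ : Type} [Fintype I] [LinearOrder I] [Fintype J] [LinearOrder J]
  [PartialOrder κ] [PartialOrder μ] {b : I →o κ} {d : J →o μ} {q : ℂ}

lemma sum_inv_pow_length_ne_zero (b : I →o κ) {q : ℝ} (hq : 1 < q) :
    (∑ w : youngSubgroup b, (1 / (q : ℂ)) ^ length (w : Equiv.Perm I)) ≠ 0 := by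
  have h : (∑ w : youngSubgroup b, (1 / (q : ℂ)) ^ length (w : Equiv.Perm I)) =
      ((∑ w : youngSubgroup b, (1 / q) ^ length (w : Equiv.Perm I) : ℝ) : ℂ) := by
    push_cast; rfl
  rw [h, Complex.ofReal_ne_zero]
  have hq0 : 0 < q := by linarith
  exact (Finset.sum_pos (fun w _ => by positivity) ⟨1, Finset.mem_univ _⟩).ne'

/-- Right multiplication by `T_s` mixes only `T_w` and `T_{w s}`, and the weights `(-1/q)^l` form an
eigenvector of eigenvalue `-1` on each such pair. -/
lemma signSum_mul_simple (hq : q ≠ 0) {a a' : I} (h : a ⋖ a') (hb : b a = b a') :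
    (∑ w : youngSubgroup b, (-1 / q) ^ length (w : Equiv.Perm I) • T b q w) * T b q (simple hb) =
      -∑ w : youngSubgroup b, (-1 / q) ^ length (w : Equiv.Perm I) • T b q w := by
  -- The coefficients in `T_w T_s = α T_w + β T_{w s}`, written uniformly for ascents and descents
  -- so that the second sum can be reindexed by `w ↦ w s`.
  let α : youngSubgroup b → ℂ := fun w =>
    if (w : Equiv.Perm I) a < (w : Equiv.Perm I) a' then 0 else q - 1
  let β : youngSubgroup b → ℂ := fun w =>
    if (w : Equiv.Perm I) a < (w : Equiv.Perm I) a' then 1 else q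
  have h1 : ∀ w, T b q w * T b q (simple hb) = α w • T b q w + β w • T b q (w * simple hb) := by
    intro w
    by_cases hw : (w : Equiv.Perm I) a < (w : Equiv.Perm I) a'
    · simp only [α, β, if_pos hw, zero_smul, one_smul, zero_add]
      exact T_mul_simple_of_lt h hb w hw
    · simp only [α, β, if_neg hw]
      exact T_mul_simple_of_gt h hb w
        (lt_of_le_of_ne (not_lt.mp hw) ((w : Equiv.Perm I).injective.ne h.1.ne'))
  have h2 : ∑ w : youngSubgroup b, ((-1 / q) ^ length (w : Equiv.Perm I) * β w) •
      T b q (w * simple hb) = ∑ w : youngSubgroup b,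
        ((-1 / q) ^ length ((w * simple hb : youngSubgroup b) : Equiv.Perm I) *
          β (w * simple hb)) • T b q w := by
    refine Fintype.sum_equiv (Equiv.mulRight (simple hb)) _ _ fun w => ?_
    simp only [Equiv.coe_mulRight, mul_assoc, simple_mul_self, mul_one]
  rw [Finset.sum_mul]
  simp only [smul_mul_assoc, h1, smul_add, smul_smul, Finset.sum_add_distrib]
  rw [h2, ← Finset.sum_add_distrib, ← Finset.sum_neg_distrib]
  refine Finset.sum_congr rfl fun w _ => ?_
  rw [← add_smul, ← neg_smul]
  congr 1
  have e : ((w * simple hb : youngSubgroup b) : Equiv.Perm I) =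
      (w : Equiv.Perm I) * Equiv.swap a a' := rfl
  by_cases hw : (w : Equiv.Perm I) a < (w : Equiv.Perm I) a'
  · have hw' : ¬ (((w * simple hb : youngSubgroup b) : Equiv.Perm I) a <
        ((w * simple hb : youngSubgroup b) : Equiv.Perm I) a') := by
      rw [e]; simpa using hw.le
    simp only [α, β, if_pos hw, if_neg hw']
    rw [e, length_mul_swap_of_lt h _ hw, pow_succ]
    field_simp
    ring
  · have hlt : (w : Equiv.Perm I) a' < (w : Equiv.Perm I) a :=
      lt_of_le_of_ne (not_lt.mp hw) ((w : Equiv.Perm I).injective.ne h.1.ne')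
    have hw' : ((w * simple hb : youngSubgroup b) : Equiv.Perm I) a <
        ((w * simple hb : youngSubgroup b) : Equiv.Perm I) a' := by
      rw [e]; simpa using hlt
    simp only [α, β, if_neg hw, if_pos hw']
    rw [e, length_eq_of_descent h _ hlt, pow_succ]
    field_simp
    ring

lemma signProjector_mul_simple (hq : q ≠ 0) {a a' : I} (h : a ⋖ a') (hb : b a = b a') :
    signProjector b q * T b q (simple hb) = -signProjector b q := by
  rw [signProjector, smul_mul_assoc, signSum_mul_simple hq h hb, smul_neg]

lemma signProjector_mul_T (hq : q ≠ 0) (w : youngSubgroup b) :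
    signProjector b q * T b q w = (-1 : ℂ) ^ length (w : Equiv.Perm I) • signProjector b q := by
  obtain ⟨w, hw⟩ := w
  induction w, hw using youngSubgroup_induction b with
  | one =>
    have : (⟨1, Subgroup.one_mem _⟩ : youngSubgroup b) = 1 := rfl
    rw [this, T_one, mul_one, Subgroup.coe_one, length_one, pow_zero, one_smul]
  | step w hw a a' haa hb hd ih =>
    rw [T_eq_mul_simple haa hb ⟨w, hw⟩ hd, ← mul_assoc]
    change signProjector b q * T b q ⟨w * Equiv.swap a a', _⟩ * _ = (-1 : ℂ) ^ length w • _
    rw [ih, smul_mul_assoc, signProjector_mul_simple hq haa hb, length_eq_of_descent haa w hd,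
      pow_succ, mul_neg_one, neg_smul, smul_neg]

/-- A sign projector absorbs the sign projectors of subalgebras. -/
lemma signProjector_mul_map (hq : q ≠ 0)
    (hb : (∑ w : youngSubgroup b, (1 / q) ^ length (w : Equiv.Perm I)) ≠ 0) (F : BlockEmb b d) :
    signProjector d q * map F q (signProjector b q) = signProjector d q := by
  conv_lhs => rhs; rw [signProjector]
  rw [map_smul, map_sum, mul_smul_comm, Finset.mul_sum]
  have h : ∀ w : youngSubgroup b, signProjector d q *
      map F q ((-1 / q) ^ length (w : Equiv.Perm I) • T b q w) =
        (1 / q) ^ length (w : Equiv.Perm I) • signProjector d q := by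
    intro w
    rw [map_smul, map_T, mul_smul_comm, signProjector_mul_T hq, F.length_permMap, smul_smul,
      ← mul_pow]
    congr 2
    ring
  rw [Finset.sum_congr rfl fun w _ => h w, ← Finset.sum_smul, smul_smul, inv_mul_cancel₀ hb,
    one_smul]

end Sign

end AffineHecke

/-- The identity embedding. -/
def BlockEmb.refl {I κ : Type} [LinearOrder I] [PartialOrder κ] (b : I →o κ) : BlockEmb b b where
  emb := RelEmbedding.refl _
  map_block _ _ h := h
  interval _ _ c _ _ _ := ⟨c, rfl⟩

/-- The composition of block embeddings. -/
def BlockEmb.comp {I J K κ μ ν : Type} [LinearOrder I] [LinearOrder J] [LinearOrder K]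
    [PartialOrder κ] [PartialOrder μ] [PartialOrder ν] {b : I →o κ} {d : J →o μ} {e : K →o ν}
    (G : BlockEmb d e) (F : BlockEmb b d) : BlockEmb b e where
  emb := F.emb.trans G.emb
  map_block a a' h := G.map_block _ _ (F.map_block _ _ h)
  interval a a' c h h1 h2 := by
    obtain ⟨x, rfl⟩ := G.interval (F.emb a) (F.emb a') c (F.map_block _ _ h) h1 h2
    obtain ⟨y, rfl⟩ := F.interval a a' x h (G.emb.le_iff_le.mp h1) (G.emb.le_iff_le.mp h2)
    exact ⟨y, rfl⟩

namespace AffineHecke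

section Ext

variable {I J K κ μ ν : Type} [Fintype I] [LinearOrder I] [Fintype J] [LinearOrder J] [Fintype K]
  [LinearOrder K] [PartialOrder κ] [PartialOrder μ] [PartialOrder ν] {b : I →o κ} {d : J →o μ}
  {e : K →o ν} {q : ℂ}

/-- Algebra homomorphisms that agree on generators are equal. -/
lemma algHom_ext {A : Type*} [Ring A] [Algebra ℂ A] {f g : AffineHecke b q →ₐ[ℂ] A}
    (hT : ∀ (a a' : I) (_ : a ⋖ a') (hb : b a = b a'), f (T b q (simple hb)) = g (T b q (simple hb)))
    (htheta : ∀ p, f (theta b q p) = g (theta b q p)) : f = g :=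
  AlgHom.ext fun x => mem_of_generators (AlgHom.equalizer f g) hT htheta x

lemma map_comp (G : BlockEmb d e) (F : BlockEmb b d) (x : AffineHecke b q) :
    map G q (map F q x) = map (G.comp F) q x := by
  refine DFunLike.congr_fun (algHom_ext (f := (map G q).comp (map F q)) (fun a a' _ hb => ?_)
    fun p => ?_) x
  · rw [AlgHom.comp_apply, map_T, map_T, map_T, F.permMap_simple, G.permMap_simple,
      BlockEmb.permMap_simple]
    rfl
  · rw [AlgHom.comp_apply, map_theta, map_theta, map_theta, rename_rename]
    rfl

lemma map_refl (x : AffineHecke b q) : map (BlockEmb.refl b) q x = x := by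
  refine DFunLike.congr_fun (algHom_ext (f := map (BlockEmb.refl b) q) (g := AlgHom.id ℂ _)
    (fun a a' _ hb => ?_) fun p => ?_) x
  · rw [map_T, BlockEmb.permMap_simple]
    rfl
  · rw [map_theta]
    exact congrArg _ (rename_id p)

lemma signProjector_mul_self (hq : q ≠ 0)
    (hb : (∑ w : youngSubgroup b, (1 / q) ^ length (w : Equiv.Perm I)) ≠ 0) :
    signProjector b q * signProjector b q = signProjector b q := by
  have := signProjector_mul_map hq hb (BlockEmb.refl b)
  rwa [map_refl] at this

end Ext

end AffineHecke

/-! ### The sign part of a module induced from a Levi subalgebra -/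

namespace ColorSystem

open AffineHecke

variable {κ : Type} [Fintype κ] [LinearOrder κ] {q : ℂ} {C : ColorSystem κ q} {n : ℕ}
  {M : Type*} [AddCommGroup M] [Module ℂ M] [Module (Hn n q) M] [IsScalarTower ℂ (Hn n q) M]
  [FiniteDimensional ℂ M] {I : Type} [Fintype I] [LinearOrder I] {b : I →o κ}

lemma Colored.map_smul_mem_colorSpace (hM : C.Colored (oneBlock n) M)
    (F : BlockEmb b (oneBlock n)) (hF : Function.Surjective F.emb) (y : AffineHecke b q) {v : M}
    (hv : v ∈ C.colorSpace (oneBlock n) M (F.coloring hF)) :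
    map F q y • v ∈ C.colorSpace (oneBlock n) M (F.coloring hF) := by
  -- The identity is shortest for every colouring; only the stability half of the lemma is needed.
  refine (hM.intertwiner_smul_map (fun _ _ => rfl) (w := 1) (fun u _ => ?_) F F (fun _ => rfl)
    (fun x y h => ?_) y v hv).1
  · rw [length_one]; exact Nat.zero_le _
  · rw [F.coloring_apply, F.coloring_apply, h]

/-- Every vector of the sign part comes from the sign part of the sorted colour. -/
lemma Colored.exists_sign_smul_eq (hq : q ≠ 0)
    (hb : (∑ w : youngSubgroup b, (1 / q) ^ length (w : Equiv.Perm I)) ≠ 0)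
    (hM : C.Colored (oneBlock n) M) (F : BlockEmb b (oneBlock n))
    (hF : Function.Surjective F.emb)
    (hall : ∀ χ : Fin n →o κ, C.colorSpace (oneBlock n) M χ ≠ ⊥ → F.coloring hF = χ) (x : M) :
    ∃ v ∈ C.colorSpace (oneBlock n) M (F.coloring hF), map F q (signProjector b q) • v = v ∧
      signProjector (oneBlock n) q • v = signProjector (oneBlock n) q • x := by
  have hd : ∀ x y, oneBlock n x = oneBlock n y := fun _ _ => rfl
  set S := signProjector (oneBlock n) q with hS
  set W : Submodule ℂ M := (C.colorSpace (oneBlock n) M (F.coloring hF)).map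
    (Algebra.lsmul ℂ ℂ M S) with hW
  -- A vector of an exchanged colour is `tau u = T_s (x_a - x_a') u - (q - 1) x_a u`. Since `S T_s =
  -- -S`, applying `S` leaves only vectors of the colour of `u`, which is nearer to the sorted one.
  have hperm : ∀ (w : Equiv.Perm (Fin n)), ∀ v ∈ C.colorSpace (oneBlock n) M (F.coloring hF ∘ w),
      S • v ∈ W := by
    intro w
    induction w using perm_induction with
    | one => exact fun v hv => ⟨v, hv, rfl⟩
    | step w a a' h _ ih =>
      intro v hv
      by_cases hφ : (F.coloring hF ∘ w) a = (F.coloring hF ∘ w) a'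
      · have := comp_swap_eq hφ
        refine ih v ?_
        change v ∈ C.colorSpace (oneBlock n) M ((F.coloring hF ∘ w) ∘ Equiv.swap a a')
        rwa [this]
      · have h1 : (F.coloring hF ∘ (w * Equiv.swap a a' : Equiv.Perm (Fin n))) a ≠
            (F.coloring hF ∘ (w * Equiv.swap a a' : Equiv.Perm (Fin n))) a' := by
          simpa using Ne.symm hφ
        have h2 : F.coloring hF ∘ w =
            (F.coloring hF ∘ (w * Equiv.swap a a' : Equiv.Perm (Fin n))) ∘ Equiv.swap a a' :=
          (comp_swap_swap (F.coloring hF ∘ w) a a').symm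
        rw [h2] at hv
        obtain ⟨u, hu, rfl⟩ := hM.exists_tau_smul h (hd a a') h1 hv
        rw [tau, sub_smul, smul_sub, mul_smul, smul_smul S, signProjector_mul_simple hq h, neg_smul,
          smul_assoc, smul_comm S (q - 1)]
        exact sub_mem (neg_mem (ih _ (C.theta_smul_mem _ hu)))
          (Submodule.smul_mem _ _ (ih _ (C.theta_smul_mem _ hu)))
  have hx : S • x ∈ W := by
    rw [← hM.sum_idem_smul x, Finset.smul_sum]
    refine Submodule.sum_mem _ fun φ _ => ?_
    obtain ⟨w, hw⟩ := exists_monotone_comp φ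
    have hv := hM.idem_smul_mem φ x
    have e : φ = (φ ∘ w) ∘ w.symm := by funext x; simp
    generalize hu : theta (oneBlock n) q (C.idem φ) • x = u at hv ⊢
    by_cases h0 : C.colorSpace (oneBlock n) M (φ ∘ w) = ⊥
    · have h1 := hM.finrank_comp_perm hd φ w
      rw [h0, finrank_bot] at h1
      rw [Submodule.finrank_eq_zero.mp h1.symm, Submodule.mem_bot] at hv
      rw [hv, smul_zero]
      exact zero_mem _
    · have hr := hall ⟨φ ∘ w, hw⟩ h0
      rw [e] at hv
      refine hperm w.symm u ?_
      rw [hr]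
      exact hv
  obtain ⟨v, hv, hvx⟩ := hx
  -- Passing to the sign part for the Levi subalgebra changes neither the colour of `v` nor the
  -- vector `S v`, because `S` absorbs the smaller projector.
  refine ⟨map F q (signProjector b q) • v, hM.map_smul_mem_colorSpace F hF _ hv, ?_, ?_⟩
  · rw [smul_smul, ← map_mul, signProjector_mul_self hq hb]
  · rw [smul_smul, signProjector_mul_map hq hb]
    exact hvx

/-- The part of the sorted colour, as a module over the Levi subalgebra. -/
def Colored.leviPart (hM : C.Colored (oneBlock n) M) (F : BlockEmb b (oneBlock n))
    (hF : Function.Surjective F.emb) : Submodule (AffineHecke b q) (Res (map F q) M) where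
  carrier := {v : M | v ∈ C.colorSpace (oneBlock n) M (F.coloring hF)}
  add_mem' hv hw := (C.colorSpace (oneBlock n) M (F.coloring hF)).add_mem hv hw
  zero_mem' := (C.colorSpace (oneBlock n) M (F.coloring hF)).zero_mem
  smul_mem' y _ hv := hM.map_smul_mem_colorSpace F hF y hv

/-- The sign projector is injective on the sign part of the sorted colour. -/
lemma Colored.eq_zero_of_sign_smul (hq : ∀ c : I →o κ,
    (∑ w : youngSubgroup c, (1 / q) ^ length (w : Equiv.Perm I)) ≠ 0)
    (hq' : (∑ w : youngSubgroup (oneBlock n), (1 / q) ^ length (w : Equiv.Perm (Fin n))) ≠ 0)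
    (hM : C.Colored (oneBlock n) M) (F : BlockEmb b (oneBlock n))
    (hF : Function.Surjective F.emb)
    (hall : ∀ χ : Fin n →o κ, C.colorSpace (oneBlock n) M χ ≠ ⊥ → F.coloring hF = χ) {v : M}
    (hv : v ∈ C.colorSpace (oneBlock n) M (F.coloring hF))
    (h1 : map F q (signProjector b q) • v = v)
    (h0 : signProjector (oneBlock n) q • v = 0) : v = 0 := by
  let f : hM.leviPart F hF →ₗ[ℂ] M :=
    { toFun := fun v => (v : Res (map F q) M)
      map_add' := fun _ _ => rfl
      map_smul' := fun _ _ => rfl }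
  obtain ⟨Φ, hΦ⟩ := hM.nonempty_equiv_ind (R := Unit) (I := fun _ => I) (b := fun _ => b)
    (fun _ => F) (fun _ => hF) (Y := fun _ => hM.leviPart F hF) (fun _ => f)
    (fun _ _ _ => rfl) (fun _ _ _ h => Subtype.ext h)
    (fun _ => by
      ext u
      constructor
      · rintro ⟨u, rfl⟩
        exact u.2
      · exact fun hu => ⟨⟨u, hu⟩, rfl⟩)
    (fun _ _ _ => rfl) (fun χ hχ => ⟨(), hall χ hχ⟩)
  let v' : hM.leviPart F hF := ⟨v, hv⟩
  -- `M` is induced from its sorted part, so the vanishing of `S v` in `M` can be read in the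
  -- induced module.
  have h2 : Ind.tmul (map F q) (signProjector (oneBlock n) q) v' = 0 := by
    have h3 : Φ (DirectSum.lof (Hn n q) Unit (fun _ => Ind (map F q) (hM.leviPart F hF)) ()
        (Ind.tmul (map F q) (signProjector (oneBlock n) q) v')) =
          signProjector (oneBlock n) q • v :=
      hΦ () (Ind.tmul (map F q) (signProjector (oneBlock n) q) v')
    rw [h0] at h3
    have h4 := Φ.injective (h3.trans (map_zero Φ).symm)
    exact DirectSum.of_injective () (h4.trans (map_zero (DirectSum.of _ ())).symm)
  -- The retraction turns `S ⊗ v` into a nonzero multiple of the smaller projector applied to `v`,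
  -- that is, of `v`.
  obtain ⟨r, hr⟩ := Ind.exists_retract (Y := hM.leviPart F hF) (map F q) (retraction F hF q)
    (retraction_mul_map F hF q)
  obtain ⟨z, hz, hz'⟩ := retraction_signProjector F hF q hq hq'
  have h5 := hr (signProjector (oneBlock n) q) v'
  rw [h2, ← Ind.zero_tmul (map F q) v', hr, map_zero, zero_smul, hz', smul_assoc] at h5
  have h6 : signProjector b q • v' = v' := Subtype.ext h1
  rw [h6, eq_comm, smul_eq_zero_iff_right hz] at h5
  exact congrArg Subtype.val h5

end ColorSystem

/-! ### Colours from a point of the torus -/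

namespace ColorSystem

open AffineHecke Polynomial

/-- The `e_k` are the terms of a Bézout identity `∑ u_k ∏_{j ≠ k} Q_j = 1`. The last divisibility
serves to evaluate `e_k` at the roots of `Q_k`. -/
lemma exists_of_coprime {κ : Type} [Fintype κ] {q : ℂ} (Q : κ → ℂ[X])
    (h1 : ∀ k l, k ≠ l → IsCoprime (Q k) (Q l))
    (h2 : ∀ k l, k ≠ l → IsCoprime (Q k) ((Q l).comp (Polynomial.C q * X))) :
    ∃ C : ColorSystem κ q, C.Q = Q ∧ ∀ k l, k ≠ l → Q k ∣ C.e l := by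
  classical
  rcases isEmpty_or_nonempty κ with hκ | hκ
  -- Without colours the product of the `Q_l` is `1`, which divides everything.
  · exact ⟨⟨Q, fun _ => 1, by simp, fun k => hκ.elim k, fun k => hκ.elim k, h2⟩, rfl,
      fun k => hκ.elim k⟩
  obtain ⟨u, hu⟩ := (exists_sum_eq_one_iff_pairwise_coprime (s := Q)
    (t := (Finset.univ : Finset κ)) Finset.univ_nonempty).mpr (fun k l hkl => h1 k l fun h => hkl (Subtype.ext h))
  have hdvd : ∀ k l, k ≠ l → Q k ∣ u l * ∏ j ∈ Finset.univ \ {l}, Q j := fun k l hkl =>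
    (Finset.dvd_prod_of_mem Q (by simpa using hkl)).mul_left _
  refine ⟨⟨Q, fun k => u k * ∏ j ∈ Finset.univ \ {k}, Q j, by rw [hu, sub_self]; exact dvd_zero _,
    fun k => ?_, fun k l hkl => ?_, h2⟩,
    rfl, hdvd⟩
  · rw [mul_left_comm, ← Finset.mul_prod_erase Finset.univ Q (Finset.mem_univ k),
      Finset.sdiff_singleton_eq_erase]
    exact dvd_mul_left _ _
  · rw [← Finset.mul_prod_erase Finset.univ Q (Finset.mem_univ k), ← Finset.sdiff_singleton_eq_erase]
    rw [mul_comm (Q k)]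
    exact mul_dvd_mul (dvd_mul_left _ _) (hdvd k l hkl)

lemma eval_e_of_root {κ : Type} [Fintype κ] {q : ℂ} (C : ColorSystem κ q)
    (h : ∀ k l, k ≠ l → C.Q k ∣ C.e l) {k : κ} {z : ℂ} (hz : (C.Q k).eval z = 0) :
    (C.e k).eval z = 1 := by
  obtain ⟨r, hr⟩ := (Finset.dvd_prod_of_mem C.Q (Finset.mem_univ k)).trans C.dvd_one_sub_sum
  have h1 := congrArg (Polynomial.eval z) hr
  rw [Polynomial.eval_mul, hz, zero_mul, Polynomial.eval_sub, Polynomial.eval_one, sub_eq_zero,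
    Polynomial.eval_finsetSum, Finset.sum_eq_single k] at h1
  · exact h1.symm
  · intro l _ hl
    obtain ⟨r, hr⟩ := h k l hl.symm
    rw [hr, Polynomial.eval_mul, hz, zero_mul]
  · simp

end ColorSystem

/-! ### Consequences of annihilation by powers of central ideals -/

section Central

open AffineHecke

variable {I κ : Type} [Fintype I] [LinearOrder I] [PartialOrder κ]

lemma evalTorus_xvar (t : I → ℂˣ) (a : I) : evalTorus t (xvar a) = t a := by
  rw [evalTorus, xvar, AddMonoidAlgebra.lift_single]
  simp [Finsupp.single_apply, Finset.prod_ite_eq]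

lemma evalTorus_aeval (t : I → ℂˣ) (a : I) (p : Polynomial ℂ) :
    evalTorus t (Polynomial.aeval (xvar a) p) = p.eval (t a : ℂ) := by
  rw [← Polynomial.aeval_algHom_apply, evalTorus_xvar, Polynomial.coe_aeval_eq_eval]

/-- The characteristic polynomial `∏ (X - t_c)` of a point, evaluated at a coordinate function,
lies in the extended central ideal. -/
lemma aeval_prod_mem_map_centralIdeal (b : I →o κ) (t : I → ℂˣ) (a : I) :
    Polynomial.aeval (xvar a) (∏ c, (Polynomial.X - Polynomial.C (t c : ℂ))) ∈
      (centralIdeal b t).map (algebraMap (invariants b) (Laurent I)) := by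
  -- `G` has symmetric coefficients, which take at `t` the values of those of `P`, and `G` has `x_a`
  -- as a root. So `P(x_a) = (P - G)(x_a)`, where `P - G` has coefficients in the central ideal.
  let G : Polynomial (Laurent I) := ∏ c, (Polynomial.X - Polynomial.C (xvar c))
  let P : Polynomial ℂ := ∏ c, (Polynomial.X - Polynomial.C (t c : ℂ))
  let D : Polynomial (Laurent I) := P.map (algebraMap ℂ (Laurent I)) - G
  have hG : G.eval (xvar a) = 0 := by
    rw [Polynomial.eval_prod]
    exact Finset.prod_eq_zero (Finset.mem_univ a) (by simp)
  have hD : Polynomial.aeval (xvar a) P = D.eval (xvar a) := by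
    rw [Polynomial.eval_sub, hG, sub_zero, Polynomial.eval_map_algebraMap]
  have hinv : ∀ (w : Equiv.Perm I) (k : ℕ), Laurent.rename w (D.coeff k) = D.coeff k := by
    intro w k
    have h1 : G.map (Laurent.rename w : Laurent I →+* Laurent I) = G := by
      simp only [G, Polynomial.map_prod, Polynomial.map_sub, Polynomial.map_X, Polynomial.map_C]
      refine Fintype.prod_equiv w _ _ fun c => ?_
      simp [rename_xvar]
    have h2 : Laurent.rename w (G.coeff k) = G.coeff k := by
      conv_rhs => rw [← h1, Polynomial.coeff_map]
      rfl
    rw [Polynomial.coeff_sub, map_sub, h2, Polynomial.coeff_map, AlgHom.commutes]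
  have hval : ∀ k, evalTorus t (D.coeff k) = 0 := by
    intro k
    have h1 : G.map (evalTorus t : Laurent I →+* ℂ) = P := by
      simp only [G, P, Polynomial.map_prod, Polynomial.map_sub, Polynomial.map_X, Polynomial.map_C]
      refine Finset.prod_congr rfl fun c _ => ?_
      simp [evalTorus_xvar]
    have h2 : evalTorus t (G.coeff k) = P.coeff k := by
      conv_rhs => rw [← h1, Polynomial.coeff_map]
      rfl
    rw [Polynomial.coeff_sub, map_sub, h2, Polynomial.coeff_map, AlgHom.commutes]
    exact sub_self _
  change Polynomial.aeval (xvar a) P ∈ _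
  rw [hD, Polynomial.eval_eq_sum_range]
  refine Ideal.sum_mem _ fun k _ => Ideal.mul_mem_right _ _ ?_
  have hk : (⟨D.coeff k, fun w _ => hinv w k⟩ : invariants b) ∈ centralIdeal b t := hval k
  exact Ideal.mem_map_of_mem (algebraMap (invariants b) (Laurent I)) hk

lemma smul_eq_zero_of_mem_map {b : I →o κ} {q : ℂ} {M : Type*} [AddCommGroup M]
    [Module (AffineHecke b q) M] {J : Ideal (invariants b)}
    (hJ : ∀ f ∈ J, ∀ v : M, theta b q (f : Laurent I) • v = 0) {f : Laurent I}
    (hf : f ∈ J.map (algebraMap (invariants b) (Laurent I))) (v : M) : theta b q f • v = 0 := by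
  rw [Ideal.map] at hf
  induction hf using Submodule.span_induction generalizing v with
  | mem f hf => obtain ⟨g, hg, rfl⟩ := hf; exact hJ g hg v
  | zero => rw [map_zero, zero_smul]
  | add f g _ _ hf hg => rw [map_add, add_smul, hf, hg, add_zero]
  | smul g f _ hf => rw [smul_eq_mul, map_mul, mul_smul, hf, smul_zero]

/-- The coordinate functions are annihilated by a power of the characteristic polynomial. -/
lemma AnnihilatedByPower.exists_pow_smul_eq_zero {b : I →o κ} {q : ℂ} {t : I → ℂˣ} {M : Type*}
    [AddCommGroup M] [Module (AffineHecke b q) M] (h : AnnihilatedByPower b q t M) :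
    ∃ N : ℕ, ∀ (a : I) (v : M), theta b q (Polynomial.aeval (xvar a)
      ((∏ c, (Polynomial.X - Polynomial.C (t c : ℂ))) ^ (N + 1))) • v = 0 := by
  obtain ⟨N, hN⟩ := h
  refine ⟨N, fun a v => ?_⟩
  -- The extra factor keeps the exponent positive, so that the `t_c` are roots even if `N = 0`.
  rw [map_pow, pow_succ', map_mul, mul_smul]
  refine (congrArg _ (smul_eq_zero_of_mem_map hN ?_ v)).trans (smul_zero _)
  rw [Ideal.map_pow]
  exact Ideal.pow_mem_pow (aeval_prod_mem_map_centralIdeal b t a) N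

end Central

/-! ### The colours of an induced module -/

section Induction

open AffineHecke ColorSystem

variable {κ : Type} [Fintype κ] [LinearOrder κ] {q : ℂ} {C : ColorSystem κ q} {n : ℕ}
  {M : Type*} [AddCommGroup M] [Module ℂ M] [Module (Hn n q) M] [IsScalarTower ℂ (Hn n q) M]
  [FiniteDimensional ℂ M] {I : Type} [Fintype I] [LinearOrder I] {b : I →o κ}
  {Y : Type*} [AddCommGroup Y] [Module ℂ Y] [Module (AffineHecke b q) Y]
  [IsScalarTower ℂ (AffineHecke b q) Y] [FiniteDimensional ℂ Y]

/-- An induced module with its canonical map from the inducing module. -/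
lemma exists_inclusion (F : BlockEmb b (oneBlock n)) (hF : Function.Surjective F.emb)
    (e : M ≃ₗ[Hn n q] Ind (map F q) Y) :
    ∃ ι : Y →ₗ[ℂ] M, (∀ (y : AffineHecke b q) v, ι (y • v) = map F q y • ι v) ∧
      Function.Injective ι ∧ ∀ x v, e (x • ι v) = Ind.tmul (map F q) x v := by
  have hsmul : ∀ (z : ℂ) (x : Ind (map F q) Y), e.symm (z • x) = z • e.symm x := fun z x => by
    rw [← algebraMap_smul (Hn n q), map_smul, algebraMap_smul]
  refine ⟨⟨⟨fun v => e.symm (Ind.tmul _ 1 v), fun v w => ?_⟩, fun z v => ?_⟩, fun y v => ?_, ?_,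
    fun x v => ?_⟩
  · rw [Ind.tmul_add, map_add]
  · change e.symm (Ind.tmul _ 1 (z • v)) = z • e.symm (Ind.tmul _ 1 v)
    rw [Ind.tmul_smul, hsmul]
  · change e.symm (Ind.tmul _ 1 (y • v)) = map F q y • e.symm (Ind.tmul _ 1 v)
    rw [← Ind.tmul_mul, one_mul, ← map_smul, Ind.smul_tmul, mul_one]
  · intro v w h
    have h1 : Ind.tmul (map F q) 1 v = Ind.tmul (map F q) 1 w := e.symm.injective h
    -- The retraction fixes `1` and therefore recovers `v` from `1 ⊗ v`.
    obtain ⟨r, hr⟩ := Ind.exists_retract (Y := Y) (map F q) (retraction F hF q)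
      (retraction_mul_map F hF q)
    have h2 : retraction F hF q 1 = 1 := by
      have := retraction_map F hF q 1
      rwa [map_one] at this
    have h3 := congrArg r h1
    rwa [hr, hr, h2, one_smul, one_smul] at h3
  · change e (x • e.symm (Ind.tmul _ 1 v)) = _
    rw [map_smul, e.apply_symm_apply, Ind.smul_tmul, mul_one]

/-- The colours of an induced module. -/
lemma exists_sorted_inclusion (F : BlockEmb b (oneBlock n)) (hF : Function.Surjective F.emb)
    (e : M ≃ₗ[Hn n q] Ind (map F q) Y) (hM : C.Colored (oneBlock n) M) {t : I → ℂˣ}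
    (hY : AnnihilatedByPower b q t Y) (ht : ∀ x, (C.e (b x)).eval (t x : ℂ) = 1) :
    ∃ ι : Y →ₗ[ℂ] M, (∀ (y : AffineHecke b q) v, ι (y • v) = map F q y • ι v) ∧
      Function.Injective ι ∧
      LinearMap.range ι = C.colorSpace (oneBlock n) M (F.coloring hF) ∧
      ∀ χ, C.colorSpace (oneBlock n) M χ ≠ ⊥ → χ ∈ orbit (F.coloring hF) := by
  have hd : ∀ x y, oneBlock n x = oneBlock n y := fun _ _ => rfl
  obtain ⟨ι, h1, h2, h3⟩ := exists_inclusion F hF e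
  have hid : Laurent.rename F.emb (C.idem b) = C.idem (F.coloring hF) := by
    rw [idem, idem, map_prod]
    refine Fintype.prod_bijective F.emb ⟨F.emb.injective, hF⟩ _ _ fun x => ?_
    rw [rename_aeval, F.coloring_apply]
  -- `1 - idem b` is invariant under the block-preserving permutations and vanishes at `t`, so its
  -- `N`-th power kills `Y`. On `M` its image acts as an idempotent, so it already kills `ι v`
  -- without the power.
  have hmem : ∀ v, ι v ∈ C.colorSpace (oneBlock n) M (F.coloring hF) := by
    intro v
    obtain ⟨N, hN⟩ := hY
    let g : invariants b := 1 - ⟨C.idem b, fun w hw => by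
      rw [rename_idem]
      congr 1
      exact funext fun x => ((inv_mem hw : w⁻¹ ∈ youngSubgroup b) x)⟩
    have hg : g ∈ centralIdeal b t := by
      have h4 : evalTorus t (C.idem b) = 1 := by
        rw [idem, map_prod]
        exact Finset.prod_eq_one fun x _ => by rw [evalTorus_aeval, ht]
      change evalTorus t (1 - C.idem b) = 0
      rw [map_sub, map_one, h4, sub_self]
    have h5 := congrArg ι (hN _ (Ideal.pow_mem_pow hg N) v)
    rw [map_zero, h1, map_theta] at h5
    have h6 : Laurent.rename F.emb ((g ^ N : invariants b) : Laurent I) =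
        (1 - C.idem (F.coloring hF)) ^ N := by
      rw [SubmonoidClass.coe_pow, map_pow]
      change Laurent.rename F.emb (1 - C.idem b) ^ N = _
      rw [map_sub, map_one, hid]
    rw [h6] at h5
    have h7 : ∀ k : ℕ, ∀ u : M, theta (oneBlock n) q ((1 - C.idem (F.coloring hF)) ^ (k + 1)) • u =
        theta (oneBlock n) q (1 - C.idem (F.coloring hF)) • u := by
      intro k
      induction k with
      | zero => intro u; rw [zero_add, pow_one]
      | succ k ih =>
        intro u
        have h8 := hM.idem_smul_mem (F.coloring hF) u
        rw [mem_colorSpace] at h8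
        rw [pow_succ, map_mul, mul_smul, ih, map_sub, map_one, sub_smul, sub_smul, one_smul,
          one_smul, smul_sub, h8, sub_self, sub_zero]
    have h8 := h7 N (ι v)
    rw [pow_succ', map_mul, mul_smul, h5, smul_zero, map_sub, map_one, sub_smul, one_smul] at h8
    exact (sub_eq_zero.mp h8.symm).symm
  -- `M` is spanned by vectors `T_w θ_f (ι v)`, and `T_w` produces only colours in the orbit of the
  -- colour of `ι v`.
  have hall : ∀ χ, C.colorSpace (oneBlock n) M χ ≠ ⊥ → χ ∈ orbit (F.coloring hF) := by
    intro χ hχ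
    by_contra hne
    refine hχ ((Submodule.eq_bot_iff _).mpr fun u hu => ?_)
    rw [← C.idem_smul_of_mem hu]
    suffices h : ∀ z : Ind (map F q) Y, theta (oneBlock n) q (C.idem χ) • e.symm z = 0 by
      simpa using h (e u)
    intro z
    induction z using Ind.induction with
    | base x v =>
      rw [← h3, e.symm_apply_apply]
      induction x using T_theta_induction with
      | base w f =>
        rw [mul_smul]
        by_contra h0
        obtain ⟨w', _, hw'⟩ := hM.exists_of_idem_smul_T_ne_zero hd w
          (C.theta_smul_mem f (hmem v)) h0
        exact hne (mem_orbit.mpr ⟨_, hw'⟩)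
      | zero => rw [zero_smul, smul_zero]
      | add x y hx hy => rw [add_smul, smul_add, hx, hy, add_zero]
    | zero => rw [map_zero, smul_zero]
    | add x y hx hy => rw [map_add, smul_add, hx, hy, add_zero]
  refine ⟨ι, h1, h2, ?_, hall⟩
  -- `dim M` is at least the orbit size times the dimension of the sorted part, and at most the
  -- orbit size times `dim Y`; the orbit size cancels.
  refine Submodule.eq_of_le_of_finrank_le ?_ ?_
  · rintro _ ⟨v, rfl⟩
    exact hmem v
  · rw [LinearMap.finrank_range_of_inj h2]
    have h4 := hM.card_orbit_mul_finrank_le hd (F.coloring hF)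
    have h5 := finrank_ind_le F hF hd q Y
    have h6 : Module.finrank ℂ M = Module.finrank ℂ (Ind (map F q) Y) :=
      LinearEquiv.finrank_eq (e.restrictScalars ℂ)
    have h7 : 0 < (orbit (F.coloring hF)).card := Finset.card_pos.mpr ⟨_, mem_orbit.mpr ⟨1, rfl⟩⟩
    exact Nat.le_of_mul_le_mul_left (h4.trans (h6.le.trans h5)) h7

end Induction

/-! ### Colours and a partition of the coordinates in two parts -/

section Count

variable {J J' K κ : Type} [Fintype J] [Fintype J'] [Fintype K]

/-- The number of coordinates of a given colour. -/
def colorCount (φ : J → κ) (k : κ) : ℕ := Nat.card {x // φ x = k}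

lemma colorCount_comp (φ : J → κ) (e : J' ≃ J) (k : κ) :
    colorCount (φ ∘ e) k = colorCount φ k :=
  Nat.card_congr (e.subtypeEquiv fun _ => Iff.rfl)

lemma colorCount_of_mem_orbit [LinearOrder J] [LinearOrder κ] {φ χ : J → κ} (h : χ ∈ orbit φ) (k : κ) :
    colorCount χ k = colorCount φ k := by
  obtain ⟨w, rfl⟩ := mem_orbit.mp h
  exact colorCount_comp φ w k

lemma mem_orbit_of_colorCount_eq [LinearOrder J] [LinearOrder κ] {φ χ : J → κ} (h : ∀ k, colorCount χ k = colorCount φ k) :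
    χ ∈ orbit φ := by
  have e : ∀ k, Nonempty ({x // χ x = k} ≃ {x // φ x = k}) := fun k =>
    ⟨(Finite.equivFinOfCardEq (h k)).trans (Finite.equivFin _).symm⟩
  refine mem_orbit.mpr ⟨(Equiv.sigmaFiberEquiv χ).symm.trans
    ((Equiv.sigmaCongrRight fun k => (e k).some).trans (Equiv.sigmaFiberEquiv φ)), funext fun x => ?_⟩
  exact ((e (χ x)).some ⟨x, rfl⟩).2

lemma colorCount_sum (φ : J ⊕ K → κ) (k : κ) :
    colorCount φ k = colorCount (φ ∘ Sum.inl) k + colorCount (φ ∘ Sum.inr) k := by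
  rw [colorCount, colorCount, colorCount, ← Nat.card_sum]
  exact Nat.card_congr (Equiv.subtypeSum)

lemma sum_colorCount [Fintype κ] (φ : J → κ) : ∑ k, colorCount φ k = Fintype.card J := by
  rw [← Nat.card_eq_fintype_card, ← Nat.card_congr (Equiv.sigmaFiberEquiv φ), Nat.card_sigma]
  rfl

end Count

namespace ColorSystem

open AffineHecke

section Parts

variable {κ : Type} [Fintype κ] {q : ℂ} (C : ColorSystem κ q)
  {I K J μ ν ρ : Type} [Fintype I] [LinearOrder I] [Fintype K] [LinearOrder K] [Fintype J]
  [LinearOrder J] [PartialOrder μ] [PartialOrder ν] [PartialOrder ρ]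
  {b : I →o μ} {b' : K →o ν} {d : J →o ρ}
  {M : Type*} [AddCommGroup M] [Module ℂ M] [Module (AffineHecke d q) M]
  [IsScalarTower ℂ (AffineHecke d q) M]

lemma idem_eq_mul (e : I ⊕ K ≃ J) (φ : J → κ) : C.idem φ =
    Laurent.rename (e ∘ Sum.inl) (C.idem (φ ∘ e ∘ Sum.inl)) *
      Laurent.rename (e ∘ Sum.inr) (C.idem (φ ∘ e ∘ Sum.inr)) := by
  rw [idem, idem, idem, ← e.prod_comp, Fintype.prod_sum_type, map_prod, map_prod]
  congr 1
  · exact Finset.prod_congr rfl fun x _ => (rename_aeval (e ∘ Sum.inl) x (C.e (φ (e (Sum.inl x))))).symm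
  · exact Finset.prod_congr rfl fun x _ => (rename_aeval (e ∘ Sum.inr) x (C.e (φ (e (Sum.inr x))))).symm

variable {C}

lemma Colored.res (hM : C.Colored d M) (F : BlockEmb b d) : C.Colored b (Res (map F q) M) := by
  intro a v
  have h : ∀ u : M, map F q (theta b q (Polynomial.aeval (xvar a) (∏ l, C.Q l))) • u = 0 := by
    intro u
    rw [map_theta, rename_aeval]
    exact hM (F.emb a) u
  exact h v

lemma Colored.submodule (hM : C.Colored d M) (S : Submodule (AffineHecke d q) M) : C.Colored d S :=
  fun a v => Subtype.ext (hM a v)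

/-- The colours with respect to the two parts of the coordinates. -/
lemma Colored.mem_colorSpace_iff (hM : C.Colored d M) (F : BlockEmb b d) (G : BlockEmb b' d)
    (e : I ⊕ K ≃ J) (hF : ∀ x, e (Sum.inl x) = F.emb x) (hG : ∀ x, e (Sum.inr x) = G.emb x)
    {ψ : I → κ} {χ : K → κ} {v : M} :
    v ∈ C.colorSpace d M (Sum.elim ψ χ ∘ e.symm) ↔
      map F q (theta b q (C.idem ψ)) • v = v ∧ map G q (theta b' q (C.idem χ)) • v = v := by
  have h1 : theta d q (C.idem (Sum.elim ψ χ ∘ e.symm)) =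
      map F q (theta b q (C.idem ψ)) * map G q (theta b' q (C.idem χ)) := by
    have h2 : e ∘ Sum.inl = F.emb := funext hF
    have h3 : e ∘ Sum.inr = G.emb := funext hG
    have h4 : (Sum.elim ψ χ ∘ e.symm) ∘ e ∘ Sum.inl = ψ := by funext x; simp
    have h5 : (Sum.elim ψ χ ∘ e.symm) ∘ e ∘ Sum.inr = χ := by funext x; simp
    rw [idem_eq_mul C e, h4, h5, map_mul, map_theta, map_theta, h2, h3]
  have hp : ∀ u : M, map F q (theta b q (C.idem ψ)) • map F q (theta b q (C.idem ψ)) • u =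
      map F q (theta b q (C.idem ψ)) • u := (hM.res F).idem_smul_mem ψ
  have hp' : ∀ u : M, map G q (theta b' q (C.idem χ)) • map G q (theta b' q (C.idem χ)) • u =
      map G q (theta b' q (C.idem χ)) • u := (hM.res G).idem_smul_mem χ
  have hc : ∀ u : M, map F q (theta b q (C.idem ψ)) • map G q (theta b' q (C.idem χ)) • u =
      map G q (theta b' q (C.idem χ)) • map F q (theta b q (C.idem ψ)) • u := fun u => by
    rw [map_theta, map_theta, theta_smul_comm]
  rw [mem_colorSpace, h1, mul_smul]
  constructor
  · intro h
    refine ⟨?_, ?_⟩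
    · rw [← h, hp]
    · rw [← h, hc, hp']
  · rintro ⟨h2, h3⟩
    rw [h3, h2]

end Parts

/-! ### The sign part for the last coordinates when the colours of the first ones are fixed. -/

section Sign

variable {κ : Type} [Fintype κ] [LinearOrder κ] {q : ℂ} {C : ColorSystem κ q} {n p s : ℕ}
  {M : Type*} [AddCommGroup M] [Module ℂ M] [Module (Hn n q) M] [IsScalarTower ℂ (Hn n q) M]
  [FiniteDimensional ℂ M] {K : Type} [Fintype K] [LinearOrder K]
  {b₂ : K →o κ}

/-- The part of a module with a given colour of the first coordinates, as a module over the algebra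
of the last coordinates. -/
def part (C : ColorSystem κ q) (M : Type*) [AddCommGroup M] [Module (Hn n q) M]
    (A : BlockEmb (oneBlock p) (oneBlock n)) (B : BlockEmb (oneBlock s) (oneBlock n))
    (hAB : ∀ x y, A.emb x ≠ B.emb y) (ψ : Fin p → κ) :
    Submodule (Hn s q) (Res (map B q) M) :=
  LinearMap.eqLocus (actionOf (map B q) (map A q (theta _ q (C.idem ψ)))
    (fun y => commute_map_map A B hAB q _ y) M) LinearMap.id

/-- The inclusion of a part. -/
def partSubtype (A : BlockEmb (oneBlock p) (oneBlock n)) (B : BlockEmb (oneBlock s) (oneBlock n))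
    (hAB : ∀ x y, A.emb x ≠ B.emb y) (ψ : Fin p → κ) : C.part M A B hAB ψ →ₗ[ℂ] M where
  toFun v := show M from v.1
  map_add' _ _ := rfl
  map_smul' _ _ := rfl

lemma partSubtype_injective (A : BlockEmb (oneBlock p) (oneBlock n))
    (B : BlockEmb (oneBlock s) (oneBlock n)) (hAB : ∀ x y, A.emb x ≠ B.emb y) (ψ : Fin p → κ) :
    Function.Injective (C.partSubtype (M := M) A B hAB ψ) := Subtype.val_injective

variable (A : BlockEmb (oneBlock p) (oneBlock n)) (B : BlockEmb (oneBlock s) (oneBlock n))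
  (e : Fin p ⊕ Fin s ≃ Fin n) (hA : ∀ x, e (Sum.inl x) = A.emb x)
  (hB : ∀ x, e (Sum.inr x) = B.emb x)

include hA hB

lemma disjoint_of_equiv (x : Fin p) (y : Fin s) : A.emb x ≠ B.emb y := by
  rw [← hA, ← hB]
  exact fun h => Sum.inl_ne_inr (e.injective h)

lemma Colored.mem_colorSpace_part (hM : C.Colored (oneBlock n) M) {ψ : Fin p → κ} {χ : Fin s → κ}
    (v : C.part M A B (disjoint_of_equiv A B e hA hB) ψ) :
    v ∈ C.colorSpace (oneBlock s) (C.part M A B (disjoint_of_equiv A B e hA hB) ψ) χ ↔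
      C.partSubtype A B _ ψ v ∈ C.colorSpace (oneBlock n) M (Sum.elim ψ χ ∘ e.symm) := by
  rw [hM.mem_colorSpace_iff A B e hA hB]
  exact ⟨fun h => ⟨v.2, congrArg Subtype.val h⟩, fun h => Subtype.ext h.2⟩

lemma Colored.ne_bot_of_part (hM : C.Colored (oneBlock n) M) {ψ : Fin p → κ} {χ : Fin s → κ}
    (h : C.colorSpace (oneBlock s) (C.part M A B (disjoint_of_equiv A B e hA hB) ψ) χ ≠ ⊥) :
    C.colorSpace (oneBlock n) M (Sum.elim ψ χ ∘ e.symm) ≠ ⊥ := by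
  obtain ⟨v, hv, h0⟩ := Submodule.exists_mem_ne_zero_of_ne_bot h
  exact (Submodule.ne_bot_iff _).mpr
    ⟨_, (hM.mem_colorSpace_part A B e hA hB v).mp hv, fun h => h0 (Subtype.ext h)⟩

lemma Colored.finite_part (ψ : Fin p → κ) :
    FiniteDimensional ℂ (C.part M A B (disjoint_of_equiv A B e hA hB) ψ) :=
  Module.Finite.of_injective _ (partSubtype_injective A B _ ψ)

/-- The algebras of the first and of the last coordinates commute, so fixing the colour `ψ` leaves a
module over the second one, to which `Colored.exists_sign_smul_eq` applies. The condition `hall`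
leaves one sorted colouring of the last coordinates. -/
lemma Colored.exists_sign_smul_eq_part (hq : q ≠ 0)
    (hb : (∑ w : youngSubgroup b₂, (1 / q) ^ length (w : Equiv.Perm K)) ≠ 0)
    (hM : C.Colored (oneBlock n) M) (G : BlockEmb b₂ (oneBlock s)) (hG : Function.Surjective G.emb)
    {ψ : Fin p → κ} (hall : ∀ χ : Fin s →o κ,
      C.colorSpace (oneBlock n) M (Sum.elim ψ χ ∘ e.symm) ≠ ⊥ → G.coloring hG = χ) (x : M)
    (hx : map A q (theta _ q (C.idem ψ)) • x = x) :
    ∃ v ∈ C.colorSpace (oneBlock n) M (Sum.elim ψ (G.coloring hG) ∘ e.symm),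
      map (B.comp G) q (signProjector b₂ q) • v = v ∧
      map B q (signProjector (oneBlock s) q) • v = map B q (signProjector (oneBlock s) q) • x := by
  have := Colored.finite_part (C := C) (M := M) A B e hA hB ψ
  obtain ⟨v, hv, h1, h2⟩ := ((hM.res B).submodule (C.part M A B
    (disjoint_of_equiv A B e hA hB) ψ)).exists_sign_smul_eq hq hb
    G hG (fun χ hχ => hall χ (hM.ne_bot_of_part A B e hA hB hχ)) ⟨x, hx⟩
  refine ⟨C.partSubtype A B _ ψ v, (hM.mem_colorSpace_part A B e hA hB v).mp hv, ?_, congrArg Subtype.val h2⟩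
  rw [← map_comp]
  exact congrArg Subtype.val h1

lemma Colored.eq_zero_of_sign_smul_part (hq : ∀ c : K →o κ,
    (∑ w : youngSubgroup c, (1 / q) ^ length (w : Equiv.Perm K)) ≠ 0)
    (hq' : (∑ w : youngSubgroup (oneBlock s), (1 / q) ^ length (w : Equiv.Perm (Fin s))) ≠ 0)
    (hM : C.Colored (oneBlock n) M) (G : BlockEmb b₂ (oneBlock s)) (hG : Function.Surjective G.emb)
    {ψ : Fin p → κ} (hall : ∀ χ : Fin s →o κ,
      C.colorSpace (oneBlock n) M (Sum.elim ψ χ ∘ e.symm) ≠ ⊥ → G.coloring hG = χ) {v : M}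
    (hv : v ∈ C.colorSpace (oneBlock n) M (Sum.elim ψ (G.coloring hG) ∘ e.symm))
    (h1 : map (B.comp G) q (signProjector b₂ q) • v = v)
    (h0 : map B q (signProjector (oneBlock s) q) • v = 0) : v = 0 := by
  have := Colored.finite_part (C := C) (M := M) A B e hA hB ψ
  have hx := ((hM.mem_colorSpace_iff A B e hA hB).mp hv).1
  rw [← map_comp] at h1
  exact congrArg Subtype.val (((hM.res B).submodule
    (C.part M A B (disjoint_of_equiv A B e hA hB) ψ)).eq_zero_of_sign_smul hq hq' G hG
    (fun χ hχ => hall χ (hM.ne_bot_of_part A B e hA hB hχ)) (v := ⟨v, hx⟩)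
    ((hM.mem_colorSpace_part A B e hA hB _).mpr hv) (Subtype.ext h1) (Subtype.ext h0))

end Sign

end ColorSystem

/-! ### The sign part for the last coordinates, with prescribed colour of the first coordinates -/

lemma oneBlock_eq (n : ℕ) (x y : Fin n) : oneBlock n x = oneBlock n y := rfl

namespace ColorSystem

open AffineHecke

variable {κ : Type} [Fintype κ] [LinearOrder κ] {q : ℂ} {C : ColorSystem κ q} {n p s : ℕ}
  {M : Type*} [AddCommGroup M] [Module ℂ M] [Module (Hn n q) M] [IsScalarTower ℂ (Hn n q) M]
  [FiniteDimensional ℂ M] {I I₁ I₂ : Type} [Fintype I] [LinearOrder I] [Fintype I₁]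
  [LinearOrder I₁] [Fintype I₂] [LinearOrder I₂] {b : I →o κ} {b₁ : I₁ →o κ} {b₂ : I₂ →o κ}
  {Y : Type*} [AddCommGroup Y] [Module ℂ Y] [Module (AffineHecke b q) Y]
  {A : BlockEmb (oneBlock p) (oneBlock n)} {B : BlockEmb (oneBlock s) (oneBlock n)}
  {e : Fin p ⊕ Fin s ≃ Fin n} (hA : ∀ x, e (Sum.inl x) = A.emb x)
  (hB : ∀ x, e (Sum.inr x) = B.emb x) {L : BlockEmb b (oneBlock n)}
  (hL : Function.Surjective L.emb) {a₁ : BlockEmb b₁ b} {a₂ : BlockEmb b₂ b}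
  (hb₁ : ∀ x, b (a₁.emb x) = b₁ x) (hb₂ : ∀ x, b (a₂.emb x) = b₂ x)
  {L₁ : BlockEmb b₁ (oneBlock p)} (hL₁ : Function.Surjective L₁.emb)
  {L₂ : BlockEmb b₂ (oneBlock s)} (hL₂ : Function.Surjective L₂.emb)
  {w : Equiv.Perm (Fin n)} (hw : w ∈ increasing (L.coloring hL))
  (hw₁ : ∀ x, w (L.emb (a₁.emb x)) = A.emb (L₁.emb x))
  (hw₂ : ∀ x, w (L.emb (a₂.emb x)) = B.emb (L₂.emb x))

include hA hB hb₁ hb₂ hw₁ hw₂ in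
lemma coloring_comp_symm : L.coloring hL ∘ w.symm =
    Sum.elim (L₁.coloring hL₁) (L₂.coloring hL₂) ∘ e.symm := by
  funext z
  obtain ⟨z, rfl⟩ := e.surjective z
  rw [Function.comp_apply, Function.comp_apply, e.symm_apply_apply]
  rcases z with x | x
  · obtain ⟨x, rfl⟩ := hL₁ x
    rw [hA, ← hw₁, w.symm_apply_apply, L.coloring_apply, hb₁, Sum.elim_inl, L₁.coloring_apply]
  · obtain ⟨x, rfl⟩ := hL₂ x
    rw [hB, ← hw₂, w.symm_apply_apply, L.coloring_apply, hb₂, Sum.elim_inr, L₂.coloring_apply]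

variable (C) in
/-- The map from the inducing module to the sign part for the last coordinates. -/
def signIntertwiner (B : BlockEmb (oneBlock s) (oneBlock n)) (φ : Fin n → κ)
    (w : Equiv.Perm (Fin n)) (ι : Y →ₗ[ℂ] M) : Y →ₗ[ℂ] M :=
  (Algebra.lsmul ℂ ℂ M (map B q (signProjector (oneBlock s) q) *
    C.intertwiner (oneBlock_eq n) φ w)) ∘ₗ ι

lemma signIntertwiner_apply (φ : Fin n → κ) (ι : Y →ₗ[ℂ] M) (v : Y) :
    C.signIntertwiner B φ w ι v = map B q (signProjector (oneBlock s) q) •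
      C.intertwiner (oneBlock_eq n) φ w • ι v := mul_smul _ _ (ι v)

section

variable (hM : C.Colored (oneBlock n) M) {ι : Y →ₗ[ℂ] M}
  (hι : ∀ (y : AffineHecke b q) v, ι (y • v) = map L q y • ι v) (hinj : Function.Injective ι)
  (hrange : LinearMap.range ι = C.colorSpace (oneBlock n) M (L.coloring hL))

include hrange in
lemma apply_mem_colorSpace (v : Y) : ι v ∈ C.colorSpace (oneBlock n) M (L.coloring hL) :=
  hrange ▸ ⟨v, rfl⟩

include hM hι hrange hb₁ hw hw₁ hA hB in
-- The intertwiner carries the action of the first coordinates of the blocks to that of the first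
-- coordinates in `Fin n`, and the sign projector of the last coordinates commutes with the latter.
lemma Colored.signIntertwiner_smul (y : AffineHecke b₁ q) (v : Y) :
    C.signIntertwiner B (L.coloring hL) w ι (map a₁ q y • v) =
      map A q (map L₁ q y) • C.signIntertwiner B (L.coloring hL) w ι v := by
  rw [signIntertwiner_apply, signIntertwiner_apply, hι, map_comp, map_comp,
    (hM.intertwiner_smul_map (oneBlock_eq n) (isShortest_of_increasing _ hw) (L.comp a₁)
      (A.comp L₁) hw₁ (fun x x' h => by
        change L.coloring hL (L.emb (a₁.emb x)) = L.coloring hL (L.emb (a₁.emb x'))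
        rw [L.coloring_apply, L.coloring_apply, hb₁, hb₁, h]) y _
      (apply_mem_colorSpace hL hrange v)).2, ← map_comp, smul_smul, smul_smul (map A q _),
    (commute_map_map A B (disjoint_of_equiv A B e hA hB) q _ _).eq]

include hM hι hrange hb₂ hw hw₂ in
lemma Colored.intertwiner_smul_last (y : AffineHecke b₂ q) (v : Y) :
    C.intertwiner (oneBlock_eq n) (L.coloring hL) w • ι (map a₂ q y • v) =
      map (B.comp L₂) q y • C.intertwiner (oneBlock_eq n) (L.coloring hL) w • ι v := by
  rw [hι, map_comp,
    (hM.intertwiner_smul_map (oneBlock_eq n) (isShortest_of_increasing _ hw) (L.comp a₂)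
      (B.comp L₂) hw₂ (fun x x' h => by
        change L.coloring hL (L.emb (a₂.emb x)) = L.coloring hL (L.emb (a₂.emb x'))
        rw [L.coloring_apply, L.coloring_apply, hb₂, hb₂, h]) y _
      (apply_mem_colorSpace hL hrange v)).2]

include hM hA hB hb₁ hb₂ hw₁ hw₂ in
lemma Colored.intertwiner_smul_mem_parts (v : M) :
    C.intertwiner (oneBlock_eq n) (L.coloring hL) w • v ∈
      C.colorSpace (oneBlock n) M (Sum.elim (L₁.coloring hL₁) (L₂.coloring hL₂) ∘ e.symm) := by
  rw [← coloring_comp_symm hA hB hL hb₁ hb₂ hL₁ hL₂ hw₁ hw₂]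
  exact hM.intertwiner_smul_mem _ _ _ _

variable (hq : ∀ c : I₂ →o κ, (∑ w : youngSubgroup c, (1 / q) ^ length (w : Equiv.Perm I₂)) ≠ 0)
  (hq' : (∑ w : youngSubgroup (oneBlock s), (1 / q) ^ length (w : Equiv.Perm (Fin s))) ≠ 0)
  (hq0 : q ≠ 0) (hall : ∀ χ : Fin s →o κ, C.colorSpace (oneBlock n) M
    (Sum.elim (L₁.coloring hL₁) χ ∘ e.symm) ≠ ⊥ → L₂.coloring hL₂ = χ)

include hM hι hinj hrange hA hB hb₁ hb₂ hw hw₁ hw₂ hq hq' hall in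
-- The map is a composite of injections: `ι`, the intertwiner of a shortest permutation, and the
-- large sign projector on vectors that the small one fixes.
lemma Colored.signIntertwiner_eq_zero {v : Y}
    (hv : map a₂ q (signProjector b₂ q) • v = v)
    (h0 : C.signIntertwiner B (L.coloring hL) w ι v = 0) : v = 0 := by
  rw [signIntertwiner_apply] at h0
  have h1 := hM.eq_zero_of_sign_smul_part A B e hA hB hq hq' L₂ hL₂ hall
    (hM.intertwiner_smul_mem_parts hA hB hL hb₁ hb₂ hL₁ hL₂ hw₁ hw₂ _)
    (by rw [← hM.intertwiner_smul_last hL hb₂ hw hw₂ hι hrange, hv]) h0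
  have h2 := (hM.intertwiner_bijective _ (isShortest_of_increasing _ hw)).2 _
    (apply_mem_colorSpace hL hrange v) h1
  exact hinj (h2.trans (map_zero ι).symm)

include hM hA hB hb₁ hb₂ hL₂ hw₁ hw₂ in
lemma Colored.theta_smul_signIntertwiner (v : Y) :
    map A q (theta _ q (C.idem (L₁.coloring hL₁))) •
      C.signIntertwiner B (L.coloring hL) w ι v = C.signIntertwiner B (L.coloring hL) w ι v := by
  rw [signIntertwiner_apply, smul_smul,
    (commute_map_map A B (disjoint_of_equiv A B e hA hB) q _ _).eq, mul_smul,
    ((hM.mem_colorSpace_iff A B e hA hB).mp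
      (hM.intertwiner_smul_mem_parts hA hB hL hb₁ hb₂ hL₁ hL₂ hw₁ hw₂ _)).1]

include hM hι hinj hrange hA hB hb₁ hb₂ hw hw₁ hw₂ hq hq' hall hq0 in
lemma Colored.exists_signIntertwiner_eq {z : M}
    (hz : map A q (theta _ q (C.idem (L₁.coloring hL₁))) • z = z)
    (hz' : map B q (signProjector (oneBlock s) q) • z = z) :
    ∃ v, map a₂ q (signProjector b₂ q) • v = v ∧
      C.signIntertwiner B (L.coloring hL) w ι v = z := by
  obtain ⟨u, hu, h1, h2⟩ := hM.exists_sign_smul_eq_part A B e hA hB hq0 (hq b₂) L₂ hL₂ hall z hz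
  rw [hz'] at h2
  have hbij := hM.intertwiner_bijective (oneBlock_eq n) (isShortest_of_increasing _ hw)
  rw [← coloring_comp_symm hA hB hL hb₁ hb₂ hL₁ hL₂ hw₁ hw₂] at hu
  obtain ⟨v, hv, rfl⟩ := hbij.1 u hu
  rw [← hrange] at hv
  obtain ⟨v, rfl⟩ := hv
  refine ⟨v, ?_, by rw [signIntertwiner_apply, h2]⟩
  -- The small projector fixes `v` because it fixes its image under the intertwiner, which is
  -- injective on the sorted part.
  refine hinj (sub_eq_zero.mp (hbij.2 _ (sub_mem (apply_mem_colorSpace hL hrange _)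
    (apply_mem_colorSpace hL hrange v)) ?_))
  rw [smul_sub, hM.intertwiner_smul_last hL hb₂ hw hw₂ hι hrange, h1, sub_self]

end

end ColorSystem

/-! ### Colours from the polar decomposition. -/

section Torus

open Polynomial

/-- The colours of the coordinates of a point of the torus that are given by the unitary parts. -/
lemma exists_colorSystem {q : ℝ} (hq : 1 < q) {κ J : Type} [Fintype κ] [Fintype J] (t : J → ℂˣ)
    (φ : J → κ) (ht : ∀ x y, unitaryPart (t x) = unitaryPart (t y) → φ x = φ y) (N : ℕ) :
    ∃ C : ColorSystem κ q, (∏ k, C.Q k) = (∏ x, (X - Polynomial.C (t x : ℂ))) ^ (N + 1) ∧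
      ∀ x, (C.e (φ x)).eval (t x : ℂ) = 1 := by
  classical
  let Q : κ → ℂ[X] := fun k =>
    (∏ x ∈ Finset.univ.filter (fun x => φ x = k), (X - Polynomial.C (t x : ℂ))) ^ (N + 1)
  have hQ : ∀ k (z : ℂ), (∀ y, φ y = k → z ≠ t y) → (Q k).eval z ≠ 0 := by
    intro k z h
    rw [eval_pow, eval_prod]
    refine pow_ne_zero _ (Finset.prod_ne_zero_iff.mpr fun y hy => ?_)
    rw [eval_sub, eval_X, eval_C, sub_ne_zero]
    exact h y (by simpa using hy)
  have hcop : ∀ k (p : ℂ[X]), (∀ x, φ x = k → p.eval (t x : ℂ) ≠ 0) → IsCoprime (Q k) p := by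
    intro k p h
    refine IsCoprime.pow_left (IsCoprime.prod_left fun x hx => ?_)
    rw [(irreducible_X_sub_C _).coprime_iff_not_dvd, dvd_iff_isRoot]
    exact h x (by simpa using hx)
  obtain ⟨C, hC, hdvd⟩ := ColorSystem.exists_of_coprime (q := (q : ℂ)) Q
    (fun k l hkl => hcop k _ fun x hx => hQ l _ fun y hy h => hkl (by
      rw [← hx, ← hy]
      exact ht x y (by rw [unitaryPart, unitaryPart, h])))
    (fun k l hkl => hcop k _ fun x hx => by
      rw [eval_comp]
      refine hQ l _ fun y hy h => hkl ?_
      rw [← hx, ← hy]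
      -- Multiplication by `q > 0` does not change the unitary part, so `t_y = q t_x` would give
      -- both points the same colour.
      refine ht x y ?_
      have hq0 : (q : ℂ) ≠ 0 := by exact_mod_cast (by linarith : q ≠ 0)
      rw [eval_mul, eval_C, eval_X] at h
      rw [unitaryPart, unitaryPart, ← h, norm_mul, Complex.norm_real, Real.norm_of_nonneg (by linarith),
        Complex.ofReal_mul, mul_div_mul_left _ _ hq0])
  refine ⟨C, ?_, fun x => C.eval_e_of_root (by rwa [hC]) ?_⟩
  · rw [hC, Finset.prod_pow]
    exact congrArg (· ^ (N + 1)) (Finset.prod_fiberwise _ φ _)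
  · rw [hC, eval_pow, eval_prod, Finset.prod_eq_zero (i := x) (by simp) (by simp),
      zero_pow (Nat.succ_ne_zero N)]

end Torus

/-! ### Separating the first and the last coordinates of all blocks -/

lemma BlockEmb.colorCount_coloring {I J κ μ : Type} [Fintype I] [LinearOrder I] [Fintype J]
    [LinearOrder J] [LinearOrder κ] [PartialOrder μ] {b : I →o κ} {d : J →o μ} (F : BlockEmb b d)
    (hF : Function.Surjective F.emb) (k : κ) : colorCount (F.coloring hF) k = colorCount b k := by
  rw [← colorCount_comp (F.coloring hF) (Equiv.ofBijective F.emb ⟨F.emb.injective, hF⟩)]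
  exact congrFun (congrArg _ (funext fun x => F.coloring_apply hF x)) k

lemma colorCount_block {m : ℕ} (c : Fin m → ℕ) (k : Fin m) : colorCount (block c) k = c k := by
  have e : {x : Coord c // block c x = k} ≃ Fin (c k) :=
    (ofLex.subtypeEquiv fun _ => Iff.rfl).trans (Equiv.sigmaSubtype k)
  rw [colorCount, Nat.card_congr e, Nat.card_eq_fintype_card, Fintype.card_fin]

lemma leviEmb_surjective {m n : ℕ} (c : Fin m → ℕ) (h : ∑ k, c k = n) :
    Function.Surjective (leviEmb c h).emb := (numbering c h).surjective

lemma colorCount_levi {m n : ℕ} (c : Fin m → ℕ) (h : ∑ k, c k = n) (k : Fin m) :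
    colorCount ((leviEmb c h).coloring (leviEmb_surjective c h)) k = c k :=
  ((leviEmb c h).colorCount_coloring _ k).trans (colorCount_block c k)

/-- The numbers of coordinates of each colour determine the orbit of a colouring, and an orbit
contains only one sorted colouring. -/
lemma eq_coloring_levi {m n : ℕ} {c : Fin m → ℕ} (h : ∑ k, c k = n) {χ : Fin n →o Fin m}
    (hχ : ∀ k, colorCount χ k = c k) :
    (leviEmb c h).coloring (leviEmb_surjective c h) = χ :=
  DFunLike.coe_injective (eq_of_mem_orbit χ.monotone (OrderHom.monotone _)
    (mem_orbit_of_colorCount_eq fun k => by rw [colorCount_levi, hχ]))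

lemma firstEmb_ne_lastEmb {n i : ℕ} (hi : i ≤ n) (x : Fin (n - i)) (y : Fin i) :
    (firstEmb n i).emb x ≠ (lastEmb hi).emb y := by
  intro h
  have h1 : (x : ℕ) = y + (n - i) := congrArg Fin.val h
  omega

/-- The first and the last coordinates. -/
def partsEquiv {n i : ℕ} (hi : i ≤ n) : Fin (n - i) ⊕ Fin i ≃ Fin n :=
  Equiv.ofBijective (Sum.elim (firstEmb n i).emb (lastEmb hi).emb)
    ((Fintype.bijective_iff_injective_and_card _).mpr
      ⟨Function.Injective.sumElim (firstEmb n i).emb.injective (lastEmb hi).emb.injective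
        (firstEmb_ne_lastEmb hi), by simp [Nat.sub_add_cancel hi]⟩)

section Parts

variable {m : ℕ} {c r : Fin m → ℕ} (hr : r ≤ c)

lemma firstBlockEmb_lt_lastBlockEmb {x : Coord (c - r)} {y : Coord r} (h : block (c - r) x = block r y) :
    (firstBlockEmb c r).emb x < (lastBlockEmb hr).emb y := by
  obtain ⟨k, x⟩ := x
  obtain ⟨l, y⟩ := y
  obtain rfl : k = l := h
  refine Sigma.Lex.lt_def.mpr (Or.inr ⟨rfl, ?_⟩)
  change (x : ℕ) < y + (c k - r k)
  have h1 : (x : ℕ) < c k - r k := x.2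
  omega

lemma firstBlockEmb_ne_lastBlockEmb (x : Coord (c - r)) (y : Coord r) :
    (firstBlockEmb c r).emb x ≠ (lastBlockEmb hr).emb y := fun h =>
  (firstBlockEmb_lt_lastBlockEmb hr (congrArg (block c) h)).ne h

/-- The first and the last coordinates of the blocks. -/
def blockPartsEquiv : Coord (c - r) ⊕ Coord r ≃ Coord c :=
  Equiv.ofBijective (Sum.elim (firstBlockEmb c r).emb (lastBlockEmb hr).emb)
    ((Fintype.bijective_iff_injective_and_card _).mpr
      ⟨Function.Injective.sumElim (firstBlockEmb c r).emb.injective (lastBlockEmb hr).emb.injective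
        (firstBlockEmb_ne_lastBlockEmb hr), by
        rw [Fintype.card_sum, card_coord, card_coord, card_coord, ← Finset.sum_add_distrib]
        exact Finset.sum_congr rfl fun k _ => Nat.sub_add_cancel (hr k)⟩)

variable {n i : ℕ} (hc : ∑ k, c k = n) (hi : i ≤ n) (hri : ∑ k, r k = i)

/-- The permutation that moves the last coordinates of all blocks to the end. -/
def separate : Equiv.Perm (Fin n) :=
  (numbering c hc).toEquiv.symm.trans ((blockPartsEquiv hr).symm.trans
    (((numbering (c - r) (sum_sub hc hr hri)).toEquiv.sumCongr (numbering r hri).toEquiv).trans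
      (partsEquiv hi)))

lemma separate_first (x : Coord (c - r)) :
    separate hr hc hi hri ((leviEmb c hc).emb ((firstBlockEmb c r).emb x)) =
      (firstEmb n i).emb ((leviEmb (c - r) (sum_sub hc hr hri)).emb x) := by
  have h1 : (numbering c hc).toEquiv.symm ((leviEmb c hc).emb ((firstBlockEmb c r).emb x)) =
      blockPartsEquiv hr (Sum.inl x) := (numbering c hc).symm_apply_apply _
  rw [separate, Equiv.trans_apply, h1, Equiv.trans_apply, Equiv.symm_apply_apply]
  rfl

lemma separate_last (x : Coord r) :
    separate hr hc hi hri ((leviEmb c hc).emb ((lastBlockEmb hr).emb x)) =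
      (lastEmb hi).emb ((leviEmb r hri).emb x) := by
  have h1 : (numbering c hc).toEquiv.symm ((leviEmb c hc).emb ((lastBlockEmb hr).emb x)) =
      blockPartsEquiv hr (Sum.inr x) := (numbering c hc).symm_apply_apply _
  rw [separate, Equiv.trans_apply, h1, Equiv.trans_apply, Equiv.symm_apply_apply]
  rfl

/-- In each block the first coordinates precede the last ones before and after the move, and the
order within each of the two kinds is kept. So `separate` is shortest for its effect on the block
colouring. -/
lemma separate_mem_increasing : separate hr hc hi hri ∈
    increasing ((leviEmb c hc).coloring (leviEmb_surjective c hc)) := by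
  rw [mem_increasing]
  intro x y hxy hφ
  obtain ⟨x, rfl⟩ := leviEmb_surjective c hc x
  obtain ⟨y, rfl⟩ := leviEmb_surjective c hc y
  rw [OrderEmbedding.lt_iff_lt] at hxy
  rw [BlockEmb.coloring_apply, BlockEmb.coloring_apply] at hφ
  obtain ⟨x, rfl⟩ := (blockPartsEquiv hr).surjective x
  obtain ⟨y, rfl⟩ := (blockPartsEquiv hr).surjective y
  rcases x with x | x <;> rcases y with y | y
  · change (firstBlockEmb c r).emb x < (firstBlockEmb c r).emb y at hxy
    change separate hr hc hi hri ((leviEmb c hc).emb ((firstBlockEmb c r).emb x)) <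
      separate hr hc hi hri ((leviEmb c hc).emb ((firstBlockEmb c r).emb y))
    rw [OrderEmbedding.lt_iff_lt] at hxy
    rwa [separate_first, separate_first, OrderEmbedding.lt_iff_lt, OrderEmbedding.lt_iff_lt]
  · change separate hr hc hi hri ((leviEmb c hc).emb ((firstBlockEmb c r).emb x)) <
      separate hr hc hi hri ((leviEmb c hc).emb ((lastBlockEmb hr).emb y))
    rw [separate_first, separate_last]
    exact Fin.lt_def.mpr (lt_of_lt_of_le ((leviEmb (c - r) (sum_sub hc hr hri)).emb x).2
      (Nat.le_add_left (n - i) ((leviEmb r hri).emb y)))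
  · exact absurd hxy (firstBlockEmb_lt_lastBlockEmb hr hφ.symm).not_gt
  · change (lastBlockEmb hr).emb x < (lastBlockEmb hr).emb y at hxy
    change separate hr hc hi hri ((leviEmb c hc).emb ((lastBlockEmb hr).emb x)) <
      separate hr hc hi hri ((leviEmb c hc).emb ((lastBlockEmb hr).emb y))
    rw [OrderEmbedding.lt_iff_lt] at hxy
    rwa [separate_last, separate_last, OrderEmbedding.lt_iff_lt, OrderEmbedding.lt_iff_lt]

end Parts

/-! ### The Leibniz rule -/

open AffineHecke ColorSystem

lemma finite_tuples {m : ℕ} (c : Fin m → ℕ) (i : ℕ) : Finite (Tuples c i) :=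
  ((Set.finite_Iic c).subset fun _ h => h.1).to_subtype

section

variable {m n i : ℕ} {q : ℂ} {C : ColorSystem (Fin m) q} {c : Fin m → ℕ} (hc : ∑ k, c k = n)
  (hi : i ≤ n) {M : Type*} [AddCommGroup M] [Module ℂ M] [Module (Hn n q) M]
  [IsScalarTower ℂ (Hn n q) M]

/-- The inclusion of the derivative. -/
def derivativeSubtype : derivative hi q M →ₗ[ℂ] M where
  toFun v := show M from v.1
  map_add' _ _ := rfl
  map_smul' _ _ := rfl

lemma derivativeSubtype_injective : Function.Injective (derivativeSubtype (q := q) (M := M) hi) :=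
  Subtype.val_injective

lemma mem_range_derivativeSubtype (hq' : q ≠ 0) (hs : (∑ w : youngSubgroup (oneBlock i),
    (1 / q) ^ length (w : Equiv.Perm (Fin i))) ≠ 0) {v : M} :
    v ∈ LinearMap.range (derivativeSubtype (q := q) (M := M) hi) ↔ signElt hi q • v = v := by
  constructor
  · rintro ⟨⟨_, u, rfl⟩, rfl⟩
    change signElt hi q • signElt hi q • (show M from u) = signElt hi q • (show M from u)
    rw [smul_smul, signElt, ← map_mul, signProjector_mul_self hq' hs]
  · exact fun h => ⟨⟨v, ⟨v, h⟩⟩, rfl⟩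

lemma derivative_mem_colorSpace {ψ : Fin (n - i) → Fin m} {v : derivative hi q M} :
    v ∈ C.colorSpace (oneBlock (n - i)) (derivative hi q M) ψ ↔
      map (firstEmb n i) q (theta _ q (C.idem ψ)) • derivativeSubtype hi v =
        derivativeSubtype hi v :=
  ⟨fun h => congrArg Subtype.val h, fun h => Subtype.ext h⟩

variable (hM : C.Colored (oneBlock n) M)
  (horb : ∀ χ, C.colorSpace (oneBlock n) M χ ≠ ⊥ →
    χ ∈ orbit ((leviEmb c hc).coloring (leviEmb_surjective c hc)))

include horb in
lemma colorCount_add {ψ : Fin (n - i) → Fin m} {χ : Fin i → Fin m}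
    (h : C.colorSpace (oneBlock n) M (Sum.elim ψ χ ∘ (partsEquiv hi).symm) ≠ ⊥) (k : Fin m) :
    colorCount ψ k + colorCount χ k = c k := by
  rw [← colorCount_levi c hc, ← colorCount_of_mem_orbit (horb _ h), colorCount_comp,
    colorCount_sum]
  rfl

include hM horb in
/-- The colours of the derivative. -/
lemma exists_tuple {ψ : Fin (n - i) →o Fin m}
    (h : C.colorSpace (oneBlock (n - i)) (derivative hi q M) ψ ≠ ⊥) :
    ∃ r : Tuples c i, (leviEmb (c - r.1) (sum_sub hc r.2.1 r.2.2)).coloring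
      (leviEmb_surjective _ _) = ψ := by
  obtain ⟨v, hv, h0⟩ := Submodule.exists_mem_ne_zero_of_ne_bot h
  rw [derivative_mem_colorSpace] at hv
  -- Some component of `v` for the colours of the last coordinates is nonzero. It is taken in `M`
  -- and need not lie in the derivative; it only shows that the combined colouring occurs in `M`,
  -- and the tuple is then given by the colour counts of `χ`.
  have h1 : ∃ χ : Fin i → Fin m,
      map (lastEmb hi) q (theta _ q (C.idem χ)) • derivativeSubtype hi v ≠ 0 := by
    by_contra! hcon
    refine h0 (derivativeSubtype_injective hi ?_)
    have h2 : ∑ χ : Fin i → Fin m, map (lastEmb hi) q (theta _ q (C.idem χ)) •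
      derivativeSubtype hi v = derivativeSubtype hi v := (hM.res (lastEmb hi)).sum_idem_smul _
    rw [← h2, map_zero]
    exact Finset.sum_eq_zero fun χ _ => hcon χ
  obtain ⟨χ, hχ⟩ := h1
  have h2 : C.colorSpace (oneBlock n) M (Sum.elim ψ χ ∘ (partsEquiv hi).symm) ≠ ⊥ := by
    refine (Submodule.ne_bot_iff _).mpr ⟨_, ?_, hχ⟩
    rw [hM.mem_colorSpace_iff (firstEmb n i) (lastEmb hi) (partsEquiv hi) (fun _ => rfl)
      fun _ => rfl]
    refine ⟨?_, (hM.res (lastEmb hi)).idem_smul_mem χ _⟩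
    rw [smul_smul, (commute_map_map _ _ (firstEmb_ne_lastEmb hi) q _ _).eq, mul_smul, hv]
  have h3 := colorCount_add hc hi horb h2
  refine ⟨⟨colorCount χ, fun k => ?_, ?_⟩, eq_coloring_levi _ fun k => ?_⟩
  · rw [← h3 k]
    exact Nat.le_add_left _ _
  · rw [sum_colorCount, Fintype.card_fin]
  · exact Nat.eq_sub_of_add_eq (h3 k)

end

lemma coloring_injective {m n i : ℕ} {c : Fin m → ℕ} (hc : ∑ k, c k = n) :
    Function.Injective fun r : Tuples c i =>
      (leviEmb (c - r.1) (sum_sub hc r.2.1 r.2.2)).coloring (leviEmb_surjective _ _) := by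
  intro r r' h
  refine Subtype.ext (funext fun k => ?_)
  have h1 : c k - r.1 k = c k - r'.1 k :=
    (colorCount_levi _ _ k).symm.trans
      ((congrArg (fun ψ : Fin (n - i) →o Fin m => colorCount ψ k) h).trans (colorCount_levi _ _ k))
  have h2 : r.1 k ≤ c k := r.2.1 k
  have h3 : r'.1 k ≤ c k := r'.2.1 k
  omega

section

variable {m n i : ℕ} {q : ℂ} {C : ColorSystem (Fin m) q} {c : Fin m → ℕ} (hc : ∑ k, c k = n)
  (hi : i ≤ n) {M : Type*} [AddCommGroup M] [Module ℂ M] [Module (Hn n q) M]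
  [IsScalarTower ℂ (Hn n q) M] [FiniteDimensional ℂ M]
  {Y : Type*} [AddCommGroup Y] [Module ℂ Y] [Module (Hblock c q) Y] [IsScalarTower ℂ (Hblock c q) Y]
  (r : Tuples c i)

/-- The embedding of a derivative of the inducing module. -/
def derivativeMap (C : ColorSystem (Fin m) q) (ι : Y →ₗ[ℂ] M) :
    blockDerivative r.2.1 q Y →ₗ[ℂ] derivative hi q M where
  toFun v := ⟨C.signIntertwiner (lastEmb hi) ((leviEmb c hc).coloring (leviEmb_surjective c hc))
    (separate r.2.1 hc hi r.2.2) ι (show Y from v.1), ⟨_, (signIntertwiner_apply _ ι _).symm⟩⟩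
  map_add' _ _ := Subtype.ext (map_add (C.signIntertwiner (lastEmb hi) _ _ ι) _ _)
  map_smul' _ _ := Subtype.ext (map_smul (C.signIntertwiner (lastEmb hi) _ _ ι) _ _)

end

section

variable {m n i : ℕ} {q : ℂ} {C : ColorSystem (Fin m) q} {c : Fin m → ℕ} (hc : ∑ k, c k = n)
  (hi : i ≤ n) {M : Type*} [AddCommGroup M] [Module ℂ M] [Module (Hn n q) M]
  [IsScalarTower ℂ (Hn n q) M] [FiniteDimensional ℂ M]
  {Y : Type*} [AddCommGroup Y] [Module ℂ Y] [Module (Hblock c q) Y] [IsScalarTower ℂ (Hblock c q) Y]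

lemma smul_of_mem_blockDerivative {r : Fin m → ℕ} (hr : r ≤ c) (hq' : q ≠ 0)
    (hs : (∑ w : youngSubgroup (block r), (1 / q) ^ length (w : Equiv.Perm (Coord r))) ≠ 0)
    (v : blockDerivative hr q Y) : signBlockElt hr q • (show Y from v.1) = (show Y from v.1) := by
  obtain ⟨_, u, rfl⟩ := v
  change signBlockElt hr q • signBlockElt hr q • (show Y from u) =
    signBlockElt hr q • (show Y from u)
  rw [smul_smul, signBlockElt, ← map_mul, signProjector_mul_self hq' hs]

variable (hM : C.Colored (oneBlock n) M)
  (horb : ∀ χ, C.colorSpace (oneBlock n) M χ ≠ ⊥ →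
    χ ∈ orbit ((leviEmb c hc).coloring (leviEmb_surjective c hc))) {ι : Y →ₗ[ℂ] M}
  (hι : ∀ (y : Hblock c q) v, ι (y • v) = map (leviEmb c hc) q y • ι v)
  (hinj : Function.Injective ι)
  (hrange : LinearMap.range ι =
    C.colorSpace (oneBlock n) M ((leviEmb c hc).coloring (leviEmb_surjective c hc)))
  (hq0 : q ≠ 0)
  (hs : ∀ {I κ : Type} [Fintype I] [LinearOrder I] [PartialOrder κ] (b : I →o κ),
    (∑ w : youngSubgroup b, (1 / q) ^ length (w : Equiv.Perm I)) ≠ 0)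

include hM horb hι hinj hrange hq0 hs in
-- `Colored.nonempty_equiv_ind` for the derivative as a module over `ℋ_{n-i}`: the possible sorted
-- colourings are indexed by the tuples `r`, and `derivativeMap` identifies the part of each with
-- the corresponding derivative of the inducing module.
lemma nonempty_equiv_derivative : Nonempty (derivative hi q M ≃ₗ[Hn (n - i) q]
    ⨁ r : Tuples c i, Ind (levi (c - r.1) (sum_sub hc r.2.1 r.2.2) q)
      (blockDerivative r.2.1 q Y)) := by
  classical
  have := finite_tuples c i
  let := Fintype.ofFinite (Tuples c i)
  have hfin : FiniteDimensional ℂ (derivative hi q M) :=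
    Module.Finite.of_injective _ (derivativeSubtype_injective hi)
  -- If the first coordinates use colour `k` exactly `c k - r k` times, the last ones use it `r k`
  -- times, which leaves one sorted colouring.
  have hall : ∀ (r : Tuples c i) (χ : Fin i →o Fin m), C.colorSpace (oneBlock n) M
      (Sum.elim ((leviEmb (c - r.1) (sum_sub hc r.2.1 r.2.2)).coloring (leviEmb_surjective _ _)) χ ∘
        (partsEquiv hi).symm) ≠ ⊥ →
      (leviEmb r.1 r.2.2).coloring (leviEmb_surjective _ _) = χ := fun r χ h =>
    eq_coloring_levi _ fun k => by
      have h1 := colorCount_add hc hi horb h k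
      rw [colorCount_levi, Pi.sub_apply] at h1
      have h2 : r.1 k ≤ c k := r.2.1 k
      omega
  have hN : C.Colored (oneBlock (n - i)) (derivative hi q M) :=
    (hM.res (firstEmb n i)).submodule (derivative hi q M)
  obtain ⟨Φ, -⟩ := hN.nonempty_equiv_ind (R := Tuples c i) (I := fun r => Coord (c - r.1))
    (b := fun r => block (c - r.1)) (fun r => leviEmb (c - r.1) (sum_sub hc r.2.1 r.2.2))
    (fun r => leviEmb_surjective _ _) (Y := fun r => blockDerivative r.2.1 q Y)
    (fun r => derivativeMap hc hi r C ι)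
    (fun r y v => Subtype.ext (hM.signIntertwiner_smul (A := firstEmb n i) (e := partsEquiv hi)
      (fun _ => rfl) (fun _ => rfl) (leviEmb_surjective c hc) (fun _ => rfl)
      (separate_mem_increasing r.2.1 hc hi r.2.2) (separate_first r.2.1 hc hi r.2.2)
      hι hrange y v.1))
    (fun r => (injective_iff_map_eq_zero _).mpr fun v hv => Subtype.ext
      (hM.signIntertwiner_eq_zero (A := firstEmb n i) (B := lastEmb hi) (e := partsEquiv hi)
        (fun _ => rfl) (fun _ => rfl) (leviEmb_surjective c hc) (fun _ => rfl) (fun _ => rfl)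
        (leviEmb_surjective _ _) (leviEmb_surjective _ _)
        (separate_mem_increasing r.2.1 hc hi r.2.2) (separate_first r.2.1 hc hi r.2.2)
        (separate_last r.2.1 hc hi r.2.2) hι hinj hrange (fun b => hs b) (hs _) (hall r)
        (smul_of_mem_blockDerivative r.2.1 hq0 (hs _) v) (congrArg Subtype.val hv)))
    (fun r => by
      refine le_antisymm ?_ fun z hz => ?_
      · rintro _ ⟨v, rfl⟩
        exact derivative_mem_colorSpace hi |>.mpr
          (hM.theta_smul_signIntertwiner (A := firstEmb n i) (B := lastEmb hi) (e := partsEquiv hi)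
          (fun _ => rfl) (fun _ => rfl) (leviEmb_surjective c hc) (fun _ => rfl) (fun _ => rfl)
          (leviEmb_surjective _ _) (leviEmb_surjective _ _)
          (separate_first r.2.1 hc hi r.2.2) (separate_last r.2.1 hc hi r.2.2) _)
      · obtain ⟨v, hv, hvz⟩ := hM.exists_signIntertwiner_eq (A := firstEmb n i) (B := lastEmb hi)
          (e := partsEquiv hi)
          (fun _ => rfl) (fun _ => rfl) (leviEmb_surjective c hc) (fun _ => rfl) (fun _ => rfl)
          (leviEmb_surjective _ _) (leviEmb_surjective _ _)
          (separate_mem_increasing r.2.1 hc hi r.2.2) (separate_first r.2.1 hc hi r.2.2)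
          (separate_last r.2.1 hc hi r.2.2) hι hinj hrange (fun b => hs b) (hs _) hq0 (hall r)
          ((derivative_mem_colorSpace hi).mp hz)
          ((mem_range_derivativeSubtype hi hq0 (hs _)).mp ⟨z, rfl⟩)
        exact ⟨⟨v, ⟨v, hv⟩⟩, Subtype.ext hvz⟩)
    (coloring_injective hc) (fun ψ hψ => exists_tuple hc hi hM horb hψ)
  exact ⟨Φ.symm⟩

end

end BZ

end

theorem theorem5p3 (q : ℝ) (hq : 1 < q) {n m : ℕ} (c : Fin m → ℕ) (hc : ∑ k, c k = n)
    (t : Fin n → ℂˣ)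
    (ht : ∀ x y : BZ.Coord c, BZ.unitaryPart (t (BZ.numbering c hc x)) =
      BZ.unitaryPart (t (BZ.numbering c hc y)) ↔ BZ.block c x = BZ.block c y)
    (i : ℕ) (hi : i ≤ n)
    (π : Type*) [AddCommGroup π] [Module ℂ π] [Module (BZ.Hn n q) π]
    [IsScalarTower ℂ (BZ.Hn n q) π] [FiniteDimensional ℂ π]
    (hπ : BZ.AnnihilatedByPower (BZ.oneBlock n) q t π)
    (σ : Type*) [AddCommGroup σ] [Module ℂ σ] [Module (BZ.Hblock c q) σ]
    [IsScalarTower ℂ (BZ.Hblock c q) σ] [FiniteDimensional ℂ σ]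
    (hσ : BZ.AnnihilatedByPower (BZ.block c) q (fun x => t (BZ.numbering c hc x)) σ)
    (hπσ : Nonempty (π ≃ₗ[BZ.Hn n q] BZ.Ind (BZ.levi c hc q) σ)) :
    Nonempty (BZ.derivative hi q π ≃ₗ[BZ.Hn (n - i) q]
      ⨁ r : BZ.Tuples c i, BZ.Ind (BZ.levi (c - r.1) (BZ.sum_sub hc r.2.1 r.2.2) q)
        (BZ.blockDerivative r.2.1 q σ)) := by
  obtain ⟨e⟩ := hπσ
  obtain ⟨N, hN⟩ := hπ.exists_pow_smul_eq_zero
  -- The exponent is taken from `π`, so that the product of the `Q k` is the polynomial that kills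
  -- every coordinate function on `π`.
  obtain ⟨C, hC, hC'⟩ := BZ.exists_colorSystem hq (fun x => t (BZ.numbering c hc x)) (BZ.block c)
    (fun x y => (ht x y).mp) N
  have hM : C.Colored (BZ.oneBlock n) π := fun a v => by
    have h : ∏ x, (Polynomial.X - Polynomial.C (t (BZ.numbering c hc x) : ℂ)) =
        ∏ x, (Polynomial.X - Polynomial.C (t x : ℂ)) :=
      (BZ.numbering c hc).toEquiv.prod_comp fun x => Polynomial.X - Polynomial.C (t x : ℂ)
    rw [hC, h]
    exact hN a v
  obtain ⟨ι, h1, h2, h3, h4⟩ := BZ.exists_sorted_inclusion (BZ.leviEmb c hc)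
    (BZ.leviEmb_surjective c hc) e hM hσ hC'
  have hq0 : (q : ℂ) ≠ 0 := by exact_mod_cast (by linarith : q ≠ 0)
  exact BZ.nonempty_equiv_derivative hc hi hM h4 h1 h2 h3 hq0
    fun b => BZ.AffineHecke.sum_inv_pow_length_ne_zero b hq
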